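/- Let $\phi_\epsilon(x,y)=e^{-\epsilon^2|x-y|^2}$ with $\epsilon>0$, let $h>0$, $x_i=x_0+ih$, and for integers $p\ge q\ge 1$ let $S=\{-p,\dots,p\}$, $\mu=\{-q,\dots,q\}\setminus\{0\}$. The Gaussian RBF-HFD weights $(\alpha_i)_{i\in S}$, $(\beta_k)_{k\in\mu}$ of the formula $$u''(x_0)\approx\sum_{i\in S}\alpha_iu(x_i)+\sum_{k\in\mu}\beta_ku''(x_k)$$ are, together with a number $\gamma$, the solution of the linear system $$\sum_{j\in S}\alpha_j\phi_\epsilon(x_j,x_i)+\sum_{k\in\mu}\beta_k\,\partial_x^2\phi_\epsilon(x_k,x_i)+\gamma=\partial_x^2\phi_\epsilon(x_0,x_i)\quad(i\in S),$$ $$\sum_{j\in S}\alpha_j\,\partial_y^2\phi_\epsilon(x_j,x_l)+\sum_{k\in\mu}\beta_k\,\partial_x^2\partial_y^2\phi_\epsilon(x_k,x_l)=\partial_x^2\partial_y^2\phi_\epsilon(x_0,x_l)\quad(l\in\mu),\qquad \sum_{j\in S}\alpha_j=0 .$$ The system truncated at order $N$ is obtained by replacing every element, as a function of $h$, by its Taylor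 polynomial of degree $N$ at $h=0$. The local truncation error is $\tau_0=\sum_{i\in S}\alpha_iu(x_i)+\sum_{k\in\mu}\beta_ku''(x_k)-u''(x_0)$. Consider the systems: order $4$, $(p,q)=(1,1)$; order $6$, $(p,q)=(2,1)$; order $8$, $(p,q)=(2,2)$, both truncated at order $18$ and without truncation; order $10$, $(p,q)=(3,2)$, both truncated at order $24$ and without truncation. For each there is $\delta>0$ such that for all $\epsilon,h>0$ with $\epsilon h<\delta$ the system has exactly one solution; it does not depend on $x_0$, it satisfies $\alpha_{-i}=\alpha_i$, $\beta_{-k}=\beta_k$, and the following expansions hold, with $O$-constants independent of $\epsilon,h$. Order 4: $\alpha_0=-\frac{12}{5h^2}-\frac{84\epsilon^2}{125}+\frac{3021\epsilon^4h^2}{3125}+\frac{92969\epsilon^6h^4}{234375}+O(\epsilon^8h^6)$, $\alpha_{\pm1}=\frac{6}{5h^2}+\frac{42\epsilon^2}{125}-\frac{3021\epsilon^4h^2}{6250}-\frac{92969\epsilon^6h^4}{468750}+O(\epsilon^8h^6)$, $\beta_{\pm1}=-\frac1{10}-\frac{26250\epsilon^2h^2}{156250}-\frac{16925\epsilon^4h^4}{156250}-\frac{651\epsilon^6h^6}{156250}+O(\epsilon^8h^8)$.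 Order 6: $\alpha_0=-\frac{51}{22h^2}+\frac{621\epsilon^2}{1694}+\frac{2841651\epsilon^4h^2}{1304380}+\frac{5555227\epsilon^6h^4}{14348180}+O(\epsilon^8h^6)$, $\alpha_{\pm1}=\frac{12}{11h^2}-\frac{414\epsilon^2}{847}-\frac{538116\epsilon^4h^2}{326095}-\frac{4542297\epsilon^6h^4}{7174090}+O(\epsilon^8h^6)$, $\alpha_{\pm2}=\frac{3}{44h^2}+\frac{1035\epsilon^2}{3388}+\frac{1463277\epsilon^4h^2}{2608760}+\frac{12613961\epsilon^6h^4}{28696360}+O(\epsilon^8h^6)$, $\beta_{\pm1}=-\frac{2}{11}-\frac{79381958040\epsilon^2h^2}{216542732560}-\frac{64254114540\epsilon^4h^4}{216542732560}-\frac{8624761068\epsilon^6h^6}{216542732560}+O(\epsilon^8h^8)$. Order 8, truncated at order 18: $\alpha_0=-\frac{265}{131h^2}+\frac{257224\epsilon^2}{154449}+\frac{374495573482511\epsilon^4h^2}{163157452416}+O(\epsilon^6h^4)$, $\alpha_{\pm1}=\frac{320}{393h^2}-\frac{723008\epsilon^2}{463347}-\frac{131554452784583\epsilon^4h^2}{61184044656}+O(\epsilon^6h^4)$,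 $\alpha_{\pm2}=\frac{155}{786h^2}+\frac{337172\epsilon^2}{463347}+\frac{981384524105795\epsilon^4h^2}{978944714496}+O(\epsilon^6h^4)$, $\beta_{\pm1}=-\frac{344}{1179}-\frac{862048\epsilon^2h^2}{1390041}-\frac{313528367747261\epsilon^4h^4}{367104267936}+O(\epsilon^6h^6)$, $\beta_{\pm2}=-\frac{23}{2358}-\frac{76472\epsilon^2h^2}{1390041}-\frac{111386667913345\epsilon^4h^4}{1468417071744}+O(\epsilon^6h^6)$. Without truncation the same holds, except that the third coefficients of $\alpha_0,\alpha_{\pm1},\alpha_{\pm2},\beta_{\pm1},\beta_{\pm2}$ are $\frac{144176866}{47209911},-\frac{347214464}{141629733},\frac{130949165}{141629733},-\frac{207500044}{424889199},-\frac{57373250}{424889199}$. Order 10 (truncated at order 24, and also without truncation): $\alpha_0=-\frac{14335}{8091h^2}+\frac{67795975\epsilon^2}{26670633}+\frac{14201025431705\epsilon^4h^2}{4747426015266}+O(\epsilon^6h^4)$, $\alpha_{\pm1}=\frac{1065}{1798h^2}-\frac{79866475\epsilon^2}{35560844}-\frac{4626851267795\epsilon^4h^2}{2109967117896}+O(\epsilon^6h^4)$,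 $\alpha_{\pm2}=\frac{519}{1798h^2}+\frac{16456115\epsilon^2}{17780422}+\frac{501398734735\epsilon^4h^2}{1054983558948}+O(\epsilon^6h^4)$, $\alpha_{\pm3}=\frac{79}{16182h^2}+\frac{5270785\epsilon^2}{106682532}+\frac{4214433321515\epsilon^4h^2}{18989704061064}+O(\epsilon^6h^4)$, $\beta_{\pm1}=-\frac{334}{899}-\frac{21525725\epsilon^2h^2}{26670633}-\frac{771306629605\epsilon^4h^4}{1582475338422}+O(\epsilon^6h^6)$, $\beta_{\pm2}=-\frac{43}{1798}-\frac{3822325\epsilon^2h^2}{26670633}-\frac{578232844745\epsilon^4h^4}{1582475338422}+O(\epsilon^6h^6)$. Truncation errors: let $m\in\{4,6,8,10\}$ be the order and let $u$ be $C^{m+4}$ near $x_0$. Then, with derivatives of $u$ at $x_0$, for $h$ and $\epsilon h$ small, and with $O$-constants depending only on the system, $u$ and $x_0$, $$\tau_0=-\tfrac{h^4}{200}\bigl(140\epsilon^4u''+28\epsilon^2u^{(4)}+u^{(6)}\bigr)+O\bigl(h^6P_3(\epsilon^2)\bigr),$$ $$\tau_0=\tfrac{23h^6}{55440}\bigl(2520\epsilon^6u''+756\epsilon^4u^{(4)}+54\epsilon^2u^{(6)}+u^{(8)}\bigr)+O\bigl(h^8P_4(\epsilon^2)\bigr),$$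 $$\tau_0=-\tfrac{79h^8}{2971080}\bigl(55440\epsilon^8u''+22176\epsilon^6u^{(4)}+2376\epsilon^4u^{(6)}+88\epsilon^2u^{(8)}+u^{(10)}\bigr)+O\bigl(h^{10}P_5(\epsilon^2)\bigr),$$ $$\tau_0=\tfrac{619h^{10}}{299043360}\bigl(1441440\epsilon^{10}u''+720720\epsilon^8u^{(4)}+102960\epsilon^6u^{(6)}+5720\epsilon^4u^{(8)}+130\epsilon^2u^{(10)}+u^{(12)}\bigr)+O\bigl(h^{12}P_6(\epsilon^2)\bigr)$$ for the orders $4,6,8,10$ respectively, where $P_k(z)=1+z+\dots+z^k$. Flat limit: for every fixed $h>0$, as $\epsilon\to0^+$ the weights tend to those of the compact finite difference formulas of Collatz (orders 4, 6, 8) and Lele (order 10), namely $(h^2\alpha_0,h^2\alpha_{\pm1},\dots;\beta_{\pm1},\dots)\to$ $(-\frac{12}5,\frac65;-\frac1{10})$, $(-\frac{51}{22},\frac{12}{11},\frac3{44};-\frac2{11})$, $(-\frac{265}{131},\frac{320}{393},\frac{155}{786};-\frac{344}{1179},-\frac{23}{2358})$, $(-\frac{14335}{8091},\frac{1065}{1798},\frac{519}{1798},\frac{79}{16182};-\frac{334}{899},-\frac{43}{1798})$,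 respectively. The truncation errors of these compact formulas are $-\frac{h^4}{200}u^{(6)}+O(h^6)$, $\frac{23h^6}{55440}u^{(8)}+O(h^8)$, $-\frac{79h^8}{2971080}u^{(10)}+O(h^{10})$, $\frac{619h^{10}}{299043360}u^{(12)}+O(h^{12})$. -/

import Mathlib

open Set Filter Topology

noncomputable section

namespace RBFHFD

/-- The Gaussian radial function with shape parameter `ε`, as a function of the evaluation point `x`
and the centre `y`. -/
def gaussian (ε x y : ℝ) : ℝ := Real.exp (-(ε ^ 2 * ‖x - y‖ ^ 2))

/-- The operator `u ↦ u''` acting on the first argument of a kernel. -/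
def L1 (K : ℝ → ℝ → ℝ) (x y : ℝ) : ℝ := iteratedDeriv 2 (fun s => K s y) x

/-- The operator `u ↦ u''` acting on the second argument of a kernel. -/
def L2 (K : ℝ → ℝ → ℝ) (x y : ℝ) : ℝ := iteratedDeriv 2 (fun s => K x s) y

/-- Indices of the nodes `x₀ + i h`, `-p ≤ i ≤ p`, that carry function values. -/
def support (p : ℕ) : Finset ℤ := Finset.Icc (-(p : ℤ)) p

/-- Indices of the nodes `x₀ + k h`, `-q ≤ k ≤ q`, `k ≠ 0`, that carry values of `u''`. -/
def deletedSupport (q : ℕ) : Finset ℤ := (support q).erase 0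

/-- Replacement of a matrix element, seen as a function of the step size, by its Taylor polynomial
of degree `N` at step size `0`. -/
def taylorTruncation (N : ℕ) (f : ℝ → ℝ) (h : ℝ) : ℝ := taylorWithinEval f N univ 0 h

/-- The Hermite collocation system, augmented by constants, for the weights of the formula
`u''(x₀) ≈ ∑ α i * u(x₀ + i h) + ∑ β k * u''(x₀ + k h)`: the formula is collocated on the Gaussians
centred at the nodes of the support (up to the common constant `γ`) and on their second derivatives
with respect to the centre at the nodes of the deleted support, and it annihilates constants.
Every non-constant element of the system, seen as a function of the step size, is passed
through `T`: the choice `T = id` gives the system itself, the choice `T = taylorTruncation N`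
gives the system with all elements expanded up to order `N`.
The weights are indexed by `ℤ` and vanish off the stencil. -/
structure IsWeights (T : (ℝ → ℝ) → ℝ → ℝ) (p q : ℕ) (x₀ ε h : ℝ)
    (α β : ℤ → ℝ) (γ : ℝ) : Prop where
  α_off : ∀ i, i ∉ support p → α i = 0
  β_off : ∀ k, k ∉ deletedSupport q → β k = 0
  colloc_function : ∀ i ∈ support p,
    (∑ j ∈ support p, α j * T (fun s => gaussian ε (x₀ + j * s) (x₀ + i * s)) h)
      + (∑ k ∈ deletedSupport q, β k * T (fun s => L1 (gaussian ε) (x₀ + k * s) (x₀ + i * s)) h)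
      + γ
      = T (fun s => L1 (gaussian ε) x₀ (x₀ + i * s)) h
  colloc_operator : ∀ l ∈ deletedSupport q,
    (∑ j ∈ support p, α j * T (fun s => L2 (gaussian ε) (x₀ + j * s) (x₀ + l * s)) h)
      + (∑ k ∈ deletedSupport q,
          β k * T (fun s => L1 (L2 (gaussian ε)) (x₀ + k * s) (x₀ + l * s)) h)
      = T (fun s => L1 (L2 (gaussian ε)) x₀ (x₀ + l * s)) h
  colloc_one : ∑ j ∈ support p, α j = 0

/-- The local truncation error at `x₀` of the formula with weights `α`, `β`. -/
def truncationError (p q : ℕ) (α β : ℤ → ℝ) (h : ℝ) (u : ℝ → ℝ) (x₀ : ℝ) : ℝ :=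
  (∑ i ∈ support p, α i * u (x₀ + i * h))
    + (∑ k ∈ deletedSupport q, β k * iteratedDeriv 2 u (x₀ + k * h))
    - iteratedDeriv 2 u x₀

/-- The system determined by `T`, `p`, `q` has, for `ε h` small, exactly one solution; it does not
depend on `x₀`, it is symmetric, and
* `α_{±j} = h⁻² (∑_{r < R} a j r (ε h)^{2r} + O((ε h)^{2R}))`,
* `β_{±(k+1)} = ∑_{r < R} b k r (ε h)^{2r} + O((ε h)^{2R})`,
* with `n = p + q` and `m = 2 n`, the local truncation error is
  `κ h^m ∑_{s ≤ n} c s ε^{2s} u^{(m+2-2s)}(x₀) + O(h^{m+2} P(ε²))`, where `P` has degree `n + 1`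
  and the bound is uniform in `ε` and `h` as long as `h` and `ε h` are small. -/
def HasExpansion (T : (ℝ → ℝ) → ℝ → ℝ) (p q R : ℕ)
    (a : Fin (p + 1) → Fin R → ℝ) (b : Fin q → Fin R → ℝ)
    (κ : ℝ) (c : Fin (p + q + 1) → ℝ) (A : Fin (p + 1) → ℝ) (B : Fin q → ℝ) : Prop :=
  ∃ (α β : ℝ → ℝ → ℤ → ℝ) (γ : ℝ → ℝ → ℝ) (δ : ℝ), 0 < δ ∧
    -- unique solvability
    (∀ x₀ ε h : ℝ, 0 < ε → 0 < h → ε * h < δ →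
      ∀ (α' β' : ℤ → ℝ) (γ' : ℝ), IsWeights T p q x₀ ε h α' β' γ' ↔
        (α' = α ε h ∧ β' = β ε h ∧ γ' = γ ε h)) ∧
    -- symmetry
    (∀ ε h : ℝ, 0 < ε → 0 < h → ε * h < δ → ∀ i : ℤ,
      α ε h (-i) = α ε h i ∧ β ε h (-i) = β ε h i) ∧
    -- expansions of the weights
    (∃ C : ℝ, ∀ ε h : ℝ, 0 < ε → 0 < h → ε * h < δ →
      (∀ j : Fin (p + 1),
        |α ε h (j : ℕ) - ∑ r : Fin R, a j r * ε ^ (2 * (r : ℕ)) * h ^ (2 * (r : ℕ)) / h ^ 2|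
          ≤ C * (ε ^ (2 * R) * h ^ (2 * R) / h ^ 2)) ∧
      (∀ k : Fin q,
        |β ε h ((k : ℕ) + 1) - ∑ r : Fin R, b k r * ε ^ (2 * (r : ℕ)) * h ^ (2 * (r : ℕ))|
          ≤ C * (ε ^ (2 * R) * h ^ (2 * R)))) ∧
    -- local truncation error
    (∀ (u : ℝ → ℝ) (x₀ : ℝ), ContDiffAt ℝ ((2 * (p + q) + 4 : ℕ) : WithTop ℕ∞) u x₀ →
      ∃ C η : ℝ, 0 < η ∧ ∀ ε h : ℝ, 0 < ε → 0 < h → h < η → ε * h < η →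
        |truncationError p q (α ε h) (β ε h) h u x₀
            - κ * h ^ (2 * (p + q)) * ∑ s : Fin (p + q + 1),
                c s * ε ^ (2 * (s : ℕ)) * iteratedDeriv (2 * (p + q) + 2 - 2 * (s : ℕ)) u x₀|
          ≤ C * (h ^ (2 * (p + q) + 2) * ∑ s ∈ Finset.range (p + q + 2), ε ^ (2 * s))) ∧
    -- flat limit, for every fixed step size
    (∀ h : ℝ, 0 < h →
      (∀ j : Fin (p + 1), Tendsto (fun ε => α ε h (j : ℕ)) (𝓝[>] 0) (𝓝 (A j / h ^ 2))) ∧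
      (∀ k : Fin q, Tendsto (fun ε => β ε h ((k : ℕ) + 1)) (𝓝[>] 0) (𝓝 (B k))))

/-- The symmetric polynomial compact finite difference formula with weights `A j / h²` of
`u(x₀ ± j h)` and `B k` of `u''(x₀ ± (k+1) h)` has, with `m = 2 (p + q)`, the local truncation error
`κ h^m u^{(m+2)}(x₀) + O(h^{m+2})`. -/
def IsCompactFD (p q : ℕ) (A : Fin (p + 1) → ℝ) (B : Fin q → ℝ) (κ : ℝ) : Prop :=
  ∀ (u : ℝ → ℝ) (x₀ : ℝ), ContDiffAt ℝ ((2 * (p + q) + 4 : ℕ) : WithTop ℕ∞) u x₀ →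
    ∃ C η : ℝ, 0 < η ∧ ∀ h : ℝ, 0 < h → h < η →
      ∀ α β : ℤ → ℝ,
        (∀ j : Fin (p + 1), α (j : ℕ) = A j / h ^ 2 ∧ α (-((j : ℕ) : ℤ)) = A j / h ^ 2) →
        (∀ k : Fin q, β ((k : ℕ) + 1) = B k ∧ β (-(((k : ℕ) : ℤ) + 1)) = B k) →
        |truncationError p q α β h u x₀
            - κ * h ^ (2 * (p + q)) * iteratedDeriv (2 * (p + q) + 2) u x₀|
          ≤ C * h ^ (2 * (p + q) + 2)

end RBFHFD

end

/-! Write `n = p + q` and `t = ε h`. Scaling the rows by powers of `h`, and `α`, `γ` by `h²`, turns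
the system into one whose entries depend on `t` alone (`isWeights_iff`). Its weights belong to `2 n
+ 1` functionals, namely values and second derivatives at integer nodes. If `exp (-(x - y)²) = ∑ G a
b x^a y^b`, the entry for functionals `ρ`, `σ` is `∑ G a b ρ(x^a) σ(y^b) t^(a+b)`, up to the order
where truncation acts. So the matrix becomes singular as `t → 0`.

The cure is to replace the weights by their moments, the values of the combined functional at `x^a`,
`a ≤ 2 n`. A rational table `W`, inverse to the confluent Vandermonde matrix, converts between the
two. Combined by `W` on both sides, entry `(a, b)` is `G a b t^(a+b)` to leading order
(`IsDual.isBigO_reduced`), and diagonal scalings remove the powers of `t`. The sections of `G` in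
use are positive definite, because `exp (-(x - y)²) = ∑ (2^k / k!) (x^k exp (-x²)) (y^k exp (-y²))`
is a triangular factorization. Hence the scaled system is uniformly well-posed for small `t`
(`eventually_abs_le`). This gives unique solvability; uniqueness and reflection give symmetry. It
also turns a residual into an error bound.

For the expansions, a candidate is prescribed by its even moments: moment `2 a` differs from that of
`u ↦ u''(0)` by `t^(2(n+1-a)) μ_a(t²)`, with `μ_a` a rational polynomial. If the residual of
equation `2 b` is `O(t^(2(b+n+R)))`, stability puts the moments within `O(t^(2(n+R-a)))` of the true
ones, hence the weights within `O(t^(2R))` (`IsDual.isBigO_combined`, `IsDual.isBigO_solution`). The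
residual condition is a finite list of rational identities, checked by evaluation. Truncating the
elements matters only if it removes a degree that these identities see. For order 8 and truncation
at 18 the term `t^20` of the undifferentiated elements is lost; this is the parameter `θ`, and it
alters the third coefficients. For order 10 and truncation at 24 nothing relevant is lost.

The truncation error is the Taylor series of `u` paired with the moment defects. Degree `2 a`
contributes `h^(2a-2) t^(2(n+1-a)) = h^(2n) ε^(2(n+1-a))`, so all even degrees up to `2 n + 2` enter
at the same order in `h`. The weights tend to `2 W ρ 2`, the combination dual to `x²`, which is the
compact finite difference formula. -/

namespace RBFHFD

open Asymptotics

/-! ### The Gaussian and its Taylor coefficients -/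

/-- The Gaussian with unit shape parameter, centred at the origin. -/
noncomputable def bump (x : ℝ) : ℝ := Real.exp (-x ^ 2)

lemma contDiff_bump {n : WithTop ℕ∞} : ContDiff ℝ n bump := by
  unfold bump; fun_prop

lemma contDiff_iteratedDeriv_bump (k : ℕ) {n : ℕ} : ContDiff ℝ n (iteratedDeriv k bump) := by
  rw [iteratedDeriv_eq_iterate]
  exact ContDiff.iterate_deriv' n k contDiff_bump

lemma hasDerivAt_iteratedDeriv_bump (k : ℕ) (x : ℝ) :
    HasDerivAt (iteratedDeriv k bump) (iteratedDeriv (k + 1) bump x) x := by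
  rw [iteratedDeriv_succ]
  exact ((contDiff_iteratedDeriv_bump k (n := 1)).differentiable (by norm_num) x).hasDerivAt

lemma iteratedDeriv_bump_one (x : ℝ) : iteratedDeriv 1 bump x = -2 * x * bump x := by
  rw [iteratedDeriv_one]
  have h : HasDerivAt bump (Real.exp (-x ^ 2) * (-((2 : ℕ) * x ^ 1))) x :=
    ((hasDerivAt_pow 2 x).neg).exp
  rw [h.deriv]; simp [bump]; ring

/-- Hermite recurrence, obtained by differentiating `f' = -2 x f` repeatedly. At `x = 0` it becomes
the recursion defining `gaussCoeff`. -/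
lemma iteratedDeriv_bump_add_two (k : ℕ) : ∀ x, iteratedDeriv (k + 2) bump x
    = -2 * x * iteratedDeriv (k + 1) bump x - 2 * (k + 1) * iteratedDeriv k bump x := by
  induction k with
  | zero =>
    intro x
    have h1 : iteratedDeriv 1 bump = fun x => -2 * x * bump x := funext iteratedDeriv_bump_one
    have h2 : HasDerivAt (fun x => -2 * x * bump x)
        (-2 * 1 * bump x + -2 * x * iteratedDeriv 1 bump x) x :=
      ((hasDerivAt_id x).const_mul (-2)).mul (by
        simpa using hasDerivAt_iteratedDeriv_bump 0 x)
    rw [iteratedDeriv_succ, h1, h2.deriv]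
    simp only [iteratedDeriv_zero, h1]; push_cast; ring
  | succ k ih =>
    intro x
    have h1 : iteratedDeriv (k + 2) bump = fun x => -2 * x * iteratedDeriv (k + 1) bump x
        - 2 * (k + 1) * iteratedDeriv k bump x := funext ih
    have h2 := (((hasDerivAt_id x).const_mul (-2)).mul
      (hasDerivAt_iteratedDeriv_bump (k + 1) x)).sub
      ((hasDerivAt_iteratedDeriv_bump k x).const_mul (2 * ((k : ℝ) + 1)))
    have h3 := hasDerivAt_iteratedDeriv_bump (k + 2) x
    rw [h1] at h3
    have := h3.unique h2
    rw [this]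
    simp only [id]
    push_cast; ring

/-- The Taylor coefficients of `exp (-x ^ 2)`. -/
def gaussCoeff : ℕ → ℚ
  | 0 => 1
  | 1 => 0
  | k + 2 => -2 * gaussCoeff k / (k + 2)

lemma gaussCoeff_even (k : ℕ) : gaussCoeff (2 * k) = (-1) ^ k / k.factorial := by
  induction k with
  | zero => simp [gaussCoeff]
  | succ k ih =>
    rw [show 2 * (k + 1) = 2 * k + 2 by ring, gaussCoeff, ih, Nat.factorial_succ]
    push_cast
    field_simp
    ring

lemma gaussCoeff_odd (k : ℕ) : gaussCoeff (2 * k + 1) = 0 := by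
  induction k with
  | zero => simp [gaussCoeff]
  | succ k ih => rw [show 2 * (k + 1) + 1 = (2 * k + 1) + 2 by ring, gaussCoeff, ih]; simp

lemma iteratedDeriv_bump_zero (k : ℕ) :
    iteratedDeriv k bump 0 = k.factorial * (gaussCoeff k : ℝ) := by
  induction k using Nat.twoStepInduction with
  | zero => simp [bump, gaussCoeff]
  | one => simp [iteratedDeriv_bump_one, gaussCoeff]
  | more k ih _ =>
    rw [iteratedDeriv_bump_add_two, ih, gaussCoeff, Nat.factorial_succ, Nat.factorial_succ]
    push_cast
    field_simp
    ring

/-! ### Elements of the scaled system -/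

/-- The elements of the system after scaling: up to a power of the step size, every element is
of this form with `t = ε h`, where `e` is the total order of differentiation and `d` is the
difference of the node indices. -/
noncomputable def element (T : (ℝ → ℝ) → ℝ → ℝ) (e : ℕ) (d t : ℝ) : ℝ :=
  t ^ e * T (fun s => iteratedDeriv e bump (d * s)) t

/-- The Taylor coefficients of the elements of the scaled system. -/
def elementCoeff (e K : ℕ) (d : ℚ) : ℚ := gaussCoeff K * K.descFactorial e * d ^ (K - e)

lemma taylorTruncation_eq_sum (N : ℕ) (f : ℝ → ℝ) (h : ℝ) :
    taylorTruncation N f h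
      = ∑ k ∈ Finset.range (N + 1), iteratedDeriv k f 0 / k.factorial * h ^ k := by
  rw [taylorTruncation, taylor_within_apply]
  refine Finset.sum_congr rfl fun k _ => ?_
  rw [iteratedDerivWithin_univ, smul_eq_mul, sub_zero]
  ring

/-- The prefactor `t ^ e` compensates the `e` derivatives, so the Gaussian coefficient of degree `K`
always comes with `t ^ K`. Consequently truncation at `N` keeps the degrees up to `N + e`:
differentiated elements retain more of the series. -/
lemma element_taylorTruncation (N e : ℕ) (d : ℚ) (t : ℝ) :
    element (taylorTruncation N) e d t
      = ∑ K ∈ Finset.range (N + e + 1), (elementCoeff e K d : ℝ) * t ^ K := by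
  rw [element, taylorTruncation_eq_sum, show N + e + 1 = e + (N + 1) by ring,
    Finset.sum_range_add _ e (N + 1)]
  have h0 : ∑ K ∈ Finset.range e, (elementCoeff e K d : ℝ) * t ^ K = 0 := by
    refine Finset.sum_eq_zero fun K hK => ?_
    simp [elementCoeff, Nat.descFactorial_eq_zero_iff_lt.mpr (Finset.mem_range.mp hK)]
  rw [h0, zero_add, Finset.mul_sum]
  refine Finset.sum_congr rfl fun k _ => ?_
  have h1 : iteratedDeriv k (fun s => iteratedDeriv e bump ((d : ℝ) * s)) 0
      = (d : ℝ) ^ k * iteratedDeriv (e + k) bump 0 := by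
    rw [iteratedDeriv_comp_const_mul (contDiff_iteratedDeriv_bump e)]
    simp only [mul_zero]
    rw [iteratedDeriv_eq_iterate, iteratedDeriv_eq_iterate, iteratedDeriv_eq_iterate,
      ← Function.iterate_add_apply, add_comm]
  have h2 : ((k.factorial : ℝ)) * ((e + k).descFactorial e : ℝ) = (e + k).factorial := by
    have := Nat.factorial_mul_descFactorial (Nat.le_add_right e k)
    rw [Nat.add_sub_cancel_left] at this
    exact_mod_cast this
  rw [h1, iteratedDeriv_bump_zero, ← h2, elementCoeff, Nat.add_sub_cancel_left]
  have h3 : (k.factorial : ℝ) ≠ 0 := by positivity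
  push_cast
  field_simp
  ring

/-! ### Asymptotics of the elements, with and without truncation. -/

lemma isBigO_pow_of_le {a b : ℕ} (h : b ≤ a) :
    (fun t : ℝ => t ^ a) =O[𝓝[>] 0] fun t => t ^ b := by
  refine IsBigO.of_bound 1 ?_
  filter_upwards [Ioo_mem_nhdsGT (zero_lt_one (α := ℝ))] with t ht
  rw [one_mul, Real.norm_of_nonneg (pow_nonneg ht.1.le _),
    Real.norm_of_nonneg (pow_nonneg ht.1.le _)]
  exact pow_le_pow_of_le_one ht.1.le ht.2.le h

/-- A finite sum of monomials is small to the order of its lowest exponent. -/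
lemma isBigO_sum_monomial {ι : Type*} (s : Finset ι) (f : ι → ℝ) (k : ι → ℕ) (m : ℕ)
    (h : ∀ i ∈ s, f i = 0 ∨ m ≤ k i) :
    (fun t : ℝ => ∑ i ∈ s, f i * t ^ k i) =O[𝓝[>] 0] fun t => t ^ m := by
  refine IsBigO.fun_sum fun i hi => ?_
  rcases h i hi with h | h
  · simp only [h, zero_mul]; exact isBigO_zero _ _
  · exact (isBigO_pow_of_le h).const_mul_left _

/-- The elements have the Taylor coefficients of the Gaussian up to order `Q`, except that the
coefficient of order `Q - 2` of the elements without differentiation is modified by `θ`. -/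
def Expands (T : (ℝ → ℝ) → ℝ → ℝ) (Q : ℕ) (θ : ℚ) : Prop :=
  ∀ e : ℕ, Even e → ∀ d : ℤ,
    (fun t => element T e d t - ((∑ K ∈ Finset.range Q, (elementCoeff e K d : ℝ) * t ^ K)
      - if e = 0 then (θ : ℝ) * (d : ℝ) ^ (Q - 2) * t ^ (Q - 2) else 0)) =O[𝓝[>] 0] fun t => t ^ Q

/-- Compatibility with rescaling of the step size. -/
def Scales (T : (ℝ → ℝ) → ℝ → ℝ) : Prop :=
  ∀ G : ℝ → ℝ, (∀ n : ℕ, ContDiff ℝ n G) → ∀ c ε h : ℝ,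
    T (fun s => c * G (ε * s)) h = c * T G (ε * h)

lemma scales_id : Scales id := fun _ _ _ _ _ => rfl

lemma scales_taylorTruncation (N : ℕ) : Scales (taylorTruncation N) := by
  intro G hG c ε h
  rw [taylorTruncation_eq_sum, taylorTruncation_eq_sum, Finset.mul_sum]
  refine Finset.sum_congr rfl fun k _ => ?_
  rw [iteratedDeriv_const_mul_field, iteratedDeriv_comp_const_mul (hG k)]
  simp only [mul_zero]
  ring

/-- Taylor's theorem of order `Q` for the derivative of the Gaussian. Because of the factor `t ^ e`,
the Taylor polynomial has surplus terms of degrees `Q` to `Q + e`, which belong to the error. -/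
lemma expands_id (Q : ℕ) : Expands id Q 0 := by
  intro e _ d
  have h1 : (fun t => iteratedDeriv e bump ((d : ℚ) * t)
      - taylorTruncation Q (fun s => iteratedDeriv e bump ((d : ℚ) * s)) t)
      =O[𝓝[>] 0] fun t => t ^ Q := by
    have hc : ContDiff ℝ Q (fun s => iteratedDeriv e bump (((d : ℚ) : ℝ) * s)) :=
      (contDiff_iteratedDeriv_bump e).comp (contDiff_const.mul contDiff_id)
    simpa [taylorTruncation] using
      ((taylor_isLittleO_univ (x₀ := 0) hc).isBigO).mono nhdsWithin_le_nhds
  have h2 : (fun t => element id e d t - element (taylorTruncation Q) e (d : ℚ) t)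
      =O[𝓝[>] 0] fun t => t ^ Q := by
    have := (isBigO_pow_of_le (Nat.zero_le e)).mul h1
    simp only [pow_zero, one_mul] at this
    refine this.congr_left fun t => ?_
    simp [element]; ring
  have h3 : (fun t : ℝ => ∑ K ∈ Finset.range (e + 1), (elementCoeff e (Q + K) d : ℝ) * t ^ (Q + K))
      =O[𝓝[>] 0] fun t => t ^ Q :=
    isBigO_sum_monomial _ _ _ _ fun _ _ => Or.inr (Nat.le_add_right _ _)
  refine (h2.add h3).congr_left fun t => ?_
  rw [element_taylorTruncation, show Q + e + 1 = Q + (e + 1) by ring,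
    Finset.sum_range_add _ Q (e + 1)]
  simp
  ring

/-- Truncation drops the degrees above `N + e`. For `e = 0` the only nonzero coefficient lost below
degree `Q` may be `θ`, at degree `Q - 2`. For even `e ≥ 2` none is lost, by `h2`. If degree `Q - 2`
is retained, `h0'` makes the correction vanish. -/
lemma expands_taylorTruncation {N Q : ℕ} {θ : ℚ} (hQ : 2 ≤ Q)
    (h0 : ∀ K < Q, N < K → gaussCoeff K = if K = Q - 2 then θ else 0)
    (h0' : Q - 2 ≤ N → θ = 0)
    (h2 : ∀ K < Q, N + 2 < K → gaussCoeff K = 0) :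
    Expands (taylorTruncation N) Q θ := by
  intro e he d
  have key : ∀ K : ℕ, K < Q → ¬ K < N + e + 1 → (elementCoeff e K d : ℝ) * 1
      = if K = Q - 2 then (if e = 0 then (θ : ℝ) * (d : ℝ) ^ (Q - 2) else 0) else 0 := by
    intro K hK hN
    rcases he with ⟨e', rfl⟩
    rcases Nat.eq_zero_or_pos e' with rfl | he'
    · rw [elementCoeff, h0 K hK (by omega)]
      split_ifs with h <;> simp_all
    · rw [elementCoeff, h2 K hK (by omega)]
      have : e' + e' ≠ 0 := by omega
      rw [if_neg this]; simp
  have h1 : ∀ t : ℝ, element (taylorTruncation N) e d t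
      - ((∑ K ∈ Finset.range Q, (elementCoeff e K d : ℝ) * t ^ K)
      - if e = 0 then (θ : ℝ) * (d : ℝ) ^ (Q - 2) * t ^ (Q - 2) else 0)
      = ∑ K ∈ Finset.range (N + e + 1) with Q ≤ K, (elementCoeff e K d : ℝ) * t ^ K := by
    intro t
    have := element_taylorTruncation N e d t
    rw [Rat.cast_intCast] at this
    rw [this]
    have e1 := Finset.sum_filter_add_sum_filter_not (Finset.range (N + e + 1)) (fun K => Q ≤ K)
      (fun K => (elementCoeff e K d : ℝ) * t ^ K)
    have e2 := Finset.sum_filter_add_sum_filter_not (Finset.range Q) (fun K => K < N + e + 1)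
      (fun K => (elementCoeff e K d : ℝ) * t ^ K)
    have e3 : (Finset.range (N + e + 1)).filter (fun K => ¬ Q ≤ K)
        = (Finset.range Q).filter (fun K => K < N + e + 1) := by
      ext K; simp; omega
    have e4 : ∑ K ∈ Finset.range Q with ¬ K < N + e + 1, (elementCoeff e K d : ℝ) * t ^ K
        = if e = 0 then (θ : ℝ) * (d : ℝ) ^ (Q - 2) * t ^ (Q - 2) else 0 := by
      have : ∑ K ∈ Finset.range Q with ¬ K < N + e + 1, (elementCoeff e K d : ℝ) * t ^ K
          = ∑ K ∈ Finset.range Q with ¬ K < N + e + 1,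
            if K = Q - 2 then (if e = 0 then (θ : ℝ) * (d : ℝ) ^ (Q - 2) else 0) * t ^ (Q - 2)
              else 0 := by
        refine Finset.sum_congr rfl fun K hK => ?_
        rw [Finset.mem_filter, Finset.mem_range] at hK
        rw [← mul_one (elementCoeff e K d : ℝ), key K hK.1 hK.2]
        split_ifs with h1 h2 <;> simp [h1]
      rw [this, Finset.sum_ite_eq']
      rw [ite_mul, zero_mul]
      split_ifs with h1 h2 h2
      · rfl
      · rfl
      · rw [h0' (by simp at h1; omega)]; simp
      · rfl
    rw [e3] at e1
    linarith
  simp only [h1]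
  exact isBigO_sum_monomial _ _ _ _ fun K hK => Or.inr (Finset.mem_filter.mp hK).2

/-! ### The Gaussian kernel and its derivatives -/

lemma gaussian_eq (ε x y : ℝ) : gaussian ε x y = bump (ε * (x - y)) := by
  rw [gaussian, bump, Real.norm_eq_abs, sq_abs]; ring_nf

lemma L1_gaussian (ε x y : ℝ) :
    L1 (gaussian ε) x y = ε ^ 2 * iteratedDeriv 2 bump (ε * (x - y)) := by
  have := iteratedDeriv_comp_sub_const 2 (fun z => bump (ε * z)) y
  rw [iteratedDeriv_comp_const_mul contDiff_bump] at this
  simp only [L1, gaussian_eq]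
  exact congrFun this x

lemma L2_gaussian (ε x y : ℝ) :
    L2 (gaussian ε) x y = ε ^ 2 * iteratedDeriv 2 bump (ε * (x - y)) := by
  have := iteratedDeriv_comp_const_sub 2 (fun z => bump (ε * z)) x
  rw [iteratedDeriv_comp_const_mul contDiff_bump] at this
  simp only [L2, gaussian_eq]
  simpa using congrFun this y

lemma L1_L2_gaussian (ε x y : ℝ) :
    L1 (L2 (gaussian ε)) x y = ε ^ 4 * iteratedDeriv 4 bump (ε * (x - y)) := by
  have := iteratedDeriv_comp_sub_const 2 (fun z => ε ^ 2 * iteratedDeriv 2 bump (ε * z)) y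
  have h2 : iteratedDeriv 2 (fun z => ε ^ 2 * iteratedDeriv 2 bump (ε * z))
      = fun z => ε ^ 4 * iteratedDeriv 4 bump (ε * z) := by
    funext z
    rw [iteratedDeriv_const_mul_field,
      iteratedDeriv_comp_const_mul (contDiff_iteratedDeriv_bump 2)]
    simp only [iteratedDeriv_eq_iterate, ← Function.iterate_add_apply]
    ring
  rw [h2] at this
  simp only [L1, L2_gaussian]
  exact congrFun this x

/-- Every element of the system is, up to a power of the step size, a scaled element. -/
lemma Scales.element_eq {T : (ℝ → ℝ) → ℝ → ℝ} (hT : Scales T) (e : ℕ) (d ε h : ℝ) :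
    h ^ e * T (fun s => ε ^ e * iteratedDeriv e bump (ε * (d * s))) h = element T e d (ε * h) := by
  have := hT (fun s => iteratedDeriv e bump (d * s))
    (fun n => (contDiff_iteratedDeriv_bump e).comp (contDiff_const.mul contDiff_id)) (ε ^ e) ε h
  rw [show (fun s => ε ^ e * iteratedDeriv e bump (ε * (d * s)))
    = fun s => ε ^ e * iteratedDeriv e bump (d * (ε * s)) by funext s; ring_nf, this, element]
  ring

/-! ### The scaled system

The functionals of the stencil are indexed by `ℤ ⊕ ℤ`: `inl j` is the evaluation at the node `j`
and `inr k` is the evaluation of the second derivative at the node `k`. -/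

/-- The order of differentiation of a functional. -/
def ord : ℤ ⊕ ℤ → ℕ := Sum.elim (fun _ => 0) (fun _ => 2)

/-- The node of a functional. -/
def node : ℤ ⊕ ℤ → ℤ := Sum.elim id id

/-- The value of a functional at the monomial of degree `i`. -/
def pair (ρ : ℤ ⊕ ℤ) (i : ℕ) : ℚ := i.descFactorial (ord ρ) * (node ρ : ℚ) ^ (i - ord ρ)

/-- The functionals entering the formula. -/
noncomputable def stencil (p q : ℕ) : Finset (ℤ ⊕ ℤ) := (support p).disjSum (deletedSupport q)

/-- The element of the scaled system for two functionals. -/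
noncomputable def el (T : (ℝ → ℝ) → ℝ → ℝ) (ρ σ : ℤ ⊕ ℤ) (t : ℝ) : ℝ :=
  element T (ord ρ + ord σ) ((node ρ - node σ : ℤ) : ℝ) t

/-- The scaled system, with the right-hand side multiplied by `θ`. -/
structure IsScaled (T : (ℝ → ℝ) → ℝ → ℝ) (p q : ℕ) (t θ : ℝ) (w : ℤ ⊕ ℤ → ℝ) (g : ℝ) : Prop where
  row : ∀ σ ∈ stencil p q, (∑ ρ ∈ stencil p q, w ρ * el T ρ σ t) + g * pair σ 0
    = θ * el T (Sum.inr 0) σ t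
  const : ∑ ρ ∈ stencil p q, w ρ * pair ρ 0 = 0

lemma mem_stencil_inl {p q : ℕ} {i : ℤ} : Sum.inl i ∈ stencil p q ↔ i ∈ support p := by
  simp [stencil]

lemma mem_stencil_inr {p q : ℕ} {k : ℤ} : Sum.inr k ∈ stencil p q ↔ k ∈ deletedSupport q := by
  simp [stencil]

lemma sum_stencil {M : Type*} [AddCommMonoid M] (p q : ℕ) (f : ℤ ⊕ ℤ → M) :
    ∑ ρ ∈ stencil p q, f ρ
      = ∑ j ∈ support p, f (Sum.inl j) + ∑ k ∈ deletedSupport q, f (Sum.inr k) := by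
  rw [stencil, Finset.sum_disjSum]

lemma pair_inl_zero (i : ℤ) : pair (Sum.inl i) 0 = 1 := by simp [pair, ord]

lemma pair_inr_zero (k : ℤ) : pair (Sum.inr k) 0 = 0 := by simp [pair, ord]

/-! ### Reduction of the collocation system to the parameter `t = ε h`. -/

section elements

variable {T : (ℝ → ℝ) → ℝ → ℝ}

lemma el_inl_inl (hT : Scales T) (x₀ ε h : ℝ) (i j : ℤ) :
    T (fun s => gaussian ε (x₀ + j * s) (x₀ + i * s)) h
    = el T (Sum.inl j) (Sum.inl i) (ε * h) := by
  have := hT.element_eq 0 ((j - i : ℤ) : ℝ) ε h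
  simp only [pow_zero, one_mul, iteratedDeriv_zero] at this
  simp only [el, ord, node, Sum.elim_inl, id, add_zero, ← this, gaussian_eq]
  congr 2; funext s; congr 1; push_cast; ring

lemma el_inr_inl (hT : Scales T) (x₀ ε h : ℝ) (i j : ℤ) :
    h ^ 2 * T (fun s => L1 (gaussian ε) (x₀ + j * s) (x₀ + i * s)) h
    = el T (Sum.inr j) (Sum.inl i) (ε * h) := by
  have := hT.element_eq 2 ((j - i : ℤ) : ℝ) ε h
  simp only [el, ord, node, Sum.elim_inl, Sum.elim_inr, id, add_zero, ← this, L1_gaussian]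
  congr 2; funext s; congr 2; push_cast; ring

lemma el_inl_inr (hT : Scales T) (x₀ ε h : ℝ) (i j : ℤ) :
    h ^ 2 * T (fun s => L2 (gaussian ε) (x₀ + j * s) (x₀ + i * s)) h
    = el T (Sum.inl j) (Sum.inr i) (ε * h) := by
  have := hT.element_eq 2 ((j - i : ℤ) : ℝ) ε h
  simp only [el, ord, node, Sum.elim_inl, Sum.elim_inr, id, zero_add, ← this, L2_gaussian]
  congr 2; funext s; congr 2; push_cast; ring

lemma el_inr_inr (hT : Scales T) (x₀ ε h : ℝ) (i j : ℤ) :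
    h ^ 4 * T (fun s => L1 (L2 (gaussian ε)) (x₀ + j * s) (x₀ + i * s)) h
    = el T (Sum.inr j) (Sum.inr i) (ε * h) := by
  have := hT.element_eq 4 ((j - i : ℤ) : ℝ) ε h
  simp only [el, ord, node, Sum.elim_inr, id, ← this, L1_L2_gaussian]
  congr 2; funext s; congr 2; push_cast; ring

/-- Value rows are multiplied by `h²` and derivative rows by `h⁴`. The constant `γ` enters through
the pairing of each row functional with `1`, which is zero for second derivatives. Only differences
of nodes occur, so `x₀` disappears. -/
lemma isWeights_iff (hT : Scales T) (x₀ ε h : ℝ) (p q : ℕ) (hh : 0 < h) (α β : ℤ → ℝ) (γ : ℝ) :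
    IsWeights T p q x₀ ε h α β γ ↔ (∀ i, i ∉ support p → α i = 0) ∧
      (∀ k, k ∉ deletedSupport q → β k = 0) ∧
      IsScaled T p q (ε * h) 1 (Sum.elim (fun i => h ^ 2 * α i) β) (h ^ 2 * γ) := by
  have r1 : ∀ i : ℤ, T (fun s => L1 (gaussian ε) x₀ (x₀ + i * s)) h * h ^ 2
      = el T (Sum.inr 0) (Sum.inl i) (ε * h) := fun i => by
    rw [← el_inr_inl hT x₀]; simp [mul_comm]
  have r2 : ∀ i : ℤ, T (fun s => L1 (L2 (gaussian ε)) x₀ (x₀ + i * s)) h * h ^ 4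
      = el T (Sum.inr 0) (Sum.inr i) (ε * h) := fun i => by
    rw [← el_inr_inr hT x₀]; simp [mul_comm]
  have h2 : h ^ 2 ≠ 0 := by positivity
  have h4 : h ^ 4 ≠ 0 := by positivity
  have c1 : ∀ i : ℤ, ((∑ j ∈ support p, α j * T (fun s => gaussian ε (x₀ + j * s) (x₀ + i * s)) h)
      + (∑ k ∈ deletedSupport q, β k * T (fun s => L1 (gaussian ε) (x₀ + k * s) (x₀ + i * s)) h)
      + γ = T (fun s => L1 (gaussian ε) x₀ (x₀ + i * s)) h) ↔
      ((∑ ρ ∈ stencil p q, (Sum.elim (fun i => h ^ 2 * α i) β : ℤ ⊕ ℤ → ℝ) ρ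
        * el T ρ (Sum.inl i) (ε * h)) + (h ^ 2 * γ) * pair (Sum.inl i) 0
        = 1 * el T (Sum.inr 0) (Sum.inl i) (ε * h)) := by
    intro i
    rw [← mul_left_inj' h2, r1, sum_stencil, one_mul, pair_inl_zero, add_mul, add_mul,
      Finset.sum_mul, Finset.sum_mul]
    simp only [Sum.elim_inl, Sum.elim_inr, ← el_inl_inl hT x₀, ← el_inr_inl hT x₀ ε h i]
    push_cast
    simp only [mul_one, mul_assoc, mul_comm, mul_left_comm]
  have c2 : ∀ i : ℤ, ((∑ j ∈ support p,
        α j * T (fun s => L2 (gaussian ε) (x₀ + j * s) (x₀ + i * s)) h)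
      + (∑ k ∈ deletedSupport q,
          β k * T (fun s => L1 (L2 (gaussian ε)) (x₀ + k * s) (x₀ + i * s)) h)
      = T (fun s => L1 (L2 (gaussian ε)) x₀ (x₀ + i * s)) h) ↔
      ((∑ ρ ∈ stencil p q, (Sum.elim (fun i => h ^ 2 * α i) β : ℤ ⊕ ℤ → ℝ) ρ
        * el T ρ (Sum.inr i) (ε * h)) + (h ^ 2 * γ) * pair (Sum.inr i) 0
        = 1 * el T (Sum.inr 0) (Sum.inr i) (ε * h)) := by
    intro i
    rw [← mul_left_inj' h4, r2, sum_stencil, one_mul, pair_inr_zero, add_mul,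
      Finset.sum_mul, Finset.sum_mul]
    simp only [Sum.elim_inl, Sum.elim_inr, ← el_inl_inr hT x₀, ← el_inr_inr hT x₀ ε h i]
    push_cast
    simp only [mul_zero, add_zero, show h ^ 4 = h ^ 2 * h ^ 2 by ring, mul_assoc, mul_comm,
      mul_left_comm]
  have c3 : (∑ j ∈ support p, α j = 0) ↔
      ∑ ρ ∈ stencil p q, (Sum.elim (fun i => h ^ 2 * α i) β : ℤ ⊕ ℤ → ℝ) ρ * pair ρ 0 = 0 := by
    rw [sum_stencil]
    simp only [Sum.elim_inl, Sum.elim_inr, pair_inl_zero, pair_inr_zero]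
    simp [hh.ne', ← Finset.mul_sum]
  constructor
  · rintro ⟨a, b, c, d, e⟩
    refine ⟨a, b, ⟨?_, c3.mp e⟩⟩
    rintro (i | i) hi
    · exact (c1 i).mp (c i (mem_stencil_inl.mp hi))
    · exact (c2 i).mp (d i (mem_stencil_inr.mp hi))
  · rintro ⟨a, b, c, d⟩
    exact ⟨a, b, fun i hi => (c1 i).mpr (c _ (mem_stencil_inl.mpr hi)),
      fun i hi => (c2 i).mpr (c _ (mem_stencil_inr.mpr hi)), c3.mpr d⟩

end elements

/-! ### Expansion of the elements in monomials -/

/-- Both sides equal `(i + j + e + f)! / (i! j!)`. -/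
lemma choose_mul_descFactorial_mul_descFactorial (e f i j : ℕ) :
    (i + j + (e + f)).choose (i + e) * (i + e).descFactorial e * (j + f).descFactorial f
      = (i + j + (e + f)).descFactorial (e + f) * (i + j).choose i := by
  have h1 := Nat.choose_mul_factorial_mul_factorial (Nat.le_add_right (i + e) (j + f))
  have h2 := Nat.factorial_mul_descFactorial (Nat.le_add_left e i)
  have h3 := Nat.factorial_mul_descFactorial (Nat.le_add_left f j)
  have h4 := Nat.factorial_mul_descFactorial (Nat.le_add_left (e + f) (i + j))
  have h5 := Nat.choose_mul_factorial_mul_factorial (Nat.le_add_right i j)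
  rw [Nat.add_sub_cancel] at h2 h3 h4
  rw [Nat.add_sub_cancel_left] at h1 h5
  rw [show i + e + (j + f) = i + j + (e + f) by ring] at h1
  have hpos : 0 < i.factorial * j.factorial := by positivity
  apply Nat.eq_of_mul_eq_mul_right hpos
  calc _ = (i + j + (e + f)).choose (i + e) * (i.factorial * (i + e).descFactorial e)
        * (j.factorial * (j + f).descFactorial f) := by ring
    _ = ((i + j).choose i * i.factorial * j.factorial)
        * (i + j + (e + f)).descFactorial (e + f) := by rw [h2, h3, h1, h5, h4]
    _ = _ := by ring

/-- This is `∂_x^e ∂_y^f` applied to `(x - y)^K`, before and after binomial expansion; evenness of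
`f` removes the sign `(-1)^f`. -/
lemma descFactorial_mul_sub_pow (e f K : ℕ) (x y : ℚ) (hf : Even f) :
    (K.descFactorial (e + f) : ℚ) * (x - y) ^ (K - (e + f))
      = ∑ i ∈ Finset.range (K + 1), (K.choose i : ℚ) * (-1) ^ (K - i)
        * (i.descFactorial e * x ^ (i - e)) * ((K - i).descFactorial f * y ^ (K - i - f)) := by
  rcases lt_or_ge K (e + f) with hK | hK
  · rw [Nat.descFactorial_eq_zero_iff_lt.mpr hK, Nat.cast_zero, zero_mul]
    symm
    refine Finset.sum_eq_zero fun i hi => ?_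
    rcases lt_or_ge i e with h | h
    · rw [Nat.descFactorial_eq_zero_iff_lt.mpr h]; simp
    · rw [Nat.descFactorial_eq_zero_iff_lt.mpr (show K - i < f by
        have := Finset.mem_range.mp hi; omega)]; simp
  · obtain ⟨m, rfl⟩ := Nat.exists_eq_add_of_le' hK
    -- The first `e` and the last `f` binomial terms are annihilated by the derivatives, and the
    -- middle block is the expansion of `(x - y)^m`.
    rw [Nat.add_sub_cancel, show m + (e + f) + 1 = e + ((m + 1) + f) by ring,
      Finset.sum_range_add _ e, Finset.sum_range_add _ (m + 1) f]
    have z1 : ∑ i ∈ Finset.range e, ((m + (e + f)).choose i : ℚ) * (-1) ^ (m + (e + f) - i)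
        * (i.descFactorial e * x ^ (i - e))
        * ((m + (e + f) - i).descFactorial f * y ^ (m + (e + f) - i - f)) = 0 := by
      refine Finset.sum_eq_zero fun i hi => ?_
      rw [Nat.descFactorial_eq_zero_iff_lt.mpr (Finset.mem_range.mp hi)]; simp
    have z2 : ∑ i ∈ Finset.range f, ((m + (e + f)).choose (e + (m + 1 + i)) : ℚ)
        * (-1) ^ (m + (e + f) - (e + (m + 1 + i)))
        * ((e + (m + 1 + i)).descFactorial e * x ^ (e + (m + 1 + i) - e))
        * ((m + (e + f) - (e + (m + 1 + i))).descFactorial f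
          * y ^ (m + (e + f) - (e + (m + 1 + i)) - f)) = 0 := by
      refine Finset.sum_eq_zero fun i hi => ?_
      rw [Nat.descFactorial_eq_zero_iff_lt.mpr
        (show m + (e + f) - (e + (m + 1 + i)) < f by
          have := Finset.mem_range.mp hi; omega)]
      simp
    rw [z1, z2, zero_add, add_zero, sub_eq_add_neg, add_pow, Finset.mul_sum]
    refine Finset.sum_congr rfl fun i hi => ?_
    obtain ⟨j, rfl⟩ := Nat.exists_eq_add_of_le (Nat.lt_succ_iff.mp (Finset.mem_range.mp hi))
    have hc := choose_mul_descFactorial_mul_descFactorial e f i j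
    rw [show i + j + (e + f) - (e + i) = j + f by omega, Nat.add_sub_cancel,
      Nat.add_sub_cancel_left, Nat.add_sub_cancel_left, add_comm e i, neg_pow, pow_add, hf.neg_one_pow]
    have hc' : ((i + j + (e + f)).choose (i + e) : ℚ) * (i + e).descFactorial e
        * (j + f).descFactorial f
        = (i + j + (e + f)).descFactorial (e + f) * (i + j).choose i := by exact_mod_cast hc
    linear_combination (-1) ^ j * x ^ i * y ^ j * (-hc')

lemma even_ord (ρ : ℤ ⊕ ℤ) : Even (ord ρ) := by
  rcases ρ with j | k
  · exact ⟨0, rfl⟩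
  · exact ⟨1, rfl⟩

/-- Separation of variables: each summand is a value of `ρ` times a value of `σ`, so combinations by
`W` can be taken on the two sides independently. -/
lemma elementCoeff_eq (ρ σ : ℤ ⊕ ℤ) (K : ℕ) :
    elementCoeff (ord ρ + ord σ) K ((node ρ - node σ : ℤ) : ℚ)
      = gaussCoeff K * ∑ i ∈ Finset.range (K + 1),
        (K.choose i : ℚ) * (-1) ^ (K - i) * pair ρ i * pair σ (K - i) := by
  rw [elementCoeff, mul_assoc]
  push_cast
  rw [descFactorial_mul_sub_pow _ _ _ _ _ (even_ord σ)]
  rfl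

/-- The coefficient of `x ^ a * y ^ b` in `exp (-(x - y) ^ 2)`. -/
def kernelCoeff (a b : ℕ) : ℚ := gaussCoeff (a + b) * (a + b).choose a * (-1) ^ b

/-- The pairing of the monomial of degree `i` with the combination of functionals given by the
`a`-th column of `W`. -/
noncomputable def moment (p q : ℕ) (W : ℤ ⊕ ℤ → ℕ → ℚ) (i a : ℕ) : ℚ :=
  ∑ ρ ∈ stencil p q, W ρ a * pair ρ i

/-- The reflection of the functionals of the stencil. -/
def reflect : ℤ ⊕ ℤ → ℤ ⊕ ℤ := Sum.map Neg.neg Neg.neg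

/-- The columns of `W` are combinations of the functionals of the stencil that are dual to the
monomials of degree at most `2 (p + q)`. -/
structure IsDual (p q : ℕ) (W : ℤ ⊕ ℤ → ℕ → ℚ) : Prop where
  biorthogonal : ∀ i ∈ Finset.range (2 * (p + q) + 1), ∀ a ∈ Finset.range (2 * (p + q) + 1),
    moment p q W i a = if i = a then 1 else 0
  complete : ∀ ρ ∈ stencil p q, ∀ σ ∈ stencil p q,
    ∑ a ∈ Finset.range (2 * (p + q) + 1), W ρ a * pair σ a = if ρ = σ then 1 else 0
  parity : ∀ ρ a, W (reflect ρ) a = (-1) ^ a * W ρ a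

lemma IsDual.moment_eq {p q : ℕ} {W : ℤ ⊕ ℤ → ℕ → ℚ} (hW : IsDual p q W) {i a : ℕ}
    (hi : i ≤ 2 * (p + q)) (ha : a ≤ 2 * (p + q)) : moment p q W i a = if i = a then 1 else 0 :=
  hW.biorthogonal i (Finset.mem_range.mpr (by omega)) a (Finset.mem_range.mpr (by omega))

lemma sum_sum_elementCoeff (p q : ℕ) (W : ℤ ⊕ ℤ → ℕ → ℚ) (a b K : ℕ) :
    ∑ ρ ∈ stencil p q, ∑ σ ∈ stencil p q,
      W ρ a * W σ b * elementCoeff (ord ρ + ord σ) K ((node ρ - node σ : ℤ) : ℚ)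
      = gaussCoeff K * ∑ i ∈ Finset.range (K + 1), (K.choose i : ℚ) * (-1) ^ (K - i)
        * moment p q W i a * moment p q W (K - i) b := by
  simp only [elementCoeff_eq, moment, Finset.mul_sum, Finset.sum_mul]
  simp only [fun ρ => Finset.sum_comm (s := stencil p q) (t := Finset.range (K + 1))
    (f := fun σ i => W ρ a * W σ b * (gaussCoeff K * ((K.choose i : ℚ) * (-1) ^ (K - i)
      * pair ρ i * pair σ (K - i))))]
  rw [Finset.sum_comm]
  refine Finset.sum_congr rfl fun i _ => ?_
  rw [Finset.sum_comm]
  refine Finset.sum_congr rfl fun σ _ => Finset.sum_congr rfl fun ρ _ => ?_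
  ring

/-- If `K ≤ a + b`, every splitting `i + (K - i)` other than `(a, b)` has `i < a` or `K - i < b`,
and then one moment vanishes by duality. -/
lemma IsDual.sum_sum_elementCoeff_eq {p q : ℕ} {W : ℤ ⊕ ℤ → ℕ → ℚ} (hW : IsDual p q W) {a b K : ℕ}
    (ha : a ≤ 2 * (p + q)) (hb : b ≤ 2 * (p + q)) (hK : K ≤ a + b) :
    ∑ ρ ∈ stencil p q, ∑ σ ∈ stencil p q,
      W ρ a * W σ b * elementCoeff (ord ρ + ord σ) K ((node ρ - node σ : ℤ) : ℚ)
      = if K = a + b then kernelCoeff a b else 0 := by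
  have hz : ∀ i, i ≤ K → ¬ (i = a ∧ K = a + b) →
      moment p q W i a * moment p q W (K - i) b = 0 := by
    intro i hi h
    rcases lt_or_ge i a with h1 | h1
    · rw [hW.moment_eq (by omega) ha, if_neg (by omega), zero_mul]
    · rw [hW.moment_eq (i := K - i) (by omega) hb, if_neg (by omega), mul_zero]
  rw [sum_sum_elementCoeff]
  split_ifs with h
  · subst h
    rw [Finset.sum_eq_single a]
    · rw [Nat.add_sub_cancel_left, hW.moment_eq ha ha, hW.moment_eq hb hb, kernelCoeff]
      simp; ring
    · intro i hi hia
      rw [mul_assoc, hz i (by simp at hi; omega) (by tauto), mul_zero]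
    · intro h; simp at h
  · rw [Finset.sum_eq_zero, mul_zero]
    intro i hi
    rw [mul_assoc, hz i (by simp at hi; omega) (by tauto), mul_zero]

lemma Expands.isBigO_el {T : (ℝ → ℝ) → ℝ → ℝ} {Q : ℕ} {θ : ℚ} (hT : Expands T Q θ) {s : ℕ}
    (hs : s ≤ Q - 2) (ρ σ : ℤ ⊕ ℤ) :
    (fun t => el T ρ σ t - ∑ K ∈ Finset.range s,
      (elementCoeff (ord ρ + ord σ) K ((node ρ - node σ : ℤ) : ℚ) : ℝ) * t ^ K)
      =O[𝓝[>] 0] fun t => t ^ s := by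
  have h1 := (hT (ord ρ + ord σ) ((even_ord ρ).add (even_ord σ)) (node ρ - node σ)).trans
    (isBigO_pow_of_le (show s ≤ Q by omega))
  have h2 := isBigO_sum_monomial (Finset.range (Q - s))
    (fun K => (elementCoeff (ord ρ + ord σ) (s + K) ((node ρ - node σ : ℤ) : ℚ) : ℝ))
    (fun K => s + K) s (fun _ _ => Or.inr (Nat.le_add_right _ _))
  have h3 : (fun t : ℝ => if ord ρ + ord σ = 0 then
      (θ : ℝ) * ((node ρ - node σ : ℤ) : ℝ) ^ (Q - 2) * t ^ (Q - 2) else 0)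
      =O[𝓝[>] 0] fun t => t ^ s := by
    split_ifs
    · exact (isBigO_pow_of_le hs).const_mul_left _
    · exact isBigO_zero _ _
  refine ((h1.add h2).sub h3).congr_left fun t => ?_
  rw [el]
  nth_rewrite 1 [show Q = s + (Q - s) by omega]
  rw [Finset.sum_range_add _ s (Q - s)]
  ring

/-- The scaled elements, combined by means of the columns of `W` in both arguments. -/
noncomputable def reduced (T : (ℝ → ℝ) → ℝ → ℝ) (p q : ℕ) (W : ℤ ⊕ ℤ → ℕ → ℚ) (a b : ℕ) (t : ℝ) :
    ℝ :=
  ∑ ρ ∈ stencil p q, ∑ σ ∈ stencil p q, (W ρ a : ℝ) * W σ b * el T ρ σ t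

/-- All degrees below `a + b` cancel by duality. The bound on `Q` ensures `a + b + 1 ≤ Q - 2`, so
the `θ` correction falls into the error. -/
lemma IsDual.isBigO_reduced {T : (ℝ → ℝ) → ℝ → ℝ} {p q Q : ℕ} {θ : ℚ} {W : ℤ ⊕ ℤ → ℕ → ℚ}
    (hW : IsDual p q W) (hT : Expands T Q θ) (hQ : 4 * (p + q) + 3 ≤ Q) {a b : ℕ}
    (ha : a ≤ 2 * (p + q)) (hb : b ≤ 2 * (p + q)) :
    (fun t => reduced T p q W a b t - kernelCoeff a b * t ^ (a + b))
      =O[𝓝[>] 0] fun t => t ^ (a + b + 1) := by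
  have h1 : (fun t => ∑ ρ ∈ stencil p q, ∑ σ ∈ stencil p q, (W ρ a : ℝ) * W σ b *
      (el T ρ σ t - ∑ K ∈ Finset.range (a + b + 1),
      (elementCoeff (ord ρ + ord σ) K ((node ρ - node σ : ℤ) : ℚ) : ℝ) * t ^ K))
      =O[𝓝[>] 0] fun t => t ^ (a + b + 1) :=
    IsBigO.fun_sum fun ρ _ => IsBigO.fun_sum fun σ _ =>
      (hT.isBigO_el (by omega) ρ σ).const_mul_left _
  refine h1.congr_left fun t => ?_
  simp only [mul_sub, Finset.sum_sub_distrib, reduced]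
  congr 1
  have h2 : ∀ K ∈ Finset.range (a + b + 1), ∑ ρ ∈ stencil p q, ∑ σ ∈ stencil p q,
      (W ρ a : ℝ) * W σ b * (elementCoeff (ord ρ + ord σ) K ((node ρ - node σ : ℤ) : ℚ) : ℝ)
      = if K = a + b then (kernelCoeff a b : ℝ) else 0 := by
    intro K hK
    have := hW.sum_sum_elementCoeff_eq ha hb (K := K) (by simp at hK; omega)
    rw [← Rat.cast_inj (α := ℝ)] at this
    rw [apply_ite (Rat.cast (K := ℝ)), Rat.cast_zero] at this
    rw [← this]
    push_cast
    rfl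
  calc _ = ∑ K ∈ Finset.range (a + b + 1), (∑ ρ ∈ stencil p q, ∑ σ ∈ stencil p q,
      (W ρ a : ℝ) * W σ b * (elementCoeff (ord ρ + ord σ) K ((node ρ - node σ : ℤ) : ℚ) : ℝ))
        * t ^ K := by
        simp only [Finset.mul_sum, Finset.sum_mul]
        simp only [fun ρ => Finset.sum_comm (s := stencil p q) (t := Finset.range (a + b + 1))
          (f := fun σ K => (W ρ a : ℝ) * W σ b *
          ((elementCoeff (ord ρ + ord σ) K ((node ρ - node σ : ℤ) : ℚ) : ℝ) * t ^ K))]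
        rw [Finset.sum_comm]
        simp only [mul_assoc]
    _ = ∑ K ∈ Finset.range (a + b + 1), (if K = a + b then (kernelCoeff a b : ℝ) else 0) * t ^ K :=
        Finset.sum_congr rfl fun K hK => by rw [h2 K hK]
    _ = _ := by simp [ite_mul]

/-! ### Nondegeneracy of the leading coefficients -/

/-- The coefficient of `x ^ a` in `x ^ k * exp (-x ^ 2)`. -/
def factorCoeff (a k : ℕ) : ℚ := if k ≤ a then gaussCoeff (a - k) else 0

/-- Comparison of coefficients in `exp (-(x - y)²) = exp (-x²) exp (2 x y) exp (-y²)`, with the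
middle factor expanded. Degrees up to 10 suffice for `p + q ≤ 5`. -/
lemma kernelCoeff_eq_sum : ∀ a ∈ Finset.range 11, ∀ b ∈ Finset.range 11, kernelCoeff a b
    = ∑ k ∈ Finset.range 11, (2 ^ k / k.factorial : ℚ) * factorCoeff a k * factorCoeff b k := by
  decide +kernel

/-- By the factorization the quadratic form is a sum of squares with positive weights, so each
square vanishes. Since `factorCoeff` is triangular with unit diagonal, the square belonging to the
largest index with `x a ≠ 0` gives a contradiction. -/
lemma eq_zero_of_sum_kernelCoeff {s : Finset ℕ} (hs : s ⊆ Finset.range 11) (x : ℕ → ℝ)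
    (h : ∀ b ∈ s, ∑ a ∈ s, x a * kernelCoeff a b = 0) : ∀ a ∈ s, x a = 0 := by
  have h1 : ∑ k ∈ Finset.range 11, (2 ^ k / k.factorial : ℝ)
      * (∑ a ∈ s, x a * factorCoeff a k) ^ 2 = 0 := by
    calc _ = ∑ b ∈ s, x b * ∑ a ∈ s, x a * kernelCoeff a b := by
          have : ∀ b ∈ s, ∀ a ∈ s, (kernelCoeff a b : ℝ) = ∑ k ∈ Finset.range 11,
              (2 ^ k / k.factorial : ℝ) * factorCoeff a k * factorCoeff b k := by
            intro b hb a ha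
            rw [kernelCoeff_eq_sum a (hs ha) b (hs hb)]
            push_cast
            rfl
          simp only [Finset.mul_sum, sq, Finset.sum_mul]
          rw [Finset.sum_comm]
          refine Finset.sum_congr rfl fun b hb => ?_
          rw [Finset.sum_comm]
          refine Finset.sum_congr rfl fun a ha => ?_
          rw [this b hb a ha, Finset.mul_sum, Finset.mul_sum]
          refine Finset.sum_congr rfl fun k _ => ?_
          ring
      _ = 0 := Finset.sum_eq_zero fun b hb => by rw [h b hb, mul_zero]
  have h2 : ∀ k ∈ Finset.range 11, ∑ a ∈ s, x a * factorCoeff a k = 0 := by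
    intro k hk
    have := (Finset.sum_eq_zero_iff_of_nonneg fun k _ => by positivity).mp h1 k hk
    have hp : (2 ^ k / k.factorial : ℝ) ≠ 0 := by positivity
    exact pow_eq_zero_iff (two_ne_zero) |>.mp ((mul_eq_zero.mp this).resolve_left hp)
  by_contra! hne
  obtain ⟨a₀, ha₀, hmax⟩ := (s.filter fun a => x a ≠ 0).exists_max_image id
    (by obtain ⟨a, ha, hx⟩ := hne; exact ⟨a, Finset.mem_filter.mpr ⟨ha, hx⟩⟩)
  rw [Finset.mem_filter] at ha₀
  have h3 := h2 a₀ (hs ha₀.1)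
  rw [Finset.sum_eq_single a₀] at h3
  · simp [factorCoeff, gaussCoeff] at h3
    exact ha₀.2 h3
  · intro a ha hne
    by_cases hxa : x a = 0
    · rw [hxa, zero_mul]
    · have := hmax a (Finset.mem_filter.mpr ⟨ha, hxa⟩)
      simp only [id] at this
      rw [factorCoeff, if_neg (by omega)]; simp
  · exact fun h => absurd ha₀.1 h

lemma exists_leftInverse_kernelCoeff {s : Finset ℕ} (hs : s ⊆ Finset.range 11) :
    ∃ J : ℕ → ℕ → ℝ, ∀ x : ℕ → ℝ, ∀ c ∈ s,
      x c = ∑ b ∈ s, J c b * ∑ a ∈ s, x a * kernelCoeff a b := by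
  classical
  let M : Matrix s s ℝ := Matrix.of fun b a => (kernelCoeff a b : ℝ)
  have hM : Function.Injective M.mulVec := by
    have hker : ∀ v, M.mulVec v = 0 → v = 0 := by
      intro v hv
      let x : ℕ → ℝ := fun a => if h : a ∈ s then v ⟨a, h⟩ else 0
      have hx := eq_zero_of_sum_kernelCoeff hs x (fun b hb => by
        have := congrFun hv ⟨b, hb⟩
        simp only [Matrix.mulVec, dotProduct, M, Matrix.of_apply, Pi.zero_apply] at this
        rw [← this, ← Finset.sum_coe_sort s]
        refine Finset.sum_congr rfl fun a _ => ?_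
        simp [x, mul_comm])
      funext a
      simpa [x] using hx a a.2
    intro v v' h
    exact sub_eq_zero.mp (hker _ (by rw [Matrix.mulVec_sub, h, sub_self]))
  have hu : IsUnit M := Matrix.mulVec_injective_iff_isUnit.mp hM
  refine ⟨fun c b => if h : c ∈ s ∧ b ∈ s then M⁻¹ ⟨c, h.1⟩ ⟨b, h.2⟩ else 0, fun x c hc => ?_⟩
  have h1 : M⁻¹.mulVec (M.mulVec fun a => x a) = fun a : s => x a := by
    rw [Matrix.mulVec_mulVec, Matrix.nonsing_inv_mul _ ((Matrix.isUnit_iff_isUnit_det M).mp hu),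
      Matrix.one_mulVec]
  have h2 := congrFun h1 ⟨c, hc⟩
  simp only [Matrix.mulVec, dotProduct] at h2
  rw [← h2, ← Finset.sum_coe_sort s]
  refine Finset.sum_congr rfl fun b _ => ?_
  simp only [hc, b.2, and_self, dif_pos]
  rw [← Finset.sum_coe_sort s]
  simp only [mul_comm (x _), M, Matrix.of_apply]

/-- A family of linear systems tending to a nondegenerate one is uniformly well-posed. -/
lemma eventually_abs_le {s : Finset ℕ} (hs : s ⊆ Finset.range 11) (N : ℕ → ℕ → ℝ → ℝ)
    (hN : ∀ a ∈ s, ∀ b ∈ s, Tendsto (N a b) (𝓝[>] 0) (𝓝 (kernelCoeff a b))) :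
    ∃ C : ℝ, ∀ᶠ t in 𝓝[>] (0 : ℝ), ∀ x : ℕ → ℝ, ∀ c ∈ s,
      |x c| ≤ C * ∑ b ∈ s, |∑ a ∈ s, x a * N a b t| := by
  obtain ⟨J, hJ⟩ := exists_leftInverse_kernelCoeff hs
  set B : ℝ := ∑ c ∈ s, ∑ b ∈ s, |J c b| with hB
  have hB0 : 0 ≤ B := Finset.sum_nonneg fun _ _ => Finset.sum_nonneg fun _ _ => abs_nonneg _
  -- `B` is the entry sum of the limiting inverse, and `η` is chosen so that `B η ≤ 1/2`. Then `S ≤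
  -- B (∑ |r b| + η S)` can be absorbed to `S ≤ 2 B ∑ |r b|`.
  set η : ℝ := 1 / (2 * (B + 1)) with hη
  have hη0 : 0 < η := by positivity
  have hBη : B * η ≤ 1 / 2 := by
    rw [hη, mul_one_div, div_le_div_iff₀ (by positivity) (by positivity)]; linarith
  have hev : ∀ᶠ t in 𝓝[>] (0 : ℝ), ∀ a ∈ s, ∀ b ∈ s, |N a b t - kernelCoeff a b| < η := by
    simp only [Finset.eventually_all]
    intro a ha b hb
    exact (Metric.tendsto_nhds.mp (hN a ha b hb)) η hη0
  refine ⟨2 * B, hev.mono fun t ht x c hc => ?_⟩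
  set r : ℕ → ℝ := fun b => ∑ a ∈ s, x a * N a b t with hr
  set S : ℝ := ∑ a ∈ s, |x a| with hS
  have hS0 : 0 ≤ S := Finset.sum_nonneg fun _ _ => abs_nonneg _
  have hrb : ∀ b ∈ s, |∑ a ∈ s, x a * (kernelCoeff a b : ℝ)| ≤ (∑ b ∈ s, |r b|) + η * S := by
    intro b hb
    have e : ∑ a ∈ s, x a * (kernelCoeff a b : ℝ)
        = r b - ∑ a ∈ s, x a * (N a b t - kernelCoeff a b) := by
      simp only [hr, mul_sub, Finset.sum_sub_distrib]; ring
    rw [e]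
    refine (abs_sub _ _).trans (add_le_add
      (Finset.single_le_sum (f := fun b => |r b|) (fun _ _ => abs_nonneg _) hb) ?_)
    refine (Finset.abs_sum_le_sum_abs _ _).trans ?_
    rw [hS, Finset.mul_sum]
    refine Finset.sum_le_sum fun a ha => ?_
    rw [abs_mul, mul_comm]
    exact mul_le_mul_of_nonneg_right (ht a ha b hb).le (abs_nonneg _)
  have hx : ∀ c ∈ s, |x c| ≤ (∑ b ∈ s, |J c b|) * ((∑ b ∈ s, |r b|) + η * S) := by
    intro c hc
    rw [hJ x c hc, Finset.sum_mul]
    refine (Finset.abs_sum_le_sum_abs _ _).trans (Finset.sum_le_sum fun b hb => ?_)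
    rw [abs_mul]
    exact mul_le_mul_of_nonneg_left (hrb b hb) (abs_nonneg _)
  have hSle : S ≤ B * ((∑ b ∈ s, |r b|) + η * S) := by
    rw [hS, hB, Finset.sum_mul]
    exact Finset.sum_le_sum hx
  have h1 : |x c| ≤ S := Finset.single_le_sum (f := fun b => |x b|) (fun _ _ => abs_nonneg _) hc
  nlinarith [mul_le_mul_of_nonneg_right hBη hS0]

/-! ### Unique solvability of the scaled system -/

section solvability

variable {T : (ℝ → ℝ) → ℝ → ℝ} {p q Q : ℕ} {θ : ℚ} {W : ℤ ⊕ ℤ → ℕ → ℚ}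

/-- The value at the monomial of degree `a` of the combination of functionals with weights `w`. -/
noncomputable def combined (p q : ℕ) (w : ℤ ⊕ ℤ → ℝ) (a : ℕ) : ℝ :=
  ∑ ρ ∈ stencil p q, w ρ * pair ρ a

/-- Completeness recovers the weights from their `2 (p + q) + 1` moments. -/
lemma IsDual.sum_mul_combined (hW : IsDual p q W) (w : ℤ ⊕ ℤ → ℝ) {ρ : ℤ ⊕ ℤ}
    (hρ : ρ ∈ stencil p q) :
    ∑ a ∈ Finset.range (2 * (p + q) + 1), (W ρ a : ℝ) * combined p q w a = w ρ := by
  simp only [Finset.mul_sum, combined]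
  rw [Finset.sum_comm]
  have : ∀ σ ∈ stencil p q, ∑ a ∈ Finset.range (2 * (p + q) + 1), (W ρ a : ℝ) * (w σ * pair σ a)
      = if ρ = σ then w σ else 0 := by
    intro σ hσ
    have h := hW.complete ρ hρ σ hσ
    rw [← Rat.cast_inj (α := ℝ), apply_ite (Rat.cast (K := ℝ))] at h
    push_cast at h
    calc _ = w σ * ∑ a ∈ Finset.range (2 * (p + q) + 1), (W ρ a : ℝ) * pair σ a := by
          rw [Finset.mul_sum]; exact Finset.sum_congr rfl fun _ _ => by ring
      _ = _ := by rw [h]; simp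
  rw [Finset.sum_congr rfl this, Finset.sum_ite_eq, if_pos hρ]

lemma sum_range_eq_sum_Icc {f : ℕ → ℝ} (h0 : f 0 = 0) (m : ℕ) :
    ∑ a ∈ Finset.range (m + 1), f a = ∑ a ∈ Finset.Icc 1 m, f a := by
  rw [Finset.sum_range_eq_add_Ico _ (Nat.succ_pos m), h0, zero_add]
  rfl

lemma IsDual.sum_combined_mul_reduced (hW : IsDual p q W) {w : ℤ ⊕ ℤ → ℝ}
    (h0 : combined p q w 0 = 0) (b : ℕ) (t : ℝ) :
    ∑ a ∈ Finset.Icc 1 (2 * (p + q)), combined p q w a * reduced T p q W a b t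
      = ∑ σ ∈ stencil p q, (W σ b : ℝ) * ∑ ρ ∈ stencil p q, w ρ * el T ρ σ t := by
  rw [← sum_range_eq_sum_Icc (f := fun a => combined p q w a * reduced T p q W a b t)
    (by simp [h0])]
  have h2 : ∀ σ, ∑ ρ ∈ stencil p q, w ρ * el T ρ σ t
      = ∑ ρ ∈ stencil p q, (∑ a ∈ Finset.range (2 * (p + q) + 1), (W ρ a : ℝ)
        * combined p q w a) * el T ρ σ t := fun σ =>
    Finset.sum_congr rfl fun ρ hρ => by rw [hW.sum_mul_combined w hρ]
  simp only [h2, reduced, Finset.mul_sum, Finset.sum_mul]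
  rw [Finset.sum_comm]
  conv_rhs => rw [Finset.sum_comm]
  refine Finset.sum_congr rfl fun ρ _ => ?_
  rw [Finset.sum_comm]
  refine Finset.sum_congr rfl fun σ _ => Finset.sum_congr rfl fun a _ => ?_
  ring

/-- The equations of the scaled system, combined by means of the columns of `W`. -/
lemma IsScaled.sum_combined_mul_reduced (hW : IsDual p q W) {t κ : ℝ} {w : ℤ ⊕ ℤ → ℝ} {g : ℝ}
    (h : IsScaled T p q t κ w g) {b : ℕ} (hb : b ∈ Finset.Icc 1 (2 * (p + q))) :
    ∑ a ∈ Finset.Icc 1 (2 * (p + q)), combined p q w a * reduced T p q W a b t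
      = κ * ∑ σ ∈ stencil p q, (W σ b : ℝ) * el T (Sum.inr 0) σ t := by
  rw [Finset.mem_Icc] at hb
  -- The columns with `b ≥ 1` annihilate constants, which eliminates the multiplier `g`; the
  -- constraint removes the moment of degree 0 in turn.
  have hg : ∑ σ ∈ stencil p q, (W σ b : ℝ) * pair σ 0 = 0 := by
    have := hW.moment_eq (i := 0) (a := b) (by omega) (by omega)
    rw [if_neg (by omega), moment] at this
    exact_mod_cast this
  rw [hW.sum_combined_mul_reduced h.const]
  have : ∑ σ ∈ stencil p q, (W σ b : ℝ) * ((∑ ρ ∈ stencil p q, w ρ * el T ρ σ t) + g * pair σ 0)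
      = κ * ∑ σ ∈ stencil p q, (W σ b : ℝ) * el T (Sum.inr 0) σ t := by
    rw [Finset.mul_sum]
    exact Finset.sum_congr rfl fun σ hσ => by rw [h.row σ hσ]; ring
  simp only [mul_add, Finset.sum_add_distrib] at this
  rw [← this]
  have : ∑ σ ∈ stencil p q, (W σ b : ℝ) * (g * pair σ 0) = 0 := by
    rw [← mul_zero g, ← hg, Finset.mul_sum]
    exact Finset.sum_congr rfl fun _ _ => by ring
  rw [this, add_zero]

lemma IsDual.tendsto_reduced (hW : IsDual p q W) (hT : Expands T Q θ) (hQ : 4 * (p + q) + 3 ≤ Q)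
    {a b : ℕ} (ha : a ≤ 2 * (p + q)) (hb : b ≤ 2 * (p + q)) :
    Tendsto (fun t => reduced T p q W a b t / t ^ (a + b)) (𝓝[>] 0) (𝓝 (kernelCoeff a b)) := by
  obtain ⟨C, hC⟩ := (hW.isBigO_reduced hT hQ ha hb).bound
  rw [tendsto_iff_norm_sub_tendsto_zero]
  have hlim : Tendsto (fun t : ℝ => C * t) (𝓝[>] 0) (𝓝 0) := by
    have : Tendsto (fun t : ℝ => C * t) (𝓝 0) (𝓝 (C * 0)) := tendsto_id.const_mul C
    rw [mul_zero] at this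
    exact this.mono_left nhdsWithin_le_nhds
  refine squeeze_zero' (Eventually.of_forall fun _ => norm_nonneg _) ?_ hlim
  filter_upwards [hC, self_mem_nhdsWithin] with t ht (ht0 : 0 < t)
  have hp : 0 < t ^ (a + b) := by positivity
  rw [show reduced T p q W a b t / t ^ (a + b) - kernelCoeff a b
    = (reduced T p q W a b t - kernelCoeff a b * t ^ (a + b)) / t ^ (a + b) by field_simp,
    norm_div, Real.norm_of_nonneg hp.le, div_le_iff₀ hp]
  refine ht.trans (le_of_eq ?_)
  rw [Real.norm_of_nonneg (by positivity)]
  ring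

/-- For small parameters the homogeneous scaled system has only the trivial solution. -/
lemma IsDual.eventually_eq_zero (hW : IsDual p q W) (hT : Expands T Q θ)
    (hQ : 4 * (p + q) + 3 ≤ Q) (hn : p + q ≤ 5) :
    ∀ᶠ t in 𝓝[>] (0 : ℝ), ∀ w g, IsScaled T p q t 0 w g →
      (∀ ρ ∈ stencil p q, w ρ = 0) ∧ g = 0 := by
  obtain ⟨C, hC⟩ := eventually_abs_le (s := Finset.Icc 1 (2 * (p + q)))
    (fun a ha => by rw [Finset.mem_Icc] at ha; rw [Finset.mem_range]; omega)
    (fun a b t => reduced T p q W a b t / t ^ (a + b))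
    (fun a ha b hb => hW.tendsto_reduced hT hQ (Finset.mem_Icc.mp ha).2 (Finset.mem_Icc.mp hb).2)
  filter_upwards [hC, self_mem_nhdsWithin] with t ht (ht0 : 0 < t) w g h
  have hm : ∀ a ∈ Finset.range (2 * (p + q) + 1), combined p q w a = 0 := by
    intro a ha
    rcases Nat.eq_zero_or_pos a with rfl | ha0
    · exact h.const
    -- Scaling moment `a` by `t ^ a` and equation `b` by `t ^ (-b)` produces the convergent matrix
    -- `reduced / t ^ (a + b)`.
    have := ht (fun a => combined p q w a * t ^ a) a
      (Finset.mem_Icc.mpr ⟨ha0, Nat.lt_succ_iff.mp (Finset.mem_range.mp ha)⟩)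
    rw [Finset.sum_eq_zero, mul_zero] at this
    · exact (mul_eq_zero.mp (abs_nonpos_iff.mp this)).resolve_right (by positivity)
    · intro b hb
      rw [abs_eq_zero]
      have hr := h.sum_combined_mul_reduced hW hb
      rw [zero_mul] at hr
      rw [← zero_div (t ^ b), ← hr, Finset.sum_div]
      refine Finset.sum_congr rfl fun a _ => ?_
      rw [pow_add]
      field_simp
  have hw : ∀ ρ ∈ stencil p q, w ρ = 0 := by
    intro ρ hρ
    rw [← hW.sum_mul_combined w hρ]
    exact Finset.sum_eq_zero fun a ha => by rw [hm a ha, mul_zero]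
  refine ⟨hw, ?_⟩
  have := h.row (Sum.inl 0) (mem_stencil_inl.mpr (by simp [support]))
  rw [Finset.sum_eq_zero fun ρ hρ => by rw [hw ρ hρ, zero_mul]] at this
  simpa [pair_inl_zero] using this

lemma IsScaled.sub {t κ κ' : ℝ} {w w' : ℤ ⊕ ℤ → ℝ} {g g' : ℝ} (h : IsScaled T p q t κ w g)
    (h' : IsScaled T p q t κ' w' g') :
    IsScaled T p q t (κ - κ') (fun ρ => w ρ - w' ρ) (g - g') := by
  constructor
  · intro σ hσ
    rw [sub_mul κ, ← h.row σ hσ, ← h'.row σ hσ]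
    simp only [sub_mul, Finset.sum_sub_distrib]
    ring
  · simp only [sub_mul, Finset.sum_sub_distrib]
    rw [h.const, h'.const, sub_zero]

/-- If the homogeneous scaled system has only the trivial solution, the inhomogeneous one has a
solution. -/
lemma exists_isScaled {t : ℝ}
    (h : ∀ w g, IsScaled T p q t 0 w g → (∀ ρ ∈ stencil p q, w ρ = 0) ∧ g = 0) :
    ∃ w g, IsScaled T p q t 1 w g ∧ ∀ ρ, ρ ∉ stencil p q → w ρ = 0 := by
  classical
  let I := stencil p q
  let ext : (I → ℝ) → ℤ ⊕ ℤ → ℝ := fun v ρ => if h : ρ ∈ I then v ⟨ρ, h⟩ else 0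
  have hext : ∀ v (f : ℤ ⊕ ℤ → ℝ), ∑ ρ ∈ stencil p q, ext v ρ * f ρ = ∑ ρ : I, v ρ * f ρ := by
    intro v f
    rw [← Finset.sum_coe_sort (stencil p q)]
    refine Finset.sum_congr rfl fun ρ _ => ?_
    simp [ext, I]
  let Φ : ((I → ℝ) × ℝ) →ₗ[ℝ] ((I → ℝ) × ℝ) :=
    { toFun := fun v => (fun σ => (∑ ρ : I, v.1 ρ * el T ρ σ t) + v.2 * pair σ 0,
        ∑ ρ : I, v.1 ρ * pair ρ 0)
      map_add' := by
        intro v v'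
        ext
        · simp only [Prod.fst_add, Prod.snd_add, Pi.add_apply, add_mul, Finset.sum_add_distrib]
          ring
        · simp only [Prod.fst_add, Prod.snd_add, Pi.add_apply, add_mul, Finset.sum_add_distrib]
      map_smul' := by
        intro c v
        ext
        · simp only [Prod.smul_fst, Prod.smul_snd, Pi.smul_apply, smul_eq_mul, RingHom.id_apply,
            mul_assoc, ← Finset.mul_sum, mul_add]
        · simp only [Prod.smul_fst, Prod.smul_snd, Pi.smul_apply, smul_eq_mul, RingHom.id_apply,
            mul_assoc, ← Finset.mul_sum] }
  have hΦ : ∀ v κ, Φ v = (fun σ : I => κ * el T (Sum.inr 0) σ t, 0) →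
      IsScaled T p q t κ (ext v.1) v.2 := by
    intro v κ hv
    have h1 := congrArg Prod.fst hv
    have h2 := congrArg Prod.snd hv
    constructor
    · intro σ hσ
      have := congrFun h1 ⟨σ, hσ⟩
      rw [hext]
      exact this
    · rw [hext]
      exact h2
  have hinj : Function.Injective Φ := by
    rw [injective_iff_map_eq_zero]
    intro v hv
    obtain ⟨h1, h2⟩ := h _ _ (hΦ v 0 (by rw [hv]; ext <;> simp))
    ext ρ
    · have := h1 ρ ρ.2
      simpa [ext, I] using this
    · exact h2
  obtain ⟨v, hv⟩ := LinearMap.injective_iff_surjective.mp hinj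
    (fun σ : I => 1 * el T (Sum.inr 0) σ t, 0)
  exact ⟨ext v.1, v.2, hΦ v 1 hv, fun ρ hρ => by simp only [ext, I]; rw [dif_neg hρ]⟩

/-! ### Reflection -/

lemma reflect_reflect (ρ : ℤ ⊕ ℤ) : reflect (reflect ρ) = ρ := by
  rcases ρ with i | i <;> simp [reflect]

lemma reflect_mem_stencil {ρ : ℤ ⊕ ℤ} (hρ : ρ ∈ stencil p q) : reflect ρ ∈ stencil p q := by
  rcases ρ with i | i
  · simp only [reflect, Sum.map_inl, mem_stencil_inl, support, Finset.mem_Icc] at hρ ⊢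
    omega
  · simp only [reflect, Sum.map_inr, mem_stencil_inr, deletedSupport, support, Finset.mem_erase,
      Finset.mem_Icc] at hρ ⊢
    omega

lemma sum_reflect {M : Type*} [AddCommMonoid M] (f : ℤ ⊕ ℤ → M) :
    ∑ ρ ∈ stencil p q, f (reflect ρ) = ∑ ρ ∈ stencil p q, f ρ :=
  Finset.sum_nbij' reflect reflect (fun _ => reflect_mem_stencil) (fun _ => reflect_mem_stencil)
    (fun ρ _ => reflect_reflect ρ) (fun ρ _ => reflect_reflect ρ) (fun _ _ => rfl)

lemma ord_reflect (ρ : ℤ ⊕ ℤ) : ord (reflect ρ) = ord ρ := by rcases ρ with i | i <;> rfl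

lemma node_reflect (ρ : ℤ ⊕ ℤ) : node (reflect ρ) = -node ρ := by rcases ρ with i | i <;> rfl

lemma pair_reflect (ρ : ℤ ⊕ ℤ) (i : ℕ) : pair (reflect ρ) i = (-1) ^ i * pair ρ i := by
  rw [pair, pair, ord_reflect, node_reflect]
  rcases lt_or_ge i (ord ρ) with h | h
  · rw [Nat.descFactorial_eq_zero_iff_lt.mpr h]; simp
  · obtain ⟨j, rfl⟩ := Nat.exists_eq_add_of_le h
    rw [Nat.add_sub_cancel_left, pow_add, (even_ord ρ).neg_one_pow]
    push_cast
    rw [neg_pow]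
    ring

lemma element_neg (T : (ℝ → ℝ) → ℝ → ℝ) {e : ℕ} (he : Even e) (d t : ℝ) :
    element T e (-d) t = element T e d t := by
  have h1 : (fun x => bump (-x)) = bump := by funext x; simp [bump]
  have h2 : ∀ x, iteratedDeriv e bump (-x) = iteratedDeriv e bump x := by
    intro x
    have := iteratedDeriv_comp_neg e bump x
    rw [h1, he.neg_one_pow, one_smul] at this
    exact this.symm
  simp only [element, neg_mul, h2]

lemma el_reflect (T : (ℝ → ℝ) → ℝ → ℝ) (ρ σ : ℤ ⊕ ℤ) (t : ℝ) :
    el T (reflect ρ) (reflect σ) t = el T ρ σ t := by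
  rw [el, el, ord_reflect, ord_reflect, node_reflect, node_reflect,
    ← element_neg T ((even_ord ρ).add (even_ord σ))]
  congr 1
  push_cast
  ring

/-- The derivative orders are even, so the elements are even in the node difference. The right-hand
functional sits at node 0, so reflection merely permutes the equations. -/
lemma IsScaled.reflect {t κ : ℝ} {w : ℤ ⊕ ℤ → ℝ} {g : ℝ} (h : IsScaled T p q t κ w g) :
    IsScaled T p q t κ (fun ρ => w (reflect ρ)) g := by
  constructor
  · intro σ hσ
    have := h.row _ (reflect_mem_stencil hσ)
    rw [pair_reflect, pow_zero, one_mul] at this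
    rw [show el T (Sum.inr 0) σ t = el T (Sum.inr 0) (RBFHFD.reflect σ) t by
      rw [← el_reflect]; rfl, ← this,
      ← sum_reflect fun ρ => w ρ * el T ρ (RBFHFD.reflect σ) t]
    simp only [el_reflect]
  · rw [← h.const, ← sum_reflect (fun ρ => w ρ * (pair ρ 0 : ℝ))]
    simp [pair_reflect]

/-- Unique solvability of the scaled system, and symmetry of its solution. -/
lemma IsDual.exists_solution (hW : IsDual p q W) (hT : Expands T Q θ)
    (hQ : 4 * (p + q) + 3 ≤ Q) (hn : p + q ≤ 5) :
    ∃ (w : ℝ → ℤ ⊕ ℤ → ℝ) (g : ℝ → ℝ) (δ : ℝ), 0 < δ ∧ (∀ t ρ, w t (RBFHFD.reflect ρ) = w t ρ) ∧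
      (∀ t ρ, ρ ∉ stencil p q → w t ρ = 0) ∧
      ∀ t, 0 < t → t < δ → IsScaled T p q t 1 (w t) (g t) ∧
        ∀ w' g', IsScaled T p q t 1 w' g' → (∀ ρ ∈ stencil p q, w' ρ = w t ρ) ∧ g' = g t := by
  have key : ∀ᶠ t in 𝓝[>] (0 : ℝ), ∃ (w : ℤ ⊕ ℤ → ℝ) (g : ℝ),
      (∀ ρ, w (RBFHFD.reflect ρ) = w ρ) ∧ (∀ ρ, ρ ∉ stencil p q → w ρ = 0) ∧
      IsScaled T p q t 1 w g ∧
        ∀ w' g', IsScaled T p q t 1 w' g' → (∀ ρ ∈ stencil p q, w' ρ = w ρ) ∧ g' = g := by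
    filter_upwards [hW.eventually_eq_zero hT hQ hn] with t ht
    obtain ⟨w, g, h, hoff⟩ := exists_isScaled ht
    have huniq : ∀ w' g', IsScaled T p q t 1 w' g' → (∀ ρ ∈ stencil p q, w' ρ = w ρ) ∧ g' = g := by
      intro w' g' h'
      obtain ⟨h1, h2⟩ := ht _ _ (by simpa using h'.sub h)
      exact ⟨fun ρ hρ => sub_eq_zero.mp (h1 ρ hρ), sub_eq_zero.mp h2⟩
    refine ⟨w, g, fun ρ => ?_, hoff, h, huniq⟩
    by_cases hρ : ρ ∈ stencil p q
    · exact (huniq _ _ h.reflect).1 ρ hρ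
    · rw [hoff ρ hρ, hoff _ fun h => hρ (by simpa [reflect_reflect] using reflect_mem_stencil h)]
  rw [eventually_nhdsWithin_iff] at key
  obtain ⟨δ, hδ, hball⟩ := Metric.eventually_nhds_iff.mp key
  have : ∀ t : ℝ, ∃ (w : ℤ ⊕ ℤ → ℝ) (g : ℝ), (∀ ρ, w (RBFHFD.reflect ρ) = w ρ) ∧
      (∀ ρ, ρ ∉ stencil p q → w ρ = 0) ∧ (0 < t → t < δ → IsScaled T p q t 1 w g ∧
        ∀ w' g', IsScaled T p q t 1 w' g' → (∀ ρ ∈ stencil p q, w' ρ = w ρ) ∧ g' = g) := by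
    intro t
    by_cases ht : 0 < t ∧ t < δ
    · obtain ⟨w, g, h1, h2, h3⟩ := hball (y := t)
        (by rw [Real.dist_eq, sub_zero, abs_of_pos ht.1]; exact ht.2) ht.1
      exact ⟨w, g, h1, h2, fun _ _ => h3⟩
    -- Zero weights outside the interval keep symmetry and support valid for every `t`.
    · exact ⟨0, 0, fun _ => rfl, fun _ _ => rfl, fun h1 h2 => absurd ⟨h1, h2⟩ ht⟩
  choose w g h1 h2 h3 using this
  exact ⟨w, g, δ, hδ, h1, h2, h3⟩

end solvability

/-! ### Finite sums -/

lemma sum_range_two_mul {M : Type*} [AddCommMonoid M] (f : ℕ → M) (hf : ∀ k, f (2 * k + 1) = 0)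
    (m : ℕ) : ∑ K ∈ Finset.range (2 * m), f K = ∑ k ∈ Finset.range m, f (2 * k) := by
  induction m with
  | zero => rfl
  | succ m ih =>
    rw [show 2 * (m + 1) = 2 * m + 1 + 1 by ring, Finset.sum_range_succ, Finset.sum_range_succ, ih,
      hf, add_zero, Finset.sum_range_succ]

lemma sum_range_two_mul_add_one {M : Type*} [AddCommMonoid M] (f : ℕ → M)
    (hf : ∀ k, f (2 * k + 1) = 0) (m : ℕ) :
    ∑ K ∈ Finset.range (2 * m + 1), f K = ∑ k ∈ Finset.range (m + 1), f (2 * k) := by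
  rw [Finset.sum_range_succ, sum_range_two_mul f hf, Finset.sum_range_succ]

lemma sum_Icc_two_mul (f : ℕ → ℝ) (hf : ∀ k, f (2 * k + 1) = 0) (m : ℕ) :
    ∑ a ∈ Finset.Icc 1 (2 * m), f a = ∑ a ∈ Finset.Icc 1 m, f (2 * a) := by
  induction m with
  | zero => rfl
  | succ m ih =>
    rw [show 2 * (m + 1) = 2 * m + 1 + 1 by ring, Finset.sum_Icc_succ_top (by omega),
      Finset.sum_Icc_succ_top (by omega), ih, hf, add_zero, Finset.sum_Icc_succ_top (by omega)]
    rfl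

/-- The coefficients of `z ^ s` times the polynomial with coefficients `f`. -/
def shift (s : ℕ) (f : ℕ → ℚ) (k : ℕ) : ℚ := if s ≤ k then f (k - s) else 0

/-- Regrouping by total degree, as in a Cauchy product. The condition `s ≤ A` ensures that no pair
of total degree below `s` is cut off. -/
lemma isBigO_sum_sum {A s : ℕ} (hs : s ≤ A) (G : ℕ → ℕ → ℝ) (v : ℕ → ℝ)
    (h : ∀ m < s, ∑ κ ∈ Finset.range (m + 1), G κ (m - κ) = v m) :
    (fun t : ℝ => (∑ κ ∈ Finset.range A, ∑ k ∈ Finset.range A, G κ k * t ^ (2 * (κ + k)))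
      - ∑ m ∈ Finset.range s, v m * t ^ (2 * m)) =O[𝓝[>] 0] fun t => t ^ (2 * s) := by
  have h1 := isBigO_sum_monomial ((Finset.range A ×ˢ Finset.range A).filter fun x => s ≤ x.1 + x.2)
    (fun x => G x.1 x.2) (fun x => 2 * (x.1 + x.2)) (2 * s)
    (fun x hx => Or.inr (by have := (Finset.mem_filter.mp hx).2; omega))
  refine h1.congr_left fun t => ?_
  have h2 : ∑ m ∈ Finset.range s, v m * t ^ (2 * m)
      = ∑ x ∈ (Finset.range A ×ˢ Finset.range A).filter (fun x => ¬ s ≤ x.1 + x.2),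
        G x.1 x.2 * t ^ (2 * (x.1 + x.2)) := by
    have : ∑ m ∈ Finset.range s, v m * t ^ (2 * m) = ∑ m ∈ Finset.range s,
        ∑ κ ∈ Finset.range (m + 1), G κ (m - κ) * t ^ (2 * m) :=
      Finset.sum_congr rfl fun m hm => by rw [← h m (Finset.mem_range.mp hm), Finset.sum_mul]
    rw [this, Finset.sum_sigma']
    refine Finset.sum_nbij' (fun x => (x.2, x.1 - x.2)) (fun x => ⟨x.1 + x.2, x.1⟩) ?_ ?_ ?_ ?_ ?_
    · rintro ⟨m, κ⟩ hx
      simp at hx ⊢; omega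
    · rintro ⟨κ, k⟩ hx
      simp at hx ⊢; omega
    · rintro ⟨m, κ⟩ hx
      simp at hx ⊢; omega
    · rintro ⟨κ, k⟩ hx
      simp
    · rintro ⟨m, κ⟩ hx
      simp at hx ⊢
      rw [show κ + (m - κ) = m by omega]; tauto
  rw [h2, ← Finset.sum_product' (f := fun κ k => G κ k * t ^ (2 * (κ + k))),
    ← Finset.sum_filter_add_sum_filter_not (Finset.range A ×ˢ Finset.range A)
      (fun x => s ≤ x.1 + x.2)]
  ring

/-! ### The candidate for the solution -/

/-- The coefficient of `x ^ (2 i) * y ^ (2 j)` in `exp (-(x - y) ^ 2)`. -/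
def evenKernelCoeff (i j : ℕ) : ℚ :=
  (-1) ^ (i + j) * (2 * (i + j)).factorial
    / ((i + j).factorial * (2 * i).factorial * (2 * j).factorial)

lemma gaussCoeff_mul_choose (i j : ℕ) :
    gaussCoeff (2 * (i + j)) * (2 * (i + j)).choose (2 * i) = evenKernelCoeff i j := by
  have h := Nat.choose_mul_factorial_mul_factorial (show 2 * i ≤ 2 * (i + j) by omega)
  rw [show 2 * (i + j) - 2 * i = 2 * j by omega] at h
  have h' : ((2 * (i + j)).choose (2 * i) : ℚ) * (2 * i).factorial * (2 * j).factorial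
      = (2 * (i + j)).factorial := by exact_mod_cast h
  rw [gaussCoeff_even, evenKernelCoeff, ← h']
  have h1 : ((2 * i).factorial : ℚ) ≠ 0 := by positivity
  have h2 : ((2 * j).factorial : ℚ) ≠ 0 := by positivity
  field_simp

section candidate

variable (p q : ℕ) (W : ℤ ⊕ ℤ → ℕ → ℚ) (μ : ℕ → ℕ → ℚ)

/-- The coefficients of the expansion in powers of `t ^ 2` of the weights of the candidate. -/
def weightCoeff (ρ : ℤ ⊕ ℤ) (k : ℕ) : ℚ :=
  (if k = 0 then 2 * W ρ 2 else 0)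
    + ∑ a ∈ Finset.Icc 1 (p + q), W ρ (2 * a) * shift (p + q + 1 - a) (μ a) k

/-- The coefficients of the expansion in powers of `t ^ 2` of the even moments of the candidate. -/
noncomputable def momentCoeff (i k : ℕ) : ℚ :=
  (if k = 0 then 2 * moment p q W (2 * i) 2 - (if i = 1 then 2 else 0) else 0)
    + ∑ a ∈ Finset.Icc 1 (p + q), moment p q W (2 * i) (2 * a) * shift (p + q + 1 - a) (μ a) k

/-- The coefficients of the expansion in powers of `t ^ 2` of the residual of the candidate in the
system with elements of the exact Gaussian. -/
noncomputable def residualCoeff (b m : ℕ) : ℚ :=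
  ∑ κ ∈ Finset.range (m + 1), ∑ i ∈ Finset.range (κ + 1),
    evenKernelCoeff i (κ - i) * moment p q W (2 * (κ - i)) (2 * b) * momentCoeff p q W μ i (m - κ)

/-- The contribution of a modified coefficient of order `s` of the elements without
differentiation to the last equation. -/
noncomputable def defect (s : ℕ) : ℚ :=
  ∑ i ∈ support p, ∑ j ∈ support p,
    W (Sum.inl i) (2 * (p + q)) * (2 * W (Sum.inl j) 2) * ((j - i : ℤ) : ℚ) ^ s

/-- The candidate with the moments given by `μ` solves the scaled system up to the order that
determines `R` coefficients of the weights. -/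
structure IsCandidate (R : ℕ) (θ : ℚ) : Prop where
  residual : ∀ b ∈ Finset.Icc 1 (p + q), ∀ m ∈ Finset.range (b + (p + q) + R),
    residualCoeff p q W μ b m
      = if b = p + q ∧ m = 2 * (p + q) + R - 1 then θ * defect p q W (4 * (p + q) + 2 * R - 2)
        else 0

/-- The weights of the candidate. -/
noncomputable def candidate (R : ℕ) (ρ : ℤ ⊕ ℤ) (t : ℝ) : ℝ :=
  ∑ k ∈ Finset.range (2 * (p + q) + R), (weightCoeff p q W μ ρ k : ℝ) * t ^ (2 * k)

end candidate

/-! ### Residual of the candidate and its distance to the solution. -/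

section expansion

variable {T : (ℝ → ℝ) → ℝ → ℝ} {p q R : ℕ} {θ : ℚ} {W : ℤ ⊕ ℤ → ℕ → ℚ} {μ : ℕ → ℕ → ℚ}

lemma sum_weightCoeff_mul_pair (i k : ℕ) :
    ∑ ρ ∈ stencil p q, weightCoeff p q W μ ρ k * pair ρ (2 * i)
      - (if k = 0 then (if i = 1 then 2 else 0) else 0) = momentCoeff p q W μ i k := by
  simp only [weightCoeff, momentCoeff, add_mul, Finset.sum_add_distrib, moment, Finset.sum_mul]
  rw [Finset.sum_comm (s := stencil p q)]
  have : ∀ a ∈ Finset.Icc 1 (p + q), ∑ ρ ∈ stencil p q,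
      W ρ (2 * a) * shift (p + q + 1 - a) (μ a) k * pair ρ (2 * i)
      = ∑ ρ ∈ stencil p q, W ρ (2 * a) * pair ρ (2 * i) * shift (p + q + 1 - a) (μ a) k :=
    fun a _ => Finset.sum_congr rfl fun ρ _ => by ring
  rw [Finset.sum_congr rfl this]
  split_ifs with h1 h2
  · simp only [Finset.mul_sum, mul_assoc]; ring
  · simp only [Finset.mul_sum, mul_assoc]; ring
  · simp

lemma pair_rhs (i : ℕ) : pair (Sum.inr 0) i = if i = 2 then 2 else 0 := by
  rcases i with _ | _ | _ | i
  · simp [pair, ord]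
  · simp [pair, ord, Nat.descFactorial]
  · simp [pair, ord, Nat.descFactorial]
  · simp [pair, ord, node]

lemma combined_candidate_even (hR : 2 ≤ R) (i : ℕ) (t : ℝ) :
    combined p q (fun ρ => candidate p q W μ R ρ t) (2 * i) - pair (Sum.inr 0) (2 * i)
      = ∑ k ∈ Finset.range (2 * (p + q) + R), (momentCoeff p q W μ i k : ℝ) * t ^ (2 * k) := by
  have h1 : (pair (Sum.inr 0) (2 * i) : ℝ) = ∑ k ∈ Finset.range (2 * (p + q) + R),
      (((if k = 0 then (if i = 1 then 2 else 0) else 0 : ℚ)) : ℝ) * t ^ (2 * k) := by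
    rw [Finset.sum_eq_single 0]
    · simp [pair_rhs, show 2 * i = 2 ↔ i = 1 by omega]
    · intro k _ hk; simp [hk]
    · intro h; simp at h; omega
  have h2 : combined p q (fun ρ => candidate p q W μ R ρ t) (2 * i)
      = ∑ k ∈ Finset.range (2 * (p + q) + R),
        ((∑ ρ ∈ stencil p q, weightCoeff p q W μ ρ k * pair ρ (2 * i) : ℚ) : ℝ) * t ^ (2 * k) := by
    simp only [combined, candidate, Finset.sum_mul]
    rw [Finset.sum_comm]
    refine Finset.sum_congr rfl fun k _ => ?_
    push_cast
    rw [Finset.sum_mul]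
    exact Finset.sum_congr rfl fun ρ _ => by ring
  rw [h1, h2, ← Finset.sum_sub_distrib]
  refine Finset.sum_congr rfl fun k _ => ?_
  rw [← sum_weightCoeff_mul_pair, ← sub_mul, Rat.cast_sub]

lemma combined_odd {w : ℤ ⊕ ℤ → ℝ} (hw : ∀ ρ, w (reflect ρ) = w ρ) (i : ℕ) :
    combined p q w (2 * i + 1) = 0 := by
  have : combined p q w (2 * i + 1) = - combined p q w (2 * i + 1) := by
    conv_lhs => rw [combined, ← sum_reflect]
    rw [combined, ← Finset.sum_neg_distrib]
    refine Finset.sum_congr rfl fun ρ _ => ?_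
    rw [hw, pair_reflect, Odd.neg_one_pow ⟨i, rfl⟩]
    push_cast
    ring
  linarith

lemma IsDual.candidate_reflect (hW : IsDual p q W) (t : ℝ) (ρ : ℤ ⊕ ℤ) :
    candidate p q W μ R (reflect ρ) t = candidate p q W μ R ρ t := by
  have h : ∀ a, W (reflect ρ) (2 * a) = W ρ (2 * a) := fun a => by
    rw [hW.parity, Even.neg_one_pow ⟨a, by ring⟩, one_mul]
  have h2 : W (reflect ρ) 2 = W ρ 2 := h 1
  simp only [candidate, weightCoeff, h, h2]

/-- The residual of the candidate in the combined equations of the scaled system. -/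
noncomputable def residual (T : (ℝ → ℝ) → ℝ → ℝ) (p q R : ℕ) (W : ℤ ⊕ ℤ → ℕ → ℚ) (μ : ℕ → ℕ → ℚ)
    (b : ℕ) (t : ℝ) : ℝ :=
  ∑ σ ∈ stencil p q, (W σ b : ℝ)
    * (∑ ρ ∈ stencil p q, candidate p q W μ R ρ t * el T ρ σ t - el T (Sum.inr 0) σ t)

/-- By separation of variables, the residual sees the weights only through the differences of their
moments from those of `u ↦ u''(0)`. -/
lemma sum_elementCoeff_eq (v : ℤ ⊕ ℤ → ℝ) (b K : ℕ) :
    ∑ σ ∈ stencil p q, (W σ b : ℝ) * (∑ ρ ∈ stencil p q,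
      v ρ * (elementCoeff (ord ρ + ord σ) K ((node ρ - node σ : ℤ) : ℚ) : ℝ)
      - (elementCoeff (ord (Sum.inr 0) + ord σ) K ((node (Sum.inr 0) - node σ : ℤ) : ℚ) : ℝ))
    = gaussCoeff K * ∑ i ∈ Finset.range (K + 1), (K.choose i : ℝ) * (-1) ^ (K - i)
      * (moment p q W (K - i) b : ℝ) * (combined p q v i - pair (Sum.inr 0) i) := by
  simp only [elementCoeff_eq, moment]
  push_cast
  have h1 : ∀ σ : ℤ ⊕ ℤ, ∑ ρ ∈ stencil p q, v ρ * ((gaussCoeff K : ℝ) *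
      ∑ i ∈ Finset.range (K + 1), (K.choose i : ℝ) * (-1) ^ (K - i) * (pair ρ i : ℝ)
        * (pair σ (K - i) : ℝ))
      = gaussCoeff K * ∑ i ∈ Finset.range (K + 1), (K.choose i : ℝ) * (-1) ^ (K - i)
        * combined p q v i * (pair σ (K - i) : ℝ) := by
    intro σ
    simp only [combined, Finset.mul_sum, Finset.sum_mul]
    rw [Finset.sum_comm]
    exact Finset.sum_congr rfl fun i _ => Finset.sum_congr rfl fun ρ _ => by ring
  simp only [h1, ← mul_sub, ← Finset.sum_sub_distrib]
  simp only [Finset.mul_sum (Finset.range (K + 1))]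
  rw [Finset.sum_comm]
  refine Finset.sum_congr rfl fun i _ => ?_
  rw [Finset.mul_sum, Finset.sum_mul, Finset.mul_sum]
  exact Finset.sum_congr rfl fun σ _ => by ring

/-- Odd `K` drop out because the Gaussian is even and odd `i` because the candidate is symmetric,
which leaves a polynomial in `t²`. -/
lemma IsDual.sum_candidate_mul_sum_elementCoeff (hW : IsDual p q W) (hR : 2 ≤ R) (b : ℕ) (t : ℝ) :
    ∑ σ ∈ stencil p q, (W σ (2 * b) : ℝ) * (∑ ρ ∈ stencil p q, candidate p q W μ R ρ t
      * (∑ K ∈ Finset.range (4 * (p + q) + 2 * R),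
        (elementCoeff (ord ρ + ord σ) K ((node ρ - node σ : ℤ) : ℚ) : ℝ) * t ^ K)
      - ∑ K ∈ Finset.range (4 * (p + q) + 2 * R), (elementCoeff (ord (Sum.inr 0) + ord σ) K
        ((node (Sum.inr 0) - node σ : ℤ) : ℚ) : ℝ) * t ^ K)
    = ∑ κ ∈ Finset.range (2 * (p + q) + R), ∑ k ∈ Finset.range (2 * (p + q) + R),
      (∑ i ∈ Finset.range (κ + 1), (evenKernelCoeff i (κ - i) : ℝ)
        * (moment p q W (2 * (κ - i)) (2 * b) : ℝ) * (momentCoeff p q W μ i k : ℝ))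
        * t ^ (2 * (κ + k)) := by
  have h1 : ∀ K : ℕ, ∑ σ ∈ stencil p q, (W σ (2 * b) : ℝ) * (∑ ρ ∈ stencil p q,
      candidate p q W μ R ρ t * (elementCoeff (ord ρ + ord σ) K ((node ρ - node σ : ℤ) : ℚ) : ℝ)
      - (elementCoeff (ord (Sum.inr 0) + ord σ) K ((node (Sum.inr 0) - node σ : ℤ) : ℚ) : ℝ))
      = _ := fun K => sum_elementCoeff_eq (fun ρ => candidate p q W μ R ρ t) (2 * b) K
  calc _ = ∑ K ∈ Finset.range (4 * (p + q) + 2 * R), (∑ σ ∈ stencil p q, (W σ (2 * b) : ℝ)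
        * (∑ ρ ∈ stencil p q,
      candidate p q W μ R ρ t * (elementCoeff (ord ρ + ord σ) K ((node ρ - node σ : ℤ) : ℚ) : ℝ)
      - (elementCoeff (ord (Sum.inr 0) + ord σ) K ((node (Sum.inr 0) - node σ : ℤ) : ℚ) : ℝ)))
        * t ^ K := by
        simp only [Finset.sum_mul, Finset.mul_sum]
        rw [Finset.sum_comm]
        refine Finset.sum_congr rfl fun σ _ => ?_
        rw [Finset.sum_comm, ← Finset.sum_sub_distrib, Finset.mul_sum]
        refine Finset.sum_congr rfl fun K _ => ?_
        rw [mul_assoc, sub_mul, Finset.sum_mul]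
        simp only [mul_assoc]
    _ = ∑ K ∈ Finset.range (2 * (2 * (p + q) + R)), (gaussCoeff K *
        ∑ i ∈ Finset.range (K + 1), (K.choose i : ℝ) * (-1) ^ (K - i)
        * (moment p q W (K - i) (2 * b) : ℝ)
        * (combined p q (fun ρ => candidate p q W μ R ρ t) i - pair (Sum.inr 0) i)) * t ^ K := by
        rw [show 4 * (p + q) + 2 * R = 2 * (2 * (p + q) + R) by ring]
        simp only [h1]
    _ = _ := by
        rw [sum_range_two_mul _ (fun k => by rw [gaussCoeff_odd]; simp)]
        refine Finset.sum_congr rfl fun κ _ => ?_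
        rw [sum_range_two_mul_add_one _ (fun i => by
          rw [combined_odd (hW.candidate_reflect t), pair_rhs, if_neg (by omega)]; simp)]
        have h2 : ∀ i ∈ Finset.range (κ + 1), (gaussCoeff (2 * κ) : ℝ)
            * (((2 * κ).choose (2 * i) : ℝ) * (-1) ^ (2 * κ - 2 * i)
            * (moment p q W (2 * κ - 2 * i) (2 * b) : ℝ)
            * (combined p q (fun ρ => candidate p q W μ R ρ t) (2 * i)
              - pair (Sum.inr 0) (2 * i)))
            = (evenKernelCoeff i (κ - i) : ℝ) * (moment p q W (2 * (κ - i)) (2 * b) : ℝ)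
              * ∑ k ∈ Finset.range (2 * (p + q) + R),
                (momentCoeff p q W μ i k : ℝ) * t ^ (2 * k) := by
          intro i hi
          rw [combined_candidate_even hR, ← gaussCoeff_mul_choose,
            show i + (κ - i) = κ by simp at hi; omega, show 2 * κ - 2 * i = 2 * (κ - i) by omega,
            Even.neg_one_pow ⟨κ - i, by ring⟩]
          push_cast
          ring
        rw [Finset.mul_sum, Finset.sum_congr rfl h2]
        simp only [Finset.mul_sum, Finset.sum_mul]
        rw [Finset.sum_comm]
        refine Finset.sum_congr rfl fun k _ => Finset.sum_congr rfl fun i _ => ?_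
        rw [mul_add 2 κ k, pow_add]
        ring

lemma isBigO_candidate (ρ : ℤ ⊕ ℤ) :
    (fun t => candidate p q W μ R ρ t) =O[𝓝[>] 0] fun _ => (1 : ℝ) := by
  have := isBigO_sum_monomial (Finset.range (2 * (p + q) + R))
    (fun k => (weightCoeff p q W μ ρ k : ℝ)) (fun k => 2 * k) 0 (fun _ _ => Or.inr (Nat.zero_le _))
  simpa only [pow_zero, candidate] using this

lemma weightCoeff_zero (ρ : ℤ ⊕ ℤ) : weightCoeff p q W μ ρ 0 = 2 * W ρ 2 := by
  rw [weightCoeff, if_pos rfl, Finset.sum_eq_zero, add_zero]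
  intro a ha
  rw [Finset.mem_Icc] at ha
  rw [shift, if_neg (by omega), mul_zero]

lemma isBigO_candidate_sub (hR : 2 ≤ R) (ρ : ℤ ⊕ ℤ) :
    (fun t => candidate p q W μ R ρ t - 2 * W ρ 2) =O[𝓝[>] 0] fun t => t ^ 2 := by
  have := isBigO_sum_monomial (Finset.range (2 * (p + q) + R - 1))
    (fun k => (weightCoeff p q W μ ρ (k + 1) : ℝ)) (fun k => 2 * (k + 1)) 2
    (fun _ _ => Or.inr (by omega))
  refine this.congr_left fun t => ?_
  rw [candidate, show 2 * (p + q) + R = (2 * (p + q) + R - 1) + 1 by omega, Finset.sum_range_succ',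
    weightCoeff_zero]
  push_cast
  simp

/-- Each element is `A - B + O(t ^ Q)`, where `A` is the Gaussian series and `B` the term lost by
truncation. By `IsCandidate`, the part from `A` reduces to the `θ` term, and the part from `B`
cancels it. -/
lemma IsDual.isBigO_residual (hW : IsDual p q W) (hR : 2 ≤ R)
    (hT : Expands T (4 * (p + q) + 2 * R) θ) (hμ : IsCandidate p q W μ R θ) {b : ℕ}
    (hb : b ∈ Finset.Icc 1 (p + q)) :
    residual T p q R W μ (2 * b) =O[𝓝[>] 0] fun t => t ^ (2 * (b + (p + q) + R)) := by
  set n := p + q with hn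
  have hb' := Finset.mem_Icc.mp hb
  set Q := 4 * n + 2 * R with hQ
  set A : ℤ ⊕ ℤ → ℤ ⊕ ℤ → ℝ → ℝ := fun ρ σ t => ∑ K ∈ Finset.range Q,
    (elementCoeff (ord ρ + ord σ) K ((node ρ - node σ : ℤ) : ℚ) : ℝ) * t ^ K with hA
  set B : ℤ ⊕ ℤ → ℤ ⊕ ℤ → ℝ → ℝ := fun ρ σ t => if ord ρ + ord σ = 0 then
    (θ : ℝ) * ((node ρ - node σ : ℤ) : ℝ) ^ (Q - 2) * t ^ (Q - 2) else 0 with hB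
  have hel : ∀ ρ σ, (fun t => el T ρ σ t - (A ρ σ t - B ρ σ t)) =O[𝓝[>] 0] fun t => t ^ Q :=
    fun ρ σ => hT (ord ρ + ord σ) ((even_ord ρ).add (even_ord σ)) (node ρ - node σ)
  have h1 : (fun t => ∑ σ ∈ stencil p q, (W σ (2 * b) : ℝ)
      * (∑ ρ ∈ stencil p q, candidate p q W μ R ρ t * (el T ρ σ t - (A ρ σ t - B ρ σ t))
        - (el T (Sum.inr 0) σ t - (A (Sum.inr 0) σ t - B (Sum.inr 0) σ t))))
      =O[𝓝[>] 0] fun t => t ^ (2 * (b + n + R)) := by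
    refine IsBigO.trans ?_ (isBigO_pow_of_le (show 2 * (b + n + R) ≤ Q by omega))
    refine IsBigO.fun_sum fun σ _ => (IsBigO.sub (IsBigO.fun_sum fun ρ _ => ?_)
      (hel _ _)).const_mul_left _
    simpa only [one_mul] using (isBigO_candidate ρ).mul (hel ρ σ)
  have h2 : (fun t => (∑ σ ∈ stencil p q, (W σ (2 * b) : ℝ)
      * (∑ ρ ∈ stencil p q, candidate p q W μ R ρ t * A ρ σ t - A (Sum.inr 0) σ t))
        - ∑ m ∈ Finset.range (b + n + R), ((if b = n ∧ m = 2 * n + R - 1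
          then θ * defect p q W (Q - 2) else 0 : ℚ) : ℝ) * t ^ (2 * m))
      =O[𝓝[>] 0] fun t => t ^ (2 * (b + n + R)) := by
    simp only [hA, hQ, hn, hW.sum_candidate_mul_sum_elementCoeff hR]
    refine isBigO_sum_sum (by omega) _ _ fun m hm => ?_
    rw [← hμ.residual b hb m (Finset.mem_range.mpr hm), residualCoeff]
    push_cast
    rfl
  have h3 : (fun t => (∑ σ ∈ stencil p q, (W σ (2 * b) : ℝ)
      * (∑ ρ ∈ stencil p q, candidate p q W μ R ρ t * B ρ σ t - B (Sum.inr 0) σ t))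
        - ∑ m ∈ Finset.range (b + n + R), ((if b = n ∧ m = 2 * n + R - 1
          then θ * defect p q W (Q - 2) else 0 : ℚ) : ℝ) * t ^ (2 * m))
      =O[𝓝[>] 0] fun t => t ^ (2 * (b + n + R)) := by
    have e1 : ∀ t, ∑ σ ∈ stencil p q, (W σ (2 * b) : ℝ)
        * (∑ ρ ∈ stencil p q, candidate p q W μ R ρ t * B ρ σ t - B (Sum.inr 0) σ t)
        = ∑ i ∈ support p, ∑ j ∈ support p, (W (Sum.inl i) (2 * b) : ℝ)
          * (θ * ((j - i : ℤ) : ℝ) ^ (Q - 2)) * (t ^ (Q - 2) * candidate p q W μ R (Sum.inl j) t) := by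
      intro t
      simp only [sum_stencil, hB, ord, node, Sum.elim_inl, Sum.elim_inr, id]
      simp [Finset.mul_sum]
      exact Finset.sum_congr rfl fun i _ => Finset.sum_congr rfl fun j _ => by ring
    simp only [e1]
    -- `B` has order `t ^ (Q - 2)`, one factor `t²` short of the target only for `b = n`. There the
    -- candidate may be replaced by its leading weights `2 W ρ 2`; for `b < n` the term is already
    -- small enough.
    rcases eq_or_lt_of_le hb'.2 with hbn | hbn
    · have e2 : ∀ t : ℝ, ∑ m ∈ Finset.range (b + n + R), ((if b = n ∧ m = 2 * n + R - 1
          then θ * defect p q W (Q - 2) else 0 : ℚ) : ℝ) * t ^ (2 * m)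
          = ∑ i ∈ support p, ∑ j ∈ support p, (W (Sum.inl i) (2 * b) : ℝ)
          * (θ * ((j - i : ℤ) : ℝ) ^ (Q - 2)) * (t ^ (Q - 2) * (2 * W (Sum.inl j) 2)) := by
        intro t
        rw [Finset.sum_eq_single (2 * n + R - 1), if_pos ⟨hbn, rfl⟩, hbn,
          show 2 * (2 * n + R - 1) = Q - 2 by omega]
        · simp only [defect, ← hn]
          push_cast
          simp only [Finset.mul_sum, Finset.sum_mul]
          exact Finset.sum_congr rfl fun i _ => Finset.sum_congr rfl fun j _ => by ring
        · intro m _ hm; rw [if_neg (by tauto)]; simp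
        · intro h; simp at h; omega
      simp only [e2, ← Finset.sum_sub_distrib, ← mul_sub]
      refine IsBigO.fun_sum fun i _ => IsBigO.fun_sum fun j _ => IsBigO.const_mul_left ?_ _
      refine ((isBigO_refl (fun t : ℝ => t ^ (Q - 2)) _).mul
        (isBigO_candidate_sub hR (Sum.inl j))).congr_right fun t => ?_
      rw [← pow_add]; congr 1; omega
    · have e2 : ∀ t : ℝ, ∑ m ∈ Finset.range (b + n + R), ((if b = n ∧ m = 2 * n + R - 1
          then θ * defect p q W (Q - 2) else 0 : ℚ) : ℝ) * t ^ (2 * m) = 0 := fun t =>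
        Finset.sum_eq_zero fun m _ => by rw [if_neg (by omega)]; simp
      simp only [e2, sub_zero]
      refine IsBigO.trans ?_ (isBigO_pow_of_le (show 2 * (b + n + R) ≤ Q - 2 by omega))
      refine IsBigO.fun_sum fun i _ => IsBigO.fun_sum fun j _ => IsBigO.const_mul_left ?_ _
      simpa only [mul_one] using (isBigO_refl (fun t : ℝ => t ^ (Q - 2)) _).mul
        (isBigO_candidate (Sum.inl j))
  refine ((h1.add h2).sub h3).congr_left fun t => ?_
  simp only [residual, mul_sub, Finset.sum_sub_distrib]
  ring

lemma IsDual.combined_candidate_zero (hW : IsDual p q W) (hR : 2 ≤ R) (hn : 1 ≤ p + q) (t : ℝ) :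
    combined p q (fun ρ => candidate p q W μ R ρ t) 0 = 0 := by
  have := combined_candidate_even (p := p) (q := q) (W := W) (μ := μ) hR 0 t
  rw [mul_zero, pair_rhs, if_neg (by omega), Rat.cast_zero, sub_zero] at this
  rw [this]
  have hm : ∀ a ∈ Finset.Icc 1 (p + q), moment p q W 0 (2 * a) = 0 := fun a ha => by
    have ha' := Finset.mem_Icc.mp ha
    rw [hW.moment_eq (by omega) (by omega), if_neg (by omega)]
  have hm1 : moment p q W 0 2 = 0 := hm 1 (Finset.mem_Icc.mpr ⟨le_rfl, hn⟩)
  refine Finset.sum_eq_zero fun k _ => ?_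
  rw [momentCoeff, mul_zero, hm1, Finset.sum_eq_zero fun a ha => by rw [hm a ha, zero_mul]]
  simp

/-- The moments of the solution of the scaled system. -/
lemma IsDual.isBigO_combined (hW : IsDual p q W) (hR : 2 ≤ R) (hn : p + q ≤ 5)
    (hT : Expands T (4 * (p + q) + 2 * R) θ) (hμ : IsCandidate p q W μ R θ)
    {w : ℝ → ℤ ⊕ ℤ → ℝ} {g : ℝ → ℝ} (hsym : ∀ t ρ, w t (reflect ρ) = w t ρ)
    (hw : ∀ᶠ t in 𝓝[>] 0, IsScaled T p q t 1 (w t) (g t)) {a : ℕ} (ha : a ∈ Finset.Icc 1 (p + q)) :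
    (fun t => combined p q (w t) (2 * a)
      - combined p q (fun ρ => candidate p q W μ R ρ t) (2 * a))
      =O[𝓝[>] 0] fun t => t ^ (2 * (p + q + R - a)) := by
  set n := p + q with hndef
  -- Odd moments vanish by symmetry, so the even degrees form a closed system, and stability is
  -- applied to that principal submatrix only.
  set S := (Finset.Icc 1 n).image (2 * ·) with hS
  have hSsum : ∀ f : ℕ → ℝ, ∑ c ∈ S, f c = ∑ a ∈ Finset.Icc 1 n, f (2 * a) := fun f => by
    rw [hS, Finset.sum_image (fun x _ y _ h => by simpa using h)]
  have hSle : ∀ c ∈ S, c ≤ 2 * n := fun c hc => by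
    obtain ⟨a, ha, rfl⟩ := Finset.mem_image.mp hc
    have := Finset.mem_Icc.mp ha
    omega
  obtain ⟨C, hC⟩ := eventually_abs_le (s := S)
    (fun c hc => by have := hSle c hc; rw [Finset.mem_range]; omega)
    (fun a b t => reduced T p q W a b t / t ^ (a + b))
    (fun a ha b hb => hW.tendsto_reduced hT (by omega) (hSle a ha) (hSle b hb))
  have hrow : ∀ᶠ t in 𝓝[>] (0 : ℝ), ∀ b ∈ Finset.Icc 1 n, ∑ a ∈ Finset.Icc 1 n,
      (combined p q (w t) (2 * a) - combined p q (fun ρ => candidate p q W μ R ρ t) (2 * a))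
        * reduced T p q W (2 * a) (2 * b) t = - residual T p q R W μ (2 * b) t := by
    filter_upwards [hw] with t ht b hb
    have hb' := Finset.mem_Icc.mp hb
    have e1 := ht.sum_combined_mul_reduced hW (b := 2 * b) (Finset.mem_Icc.mpr (by omega))
    have e2 := hW.sum_combined_mul_reduced (T := T)
      (hW.combined_candidate_zero (μ := μ) hR (by omega) t) (2 * b) t
    rw [sum_Icc_two_mul _ (fun k => by rw [combined_odd (hsym t), zero_mul])] at e1
    rw [sum_Icc_two_mul _ (fun k => by rw [combined_odd (hW.candidate_reflect t), zero_mul])] at e2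
    simp only [sub_mul, Finset.sum_sub_distrib, residual, mul_sub]
    rw [e1, e2]
    ring
  have ha' := Finset.mem_Icc.mp ha
  -- The accuracy demanded of equation `b` grows with `b` exactly so that the scaled residuals share
  -- the order `2 (n + R)`.
  have hres : (fun t => ∑ b ∈ Finset.Icc 1 n, |residual T p q R W μ (2 * b) t / t ^ (2 * b)|)
      =O[𝓝[>] 0] fun t => t ^ (2 * (n + R)) := by
    refine IsBigO.fun_sum fun b hb => ?_
    obtain ⟨K, hK⟩ := (hW.isBigO_residual hR hT hμ hb).bound
    refine IsBigO.of_bound K ?_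
    filter_upwards [hK, self_mem_nhdsWithin] with t h1 (h2 : 0 < t)
    rw [Real.norm_eq_abs, abs_abs, abs_div, abs_of_pos (show 0 < t ^ (2 * b) by positivity),
      div_le_iff₀ (by positivity)]
    refine h1.trans (le_of_eq ?_)
    rw [Real.norm_of_nonneg (by positivity), Real.norm_of_nonneg (by positivity), mul_assoc,
      ← pow_add]
    congr 2; omega
  obtain ⟨K, hK⟩ := hres.bound
  refine IsBigO.of_bound (|C| * K) ?_
  filter_upwards [hC, hrow, hK, self_mem_nhdsWithin] with t h1 h2 h3 (h4 : 0 < t)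
  have h5 := h1 (fun c => (combined p q (w t) c
    - combined p q (fun ρ => candidate p q W μ R ρ t) c) * t ^ c) (2 * a)
    (Finset.mem_image.mpr ⟨a, ha, rfl⟩)
  have h6 : ∑ b ∈ S, |∑ c ∈ S, (combined p q (w t) c
      - combined p q (fun ρ => candidate p q W μ R ρ t) c) * t ^ c
      * (reduced T p q W c b t / t ^ (c + b))|
      = ∑ b ∈ Finset.Icc 1 n, |residual T p q R W μ (2 * b) t / t ^ (2 * b)| := by
    rw [hSsum]
    refine Finset.sum_congr rfl fun b hb => ?_
    rw [hSsum, ← abs_neg (_ / _), ← neg_div, ← h2 b hb, Finset.sum_div]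
    congr 1
    refine Finset.sum_congr rfl fun c _ => ?_
    rw [pow_add]
    field_simp
  simp only [h6] at h5
  have h7 : |(combined p q (w t) (2 * a)
      - combined p q (fun ρ => candidate p q W μ R ρ t) (2 * a)) * t ^ (2 * a)|
      ≤ |C| * K * t ^ (2 * (n + R)) := by
    refine h5.trans ?_
    rw [Real.norm_of_nonneg (Finset.sum_nonneg fun _ _ => abs_nonneg _),
      Real.norm_of_nonneg (by positivity)] at h3
    calc _ ≤ |C| * ∑ b ∈ Finset.Icc 1 n, |residual T p q R W μ (2 * b) t / t ^ (2 * b)| :=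
          mul_le_mul_of_nonneg_right (le_abs_self C) (Finset.sum_nonneg fun _ _ => abs_nonneg _)
      _ ≤ |C| * (K * t ^ (2 * (n + R))) := mul_le_mul_of_nonneg_left h3 (abs_nonneg C)
      _ = _ := by ring
  rw [abs_mul, abs_of_pos (show 0 < t ^ (2 * a) by positivity),
    show 2 * (n + R) = 2 * (n + R - a) + 2 * a by omega, pow_add, ← mul_assoc] at h7
  rw [Real.norm_eq_abs, Real.norm_of_nonneg (by positivity)]
  exact le_of_mul_le_mul_right h7 (by positivity)

lemma IsDual.moment_two_mul (hW : IsDual p q W) {i a : ℕ} (hi : i ≤ p + q) (ha : a ≤ p + q) :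
    moment p q W (2 * i) (2 * a) = if i = a then 1 else 0 := by
  rw [hW.moment_eq (by omega) (by omega)]
  exact if_congr (by omega) rfl rfl

/-- The weights of the solution of the scaled system. -/
lemma IsDual.isBigO_solution (hW : IsDual p q W) (hR : 2 ≤ R) (hn : p + q ≤ 5)
    (hn1 : 1 ≤ p + q) (hT : Expands T (4 * (p + q) + 2 * R) θ) (hμ : IsCandidate p q W μ R θ)
    {w : ℝ → ℤ ⊕ ℤ → ℝ} {g : ℝ → ℝ} (hsym : ∀ t ρ, w t (reflect ρ) = w t ρ)
    (hw : ∀ᶠ t in 𝓝[>] 0, IsScaled T p q t 1 (w t) (g t)) {ρ : ℤ ⊕ ℤ} (hρ : ρ ∈ stencil p q) :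
    (fun t => w t ρ - ∑ r ∈ Finset.range R, (weightCoeff p q W μ ρ r : ℝ) * t ^ (2 * r))
      =O[𝓝[>] 0] fun t => t ^ (2 * R) := by
  have h1 : (fun t => w t ρ - candidate p q W μ R ρ t) =O[𝓝[>] 0] fun t => t ^ (2 * R) := by
    have hsum : (fun t => ∑ a ∈ Finset.Icc 1 (p + q), (W ρ (2 * a) : ℝ)
        * (combined p q (w t) (2 * a)
          - combined p q (fun ρ => candidate p q W μ R ρ t) (2 * a)))
        =O[𝓝[>] 0] fun t => t ^ (2 * R) := by
      refine IsBigO.fun_sum fun a ha => IsBigO.const_mul_left ?_ _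
      refine (hW.isBigO_combined hR hn hT hμ hsym hw ha).trans (isBigO_pow_of_le ?_)
      have := Finset.mem_Icc.mp ha
      omega
    refine hsum.congr' ?_ EventuallyEq.rfl
    filter_upwards [hw] with t ht
    rw [← sum_Icc_two_mul (fun a => (W ρ a : ℝ) * (combined p q (w t) a
      - combined p q (fun ρ => candidate p q W μ R ρ t) a)) (fun k => by
        rw [combined_odd (hsym t), combined_odd (hW.candidate_reflect t), sub_zero, mul_zero]),
      ← sum_range_eq_sum_Icc]
    · simp only [mul_sub, Finset.sum_sub_distrib]
      rw [hW.sum_mul_combined _ hρ, hW.sum_mul_combined _ hρ]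
    · rw [hW.combined_candidate_zero hR hn1, show combined p q (w t) 0 = 0 from ht.const]
      simp
  have h2 := isBigO_sum_monomial (Finset.range (2 * (p + q)))
    (fun k => (weightCoeff p q W μ ρ (R + k) : ℝ)) (fun k => 2 * (R + k)) (2 * R)
    (fun _ _ => Or.inr (by omega))
  refine (h1.add h2).congr_left fun t => ?_
  rw [candidate, add_comm (2 * (p + q)) R, Finset.sum_range_add _ R]
  ring

/-- Supplies both the flat limit and the boundedness of the weights needed for the truncation error.
-/
lemma IsDual.isBigO_solution_sub (hW : IsDual p q W) (hR : 2 ≤ R) (hn : p + q ≤ 5)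
    (hn1 : 1 ≤ p + q) (hT : Expands T (4 * (p + q) + 2 * R) θ) (hμ : IsCandidate p q W μ R θ)
    {w : ℝ → ℤ ⊕ ℤ → ℝ} {g : ℝ → ℝ} (hsym : ∀ t ρ, w t (reflect ρ) = w t ρ)
    (hw : ∀ᶠ t in 𝓝[>] 0, IsScaled T p q t 1 (w t) (g t)) {ρ : ℤ ⊕ ℤ} (hρ : ρ ∈ stencil p q) :
    (fun t => w t ρ - 2 * W ρ 2) =O[𝓝[>] 0] fun t => t ^ 2 := by
  have h1 := (hW.isBigO_solution hR hn hn1 hT hμ hsym hw hρ).trans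
    (isBigO_pow_of_le (show 2 ≤ 2 * R by omega))
  have h2 := isBigO_sum_monomial (Finset.range (R - 1))
    (fun k => (weightCoeff p q W μ ρ (k + 1) : ℝ)) (fun k => 2 * (k + 1)) 2
    (fun _ _ => Or.inr (by omega))
  refine (h1.add h2).congr_left fun t => ?_
  nth_rewrite 1 [show R = R - 1 + 1 by omega]
  rw [Finset.sum_range_succ', weightCoeff_zero]
  push_cast
  simp only [pow_zero]
  ring

/-- The leading coefficients of the moments of the solution of the scaled system. -/
lemma IsDual.isBigO_combined_sub (hW : IsDual p q W) (hR : 2 ≤ R) (hn : p + q ≤ 5)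
    (hT : Expands T (4 * (p + q) + 2 * R) θ) (hμ : IsCandidate p q W μ R θ)
    {w : ℝ → ℤ ⊕ ℤ → ℝ} {g : ℝ → ℝ} (hsym : ∀ t ρ, w t (reflect ρ) = w t ρ)
    (hw : ∀ᶠ t in 𝓝[>] 0, IsScaled T p q t 1 (w t) (g t)) {a : ℕ} (ha : a ∈ Finset.Icc 1 (p + q)) :
    (fun t => combined p q (w t) (2 * a) - pair (Sum.inr 0) (2 * a)
      - μ a 0 * t ^ (2 * (p + q + 1 - a))) =O[𝓝[>] 0] fun t => t ^ (2 * (p + q + 2 - a)) := by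
  have ha' := Finset.mem_Icc.mp ha
  have h1 := (hW.isBigO_combined hR hn hT hμ hsym hw ha).trans
    (isBigO_pow_of_le (show 2 * (p + q + 2 - a) ≤ 2 * (p + q + R - a) by omega))
  set s := p + q + 1 - a with hs
  have hm : ∀ k, momentCoeff p q W μ a k = shift s (μ a) k := by
    intro k
    have e1 : moment p q W (2 * a) 2 = if a = 1 then 1 else 0 :=
      hW.moment_two_mul ha'.2 (a := 1) (by omega)
    rw [momentCoeff, e1, Finset.sum_eq_single a]
    · rw [hW.moment_two_mul ha'.2 ha'.2, if_pos (rfl : a = a)]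
      split_ifs <;> simp [hs]
    · intro c hc hne
      rw [hW.moment_two_mul ha'.2 (Finset.mem_Icc.mp hc).2, if_neg hne.symm, zero_mul]
    · exact fun h => absurd ha h
  have h2 := isBigO_sum_monomial (Finset.range (2 * (p + q) + R))
    (fun k => (shift s (μ a) k : ℝ) - if k = s then (μ a 0 : ℝ) else 0) (fun k => 2 * k)
    (2 * (p + q + 2 - a)) (fun k _ => by
      rcases lt_trichotomy k s with h | h | h
      · left; rw [shift, if_neg (by omega), if_neg (by omega)]; simp
      · left; rw [shift, if_pos h.ge, if_pos h, h, Nat.sub_self, sub_self]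
      · right; omega)
  refine (h1.add h2).congr_left fun t => ?_
  have h3 := combined_candidate_even (p := p) (q := q) (W := W) (μ := μ) hR a t
  simp only [hm] at h3
  simp only [sub_mul, Finset.sum_sub_distrib, ← h3, ite_mul, zero_mul]
  rw [Finset.sum_ite_eq', if_pos (Finset.mem_range.mpr (by omega))]
  ring

/-- The first moment that is not small. -/
lemma IsDual.isBigO_combined_last (hW : IsDual p q W) (hR : 2 ≤ R) (hn : p + q ≤ 5)
    (hn1 : 1 ≤ p + q)
    (hT : Expands T (4 * (p + q) + 2 * R) θ) (hμ : IsCandidate p q W μ R θ)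
    {w : ℝ → ℤ ⊕ ℤ → ℝ} {g : ℝ → ℝ} (hsym : ∀ t ρ, w t (reflect ρ) = w t ρ)
    (hw : ∀ᶠ t in 𝓝[>] 0, IsScaled T p q t 1 (w t) (g t)) :
    (fun t => combined p q (w t) (2 * (p + q + 1)) - 2 * moment p q W (2 * (p + q + 1)) 2)
      =O[𝓝[>] 0] fun t => t ^ 2 := by
  have h : (fun t => ∑ ρ ∈ stencil p q, (pair ρ (2 * (p + q + 1)) : ℝ) * (w t ρ - 2 * W ρ 2))
      =O[𝓝[>] 0] fun t => t ^ 2 :=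
    IsBigO.fun_sum fun ρ hρ =>
      (hW.isBigO_solution_sub hR hn hn1 hT hμ hsym hw hρ).const_mul_left _
  refine h.congr_left fun t => ?_
  rw [combined, moment]
  push_cast
  rw [Finset.mul_sum, ← Finset.sum_sub_distrib]
  exact Finset.sum_congr rfl fun ρ _ => by ring

end expansion

/-! ### Taylor expansion of the truncation error -/

lemma isBigO_taylor {u : ℝ → ℝ} {x₀ : ℝ} {N : ℕ} (hu : ContDiffAt ℝ N u x₀) :
    (fun x => u (x₀ + x) - ∑ k ∈ Finset.range N, iteratedDeriv k u x₀ / k.factorial * x ^ k)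
      =O[𝓝 0] fun x => x ^ N := by
  obtain ⟨r, hr, hball⟩ := Metric.eventually_nhds_iff_ball.mp
    (hu.eventually (by simp))
  have hon : ContDiffOn ℝ N u (Metric.ball x₀ r) := fun y hy => (hball y hy).contDiffWithinAt
  have h1 := taylor_isLittleO (convex_ball x₀ r) (Metric.mem_ball_self hr) hon
  rw [Metric.isOpen_ball.nhdsWithin_eq (Metric.mem_ball_self hr)] at h1
  have h2 : Tendsto (fun x : ℝ => x₀ + x) (𝓝 0) (𝓝 x₀) := by
    have : Tendsto (fun x : ℝ => x₀ + x) (𝓝 0) (𝓝 (x₀ + 0)) := tendsto_const_nhds.add tendsto_id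
    rwa [add_zero] at this
  have h3 := h1.isBigO.comp_tendsto h2
  simp only [Function.comp_def, add_sub_cancel_left] at h3
  have h4 : (fun x : ℝ => iteratedDeriv N u x₀ / N.factorial * x ^ N) =O[𝓝 0] fun x => x ^ N :=
    (isBigO_refl _ _).const_mul_left _
  refine (h3.add h4).congr_left fun x => ?_
  rw [taylor_within_apply, Finset.sum_range_succ]
  have h5 : ∀ k, iteratedDerivWithin k u (Metric.ball x₀ r) x₀ = iteratedDeriv k u x₀ := fun k =>
    iteratedDerivWithin_of_isOpen Metric.isOpen_ball (Metric.mem_ball_self hr)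
  simp only [h5, add_sub_cancel_left, smul_eq_mul]
  have h6 : ∀ k, ((k.factorial : ℝ)⁻¹ * x ^ k) * iteratedDeriv k u x₀
      = iteratedDeriv k u x₀ / k.factorial * x ^ k := fun k => by ring
  simp only [h6]
  ring

lemma iteratedDeriv_iteratedDeriv (k m : ℕ) (u : ℝ → ℝ) :
    iteratedDeriv k (iteratedDeriv m u) = iteratedDeriv (k + m) u := by
  simp only [iteratedDeriv_eq_iterate, ← Function.iterate_add_apply]

lemma contDiffAt_iteratedDeriv_two {u : ℝ → ℝ} {x₀ : ℝ} {N : ℕ}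
    (hu : ContDiffAt ℝ (N + 2 : ℕ) u x₀) : ContDiffAt ℝ N (iteratedDeriv 2 u) x₀ := by
  rw [iteratedDeriv_succ, iteratedDeriv_one]
  refine ContDiffAt.derivWithin (n := (N + 1 : ℕ)) ?_ (by norm_cast)
  exact ContDiffAt.derivWithin (n := (N + 2 : ℕ)) hu (by norm_cast)

/-- The value of a functional at the function `s ↦ u (x₀ + s h)`. -/
noncomputable def value (u : ℝ → ℝ) (x₀ h : ℝ) : ℤ ⊕ ℤ → ℝ :=
  Sum.elim (fun j => u (x₀ + j * h)) (fun k => h ^ 2 * iteratedDeriv 2 u (x₀ + k * h))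

/-- The functional acts on the Taylor polynomial term by term. For second derivatives the factor
`h²` restores the two powers lost by differentiation, and the terms `k = 0, 1` vanish. -/
lemma isBigO_value {u : ℝ → ℝ} {x₀ : ℝ} {N : ℕ} (hu : ContDiffAt ℝ (N + 2 : ℕ) u x₀) (ρ : ℤ ⊕ ℤ) :
    (fun h => value u x₀ h ρ
      - ∑ k ∈ Finset.range (N + 2), iteratedDeriv k u x₀ / k.factorial * pair ρ k * h ^ k)
      =O[𝓝[>] 0] fun h => h ^ (N + 2) := by
  have hlim : ∀ j : ℤ, Tendsto (fun h : ℝ => j * h) (𝓝[>] 0) (𝓝 0) := fun j => by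
    have : Tendsto (fun h : ℝ => j * h) (𝓝 0) (𝓝 (j * 0)) := tendsto_id.const_mul _
    rw [mul_zero] at this
    exact this.mono_left nhdsWithin_le_nhds
  have hpow : ∀ (j : ℤ) (m : ℕ), (fun h : ℝ => (j * h) ^ m) =O[𝓝[>] 0] fun h => h ^ m :=
    fun j m => by
      simp only [mul_pow]
      exact (isBigO_refl _ _).const_mul_left _
  rcases ρ with j | j
  · refine (((isBigO_taylor hu).comp_tendsto (hlim j)).trans (hpow j (N + 2))).congr_left
      fun h => ?_
    simp only [Function.comp_def, value, Sum.elim_inl]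
    congr 1
    refine Finset.sum_congr rfl fun k _ => ?_
    simp [pair, ord, node]
    ring
  · have h1 := ((isBigO_taylor (contDiffAt_iteratedDeriv_two hu)).comp_tendsto (hlim j)).trans
      (hpow j N)
    have h2 := (isBigO_refl (fun h : ℝ => h ^ 2) (𝓝[>] 0)).mul h1
    refine (h2.congr_right fun h => ?_).congr_left fun h => ?_
    · ring
    · simp only [Function.comp_def, value, Sum.elim_inr]
      rw [mul_sub, Finset.sum_range_succ', Finset.sum_range_succ']
      simp only [pair, ord, node, Sum.elim_inr, id]
      simp only [Nat.zero_descFactorial_succ, Nat.cast_zero, Rat.cast_mul, Rat.cast_zero, zero_mul,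
        mul_zero, add_zero, show Nat.descFactorial 1 2 = 0 from rfl, Rat.cast_natCast, zero_add]
      rw [Finset.mul_sum]
      congr 1
      refine Finset.sum_congr rfl fun k _ => ?_
      rw [iteratedDeriv_iteratedDeriv, show k + 1 + 1 - 2 = k by omega, Nat.factorial_succ,
        Nat.factorial_succ]
      have : (k + 2).descFactorial 2 = (k + 2) * (k + 1) := by
        simp [Nat.descFactorial]; ring
      rw [show k + 1 + 1 = k + 2 by ring, this]
      push_cast
      field_simp
      ring

lemma truncationError_eq {p q : ℕ} {w : ℤ ⊕ ℤ → ℝ} {α β : ℤ → ℝ} {h : ℝ} (hh : 0 < h)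
    (hα : ∀ i ∈ support p, α i = w (Sum.inl i) / h ^ 2)
    (hβ : ∀ k ∈ deletedSupport q, β k = w (Sum.inr k)) (u : ℝ → ℝ) (x₀ : ℝ) :
    truncationError p q α β h u x₀
      = (∑ ρ ∈ stencil p q, w ρ * value u x₀ h ρ - value u x₀ h (Sum.inr 0)) / h ^ 2 := by
  rw [truncationError, sum_stencil, sub_div, add_div, Finset.sum_div, Finset.sum_div]
  congr 1
  · congr 1
    · refine Finset.sum_congr rfl fun i hi => ?_
      rw [hα i hi, value, Sum.elim_inl]; ring
    · refine Finset.sum_congr rfl fun k hk => ?_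
      rw [hβ k hk, value, Sum.elim_inr]; field_simp
  · simp only [value, Sum.elim_inr]; field_simp; simp

/-- The truncation error of a symmetric formula in terms of its moments. -/
lemma abs_truncationError_sub_le {p q : ℕ} {u : ℝ → ℝ} {x₀ : ℝ}
    (hu : ContDiffAt ℝ ((2 * (p + q) + 4 : ℕ) : WithTop ℕ∞) u x₀) (M : ℝ) :
    ∃ C η : ℝ, 0 < η ∧ ∀ h : ℝ, 0 < h → h < η → ∀ w : ℤ ⊕ ℤ → ℝ,
      (∀ ρ, w (reflect ρ) = w ρ) → (∀ ρ ∈ stencil p q, |w ρ| ≤ M) → ∀ α β : ℤ → ℝ,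
      (∀ i ∈ support p, α i = w (Sum.inl i) / h ^ 2) →
      (∀ k ∈ deletedSupport q, β k = w (Sum.inr k)) →
      |truncationError p q α β h u x₀ - ∑ a ∈ Finset.range (p + q + 2),
        iteratedDeriv (2 * a) u x₀ / (2 * a).factorial
          * (combined p q w (2 * a) - pair (Sum.inr 0) (2 * a)) * h ^ (2 * a) / h ^ 2|
        ≤ C * h ^ (2 * (p + q) + 2) := by
  set n := p + q with hn
  set P : ℤ ⊕ ℤ → ℝ → ℝ := fun ρ h => ∑ k ∈ Finset.range (2 * n + 2 + 2),
    iteratedDeriv k u x₀ / k.factorial * pair ρ k * h ^ k with hP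
  have h1 : ∀ ρ, ∃ K : ℝ, ∀ᶠ h in 𝓝[>] (0 : ℝ),
      |value u x₀ h ρ - P ρ h| ≤ K * h ^ (2 * n + 4) := fun ρ => by
    obtain ⟨K, hK⟩ := (isBigO_value (N := 2 * n + 2) hu ρ).bound
    refine ⟨K, ?_⟩
    filter_upwards [hK, self_mem_nhdsWithin] with h hh (h0 : 0 < h)
    rwa [Real.norm_eq_abs, Real.norm_of_nonneg (by positivity)] at hh
  choose K hK using h1
  have hev : ∀ᶠ h in 𝓝[>] (0 : ℝ), ∀ ρ ∈ insert (Sum.inr 0) (stencil p q),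
      |value u x₀ h ρ - P ρ h| ≤ K ρ * h ^ (2 * n + 4) := by
    rw [Finset.eventually_all]
    exact fun ρ _ => hK ρ
  rw [eventually_nhdsWithin_iff] at hev
  obtain ⟨η, hη, hball⟩ := Metric.eventually_nhds_iff.mp hev
  -- The constants depend on the weights only through `M`; this later gives uniformity in `ε`.
  refine ⟨∑ ρ ∈ stencil p q, M * |K ρ| + |K (Sum.inr 0)|, η, hη, ?_⟩
  intro h h0 hlt w hsym hw α β hα hβ
  have hb := hball (y := h) (by rw [Real.dist_eq, sub_zero, abs_of_pos h0]; exact hlt) h0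
  have hmain : ∑ a ∈ Finset.range (n + 2), iteratedDeriv (2 * a) u x₀ / (2 * a).factorial
          * (combined p q w (2 * a) - pair (Sum.inr 0) (2 * a)) * h ^ (2 * a) / h ^ 2
      = (∑ ρ ∈ stencil p q, w ρ * P ρ h - P (Sum.inr 0) h) / h ^ 2 := by
    rw [← Finset.sum_div, ← sum_range_two_mul (fun k => iteratedDeriv k u x₀ / k.factorial
          * (combined p q w k - pair (Sum.inr 0) k) * h ^ k) (fun k => by
          rw [combined_odd hsym, pair_rhs, if_neg (by omega)]; simp)]
    congr 1
    rw [show 2 * (n + 2) = 2 * n + 2 + 2 by ring]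
    simp only [hP, Finset.mul_sum]
    rw [Finset.sum_comm, ← Finset.sum_sub_distrib]
    refine Finset.sum_congr rfl fun k _ => ?_
    rw [combined, mul_sub, sub_mul, Finset.mul_sum, Finset.sum_mul]
    congr 1
    exact Finset.sum_congr rfl fun ρ _ => by ring
  rw [hmain, truncationError_eq h0 hα hβ, ← sub_div, abs_div, abs_of_pos (by positivity : 0 < h ^ 2),
    div_le_iff₀ (by positivity)]
  have e1 : ∑ ρ ∈ stencil p q, w ρ * value u x₀ h ρ - value u x₀ h (Sum.inr 0)
      - (∑ ρ ∈ stencil p q, w ρ * P ρ h - P (Sum.inr 0) h)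
      = ∑ ρ ∈ stencil p q, w ρ * (value u x₀ h ρ - P ρ h)
        - (value u x₀ h (Sum.inr 0) - P (Sum.inr 0) h) := by
    simp only [mul_sub, Finset.sum_sub_distrib]; ring
  rw [e1]
  have hpos : 0 ≤ h ^ (2 * n + 4) := by positivity
  have e2 : ∀ ρ ∈ insert (Sum.inr 0) (stencil p q),
      |value u x₀ h ρ - P ρ h| ≤ |K ρ| * h ^ (2 * n + 4) := fun ρ hρ =>
    (hb ρ hρ).trans (mul_le_mul_of_nonneg_right (le_abs_self _) hpos)
  calc _ ≤ |∑ ρ ∈ stencil p q, w ρ * (value u x₀ h ρ - P ρ h)|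
        + |value u x₀ h (Sum.inr 0) - P (Sum.inr 0) h| := abs_sub _ _
    _ ≤ ∑ ρ ∈ stencil p q, M * (|K ρ| * h ^ (2 * n + 4)) + |K (Sum.inr 0)| * h ^ (2 * n + 4) := by
        refine add_le_add ((Finset.abs_sum_le_sum_abs _ _).trans
          (Finset.sum_le_sum fun ρ hρ => ?_)) (e2 _ (Finset.mem_insert_self _ _))
        rw [abs_mul]
        exact mul_le_mul (hw ρ hρ) (e2 ρ (Finset.mem_insert_of_mem hρ)) (abs_nonneg _)
          ((abs_nonneg _).trans (hw ρ hρ))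
    _ = _ := by
        rw [mul_assoc, ← pow_add, add_mul, Finset.sum_mul]
        simp only [mul_assoc]

/-! ### Compact finite difference formulas -/

/-- Duality to `x²` makes `2 W ρ 2` reproduce the second derivative up to degree `2 (p + q)`, and
symmetry covers the next odd degree. The error constant is thus the moment of degree `2 (p + q + 1)`
over its factorial. -/
lemma IsDual.isCompactFD {p q : ℕ} {W : ℤ ⊕ ℤ → ℕ → ℚ} (hW : IsDual p q W) (hn1 : 1 ≤ p + q)
    {A : Fin (p + 1) → ℝ} {B : Fin q → ℝ} {κ : ℝ}
    (hA : ∀ j, A j = ((2 * W (Sum.inl (j : ℕ)) 2 : ℚ) : ℝ))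
    (hB : ∀ k, B k = ((2 * W (Sum.inr ((k : ℕ) + 1)) 2 : ℚ) : ℝ))
    (hκ : κ * (2 * (p + q + 1)).factorial = ((2 * moment p q W (2 * (p + q + 1)) 2 : ℚ) : ℝ)) :
    IsCompactFD p q A B κ := by
  intro u x₀ hu
  set w : ℤ ⊕ ℤ → ℝ := fun ρ => ((2 * W ρ 2 : ℚ) : ℝ) with hw
  have hsym : ∀ ρ, w (reflect ρ) = w ρ := fun ρ => by simp [hw, hW.parity]
  obtain ⟨C, η, hη, hC⟩ := abs_truncationError_sub_le hu (∑ ρ ∈ stencil p q, |w ρ|)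
  refine ⟨C, η, hη, fun h h0 hlt α β hα hβ => ?_⟩
  have hα' : ∀ i ∈ support p, α i = w (Sum.inl i) / h ^ 2 := by
    intro i hi
    rw [support, Finset.mem_Icc] at hi
    obtain ⟨j, hj | hj⟩ := Int.eq_nat_or_neg i
    · have := (hα ⟨j, by omega⟩).1
      rw [hj]; simpa [hA, hw] using this
    · have := (hα ⟨j, by omega⟩).2
      rw [hj, show Sum.inl (-(j : ℤ)) = reflect (Sum.inl (j : ℤ)) from rfl, hsym]
      simpa [hA, hw] using this
  have hβ' : ∀ k ∈ deletedSupport q, β k = w (Sum.inr k) := by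
    intro i hi
    rw [deletedSupport, support, Finset.mem_erase, Finset.mem_Icc] at hi
    obtain ⟨j, hj | hj⟩ := Int.eq_nat_or_neg i
    · obtain ⟨k, rfl⟩ : ∃ k, j = k + 1 := ⟨j - 1, by omega⟩
      have := (hβ ⟨k, by omega⟩).1
      rw [hj]; simpa [hB, hw] using this
    · obtain ⟨k, rfl⟩ : ∃ k, j = k + 1 := ⟨j - 1, by omega⟩
      have := (hβ ⟨k, by omega⟩).2
      rw [hj, show Sum.inr (-((k + 1 : ℕ) : ℤ)) = reflect (Sum.inr ((k + 1 : ℕ) : ℤ)) from rfl, hsym]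
      simpa [hB, hw] using this
  have hmain := hC h h0 hlt w hsym
    (fun ρ hρ => Finset.single_le_sum (f := fun ρ => |w ρ|) (fun _ _ => abs_nonneg _) hρ)
    α β hα' hβ'
  have hcomb : ∀ i, combined p q w i = ((2 * moment p q W i 2 : ℚ) : ℝ) := fun i => by
    rw [combined, moment, Finset.mul_sum]
    push_cast
    exact Finset.sum_congr rfl fun ρ _ => by simp [hw, mul_assoc]
  rw [Finset.sum_range_succ, Finset.sum_eq_zero, zero_add, hcomb, ← hκ, pair_rhs,
    if_neg (by omega)] at hmain
  · refine le_of_eq_of_le ?_ hmain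
    congr 2
    have : ((2 * (p + q + 1)).factorial : ℝ) ≠ 0 := by positivity
    rw [show 2 * (p + q + 1) = 2 * (p + q) + 2 by ring] at this ⊢
    rw [pow_add]
    field_simp
    rw [Rat.cast_zero]
    ring
  · intro a ha
    have ha' := Finset.mem_range.mp ha
    have : moment p q W (2 * a) 2 = if a = 1 then 1 else 0 :=
      hW.moment_two_mul (a := 1) (by omega) hn1
    rw [hcomb, pair_rhs, this]
    split_ifs with h1 h2 h2
    · simp
    · omega
    · omega
    · simp

/-! ### Expansion of the weights -/

/-- The coefficients of the leading terms of the moments. -/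
noncomputable def leadingMoment (p q : ℕ) (W : ℤ ⊕ ℤ → ℕ → ℚ) (μ : ℕ → ℕ → ℚ) (a : ℕ) : ℚ :=
  if a = p + q + 1 then 2 * moment p q W (2 * (p + q + 1)) 2 else μ a 0

lemma exists_uniform_bound {ι : Type*} (S : Finset ι) (F : ι → ℝ → ℝ) (m : ι → ℕ)
    (hF : ∀ i ∈ S, F i =O[𝓝[>] 0] fun t => t ^ m i) :
    ∃ C δ : ℝ, 0 ≤ C ∧ 0 < δ ∧ ∀ t, 0 < t → t < δ → ∀ i ∈ S, |F i t| ≤ C * t ^ m i := by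
  have h1 : ∀ i, ∃ K : ℝ, i ∈ S → ∀ᶠ t in 𝓝[>] (0 : ℝ), |F i t| ≤ K * t ^ m i := fun i => by
    by_cases hi : i ∈ S
    · obtain ⟨K, hK⟩ := (hF i hi).bound
      refine ⟨K, fun _ => ?_⟩
      filter_upwards [hK, self_mem_nhdsWithin] with t ht (h0 : 0 < t)
      rwa [Real.norm_eq_abs, Real.norm_of_nonneg (by positivity)] at ht
    · exact ⟨0, fun h => absurd h hi⟩
  choose K hK using h1
  have hev : ∀ᶠ t in 𝓝[>] (0 : ℝ), ∀ i ∈ S, |F i t| ≤ K i * t ^ m i := by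
    rw [Finset.eventually_all]
    exact fun i hi => hK i hi
  rw [eventually_nhdsWithin_iff] at hev
  obtain ⟨δ, hδ, hball⟩ := Metric.eventually_nhds_iff.mp hev
  refine ⟨∑ i ∈ S, |K i|, δ, Finset.sum_nonneg fun _ _ => abs_nonneg _, hδ,
    fun t h0 hlt i hi => ?_⟩
  refine (hball (y := t) (by rw [Real.dist_eq, sub_zero, abs_of_pos h0]; exact hlt) h0 i hi).trans
    (mul_le_mul_of_nonneg_right ((le_abs_self _).trans ?_) (by positivity))
  exact Finset.single_le_sum (f := fun i => |K i|) (fun _ _ => abs_nonneg _) hi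

/-! ### From moments to truncation error and weight expansions. -/

section assembly

variable {T : (ℝ → ℝ) → ℝ → ℝ} {p q R : ℕ} {θ : ℚ} {W : ℤ ⊕ ℤ → ℕ → ℚ} {μ : ℕ → ℕ → ℚ}

lemma IsDual.isBigO_leadingMoment (hW : IsDual p q W) (hR : 2 ≤ R) (hn : p + q ≤ 5)
    (hn1 : 1 ≤ p + q) (hT : Expands T (4 * (p + q) + 2 * R) θ) (hμ : IsCandidate p q W μ R θ)
    {w : ℝ → ℤ ⊕ ℤ → ℝ} {g : ℝ → ℝ} (hsym : ∀ t ρ, w t (reflect ρ) = w t ρ)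
    (hw : ∀ᶠ t in 𝓝[>] 0, IsScaled T p q t 1 (w t) (g t)) {a : ℕ}
    (ha : a ∈ Finset.Icc 1 (p + q + 1)) :
    (fun t => combined p q (w t) (2 * a) - pair (Sum.inr 0) (2 * a)
      - leadingMoment p q W μ a * t ^ (2 * (p + q + 1 - a)))
      =O[𝓝[>] 0] fun t => t ^ (2 * (p + q + 2 - a)) := by
  have ha' := Finset.mem_Icc.mp ha
  by_cases h : a = p + q + 1
  · have := hW.isBigO_combined_last hR hn hn1 hT hμ hsym hw
    rw [leadingMoment, if_pos h, h, pair_rhs, if_neg (by omega)]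
    rw [show 2 * (p + q + 2 - (p + q + 1)) = 2 by omega]
    refine this.congr_left fun t => ?_
    push_cast
    simp
  · have := hW.isBigO_combined_sub hR hn hT hμ hsym hw (a := a) (Finset.mem_Icc.mpr (by omega))
    rwa [leadingMoment, if_neg h]

/-- The new index `s = n + 1 - a` is the power of `ε²` accompanying the derivative of order `2 a`.
-/
lemma sum_Icc_reflect (f : ℕ → ℝ) (n : ℕ) :
    ∑ a ∈ Finset.Icc 1 (n + 1), f a = ∑ s : Fin (n + 1), f (n + 1 - s) := by
  rw [Fin.sum_univ_eq_sum_range (fun s => f (n + 1 - s)) (n + 1)]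
  refine Finset.sum_nbij' (fun a => n + 1 - a) (fun s => n + 1 - s) ?_ ?_ ?_ ?_ ?_
  · intro a ha; simp at ha ⊢; omega
  · intro a ha; simp at ha ⊢; omega
  · intro a ha; simp at ha ⊢; omega
  · intro a ha; simp at ha ⊢; omega
  · intro a ha; simp at ha ⊢; congr 1; omega

/-- The truncation error of the formula whose weights solve the scaled system. -/
lemma IsDual.abs_truncationError_sub_le (hW : IsDual p q W) (hR : 2 ≤ R) (hn : p + q ≤ 5)
    (hn1 : 1 ≤ p + q) (hT : Expands T (4 * (p + q) + 2 * R) θ) (hμ : IsCandidate p q W μ R θ)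
    {w : ℝ → ℤ ⊕ ℤ → ℝ} {g : ℝ → ℝ} (hsym : ∀ t ρ, w t (reflect ρ) = w t ρ) {δ : ℝ} (hδ : 0 < δ)
    (hsol : ∀ t, 0 < t → t < δ → IsScaled T p q t 1 (w t) (g t))
    {κ : ℝ} {c : Fin (p + q + 1) → ℝ}
    (hc : ∀ s, κ * c s * (2 * (p + q + 1 - (s : ℕ))).factorial
      = (leadingMoment p q W μ (p + q + 1 - s) : ℝ))
    {u : ℝ → ℝ} {x₀ : ℝ} (hu : ContDiffAt ℝ ((2 * (p + q) + 4 : ℕ) : WithTop ℕ∞) u x₀) :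
    ∃ C η : ℝ, 0 < η ∧ ∀ ε h : ℝ, 0 < ε → 0 < h → h < η → ε * h < η →
      |truncationError p q (fun i => w (ε * h) (Sum.inl i) / h ^ 2)
          (fun k => w (ε * h) (Sum.inr k)) h u x₀
        - κ * h ^ (2 * (p + q)) * ∑ s : Fin (p + q + 1),
            c s * ε ^ (2 * (s : ℕ)) * iteratedDeriv (2 * (p + q) + 2 - 2 * (s : ℕ)) u x₀|
        ≤ C * (h ^ (2 * (p + q) + 2) * ∑ s ∈ Finset.range (p + q + 2), ε ^ (2 * s)) := by
  have hw : ∀ᶠ t in 𝓝[>] 0, IsScaled T p q t 1 (w t) (g t) := by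
    filter_upwards [Ioo_mem_nhdsGT hδ] with t ht using hsol t ht.1 ht.2
  obtain ⟨C₁, δ₁, hC₁, hδ₁, hb₁⟩ := exists_uniform_bound (stencil p q)
    (fun ρ t => w t ρ - 2 * W ρ 2) (fun _ => 2)
    (fun ρ hρ => hW.isBigO_solution_sub hR hn hn1 hT hμ hsym hw hρ)
  obtain ⟨C₂, δ₂, hC₂, hδ₂, hb₂⟩ := exists_uniform_bound (Finset.Icc 1 (p + q + 1))
    (fun a t => combined p q (w t) (2 * a) - pair (Sum.inr 0) (2 * a)
      - leadingMoment p q W μ a * t ^ (2 * (p + q + 1 - a))) (fun a => 2 * (p + q + 2 - a))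
    (fun a ha => hW.isBigO_leadingMoment hR hn hn1 hT hμ hsym hw ha)
  set M : ℝ := C₁ * δ₁ ^ 2 + ∑ ρ ∈ stencil p q, |(2 * W ρ 2 : ℝ)| with hM
  obtain ⟨C₃, η, hη, hC₃⟩ := RBFHFD.abs_truncationError_sub_le hu M
  set D : ℝ := ∑ a ∈ Finset.Icc 1 (p + q + 1), |iteratedDeriv (2 * a) u x₀ / (2 * a).factorial|
    with hD
  refine ⟨|C₃| + D * C₂, min η (min δ (min δ₁ δ₂)),
    lt_min hη (lt_min hδ (lt_min hδ₁ hδ₂)), fun ε h hε h0 hh ht => ?_⟩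
  simp only [lt_min_iff] at hh ht
  set t := ε * h with htdef
  have ht0 : 0 < t := mul_pos hε h0
  have hsc := hsol t ht0 ht.2.1
  have hbound : ∀ ρ ∈ stencil p q, |w t ρ| ≤ M := by
    intro ρ hρ
    have h1 := hb₁ t ht0 ht.2.2.1 ρ hρ
    have h2 : |(2 * W ρ 2 : ℝ)| ≤ ∑ ρ ∈ stencil p q, |(2 * W ρ 2 : ℝ)| :=
      Finset.single_le_sum (f := fun ρ => |(2 * W ρ 2 : ℝ)|) (fun _ _ => abs_nonneg _) hρ
    have h3 : t ^ 2 ≤ δ₁ ^ 2 := pow_le_pow_left₀ ht0.le ht.2.2.1.le 2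
    calc |w t ρ| = |(w t ρ - 2 * W ρ 2) + 2 * W ρ 2| := by ring_nf
      _ ≤ |w t ρ - 2 * W ρ 2| + |(2 * W ρ 2 : ℝ)| := abs_add_le _ _
      _ ≤ C₁ * δ₁ ^ 2 + ∑ ρ ∈ stencil p q, |(2 * W ρ 2 : ℝ)| :=
          add_le_add (h1.trans (mul_le_mul_of_nonneg_left h3 hC₁)) h2
  have hτ := hC₃ h h0 hh.1 (w t) (hsym t) hbound _ _ (fun _ _ => rfl) (fun _ _ => rfl)
  set E : ℝ := ∑ s ∈ Finset.range (p + q + 2), ε ^ (2 * s) with hE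
  have hE1 : 1 ≤ E := by
    have := Finset.single_le_sum (f := fun s => ε ^ (2 * s)) (fun _ _ => by positivity)
      (show 0 ∈ Finset.range (p + q + 2) by simp)
    simpa using this
  -- With `t = ε h`, the factor `t ^ (2 (n + 1 - a)) h ^ (2 a) / h²` equals `ε ^ (2 (n + 1 - a)) h ^
  -- (2 n)` for every `a`, where `n = p + q`.
  have hlead : κ * h ^ (2 * (p + q)) * ∑ s : Fin (p + q + 1),
      c s * ε ^ (2 * (s : ℕ)) * iteratedDeriv (2 * (p + q) + 2 - 2 * (s : ℕ)) u x₀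
      = ∑ a ∈ Finset.Icc 1 (p + q + 1), iteratedDeriv (2 * a) u x₀ / (2 * a).factorial
        * (leadingMoment p q W μ a * t ^ (2 * (p + q + 1 - a))) * h ^ (2 * a) / h ^ 2 := by
    rw [sum_Icc_reflect, Finset.mul_sum]
    refine Finset.sum_congr rfl fun s _ => ?_
    have hs := s.2
    rw [← hc s, show p + q + 1 - (p + q + 1 - (s : ℕ)) = s by omega, htdef, mul_pow,
      show 2 * (p + q) + 2 - 2 * (s : ℕ) = 2 * (p + q + 1 - s) by omega]
    have hf : ((2 * (p + q + 1 - (s : ℕ))).factorial : ℝ) ≠ 0 := by positivity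
    have hh2 : h ^ (2 * (s : ℕ)) * h ^ (2 * (p + q + 1 - (s : ℕ))) = h ^ (2 * (p + q)) * h ^ 2 := by
      rw [← pow_add, ← pow_add]; congr 1; omega
    field_simp
    linear_combination (-(κ * c s * iteratedDeriv (2 * (p + q + 1 - (s : ℕ))) u x₀)) * hh2
  have hsum0 : ∑ a ∈ Finset.range (p + q + 2), iteratedDeriv (2 * a) u x₀ / (2 * a).factorial
      * (combined p q (w t) (2 * a) - pair (Sum.inr 0) (2 * a)) * h ^ (2 * a) / h ^ 2
      = ∑ a ∈ Finset.Icc 1 (p + q + 1), iteratedDeriv (2 * a) u x₀ / (2 * a).factorial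
      * (combined p q (w t) (2 * a) - pair (Sum.inr 0) (2 * a)) * h ^ (2 * a) / h ^ 2 := by
    refine sum_range_eq_sum_Icc ?_ (p + q + 1)
    rw [mul_zero, show combined p q (w t) 0 = 0 from hsc.const, pair_rhs]
    simp
  have hdiff : |∑ a ∈ Finset.range (p + q + 2), iteratedDeriv (2 * a) u x₀ / (2 * a).factorial
      * (combined p q (w t) (2 * a) - pair (Sum.inr 0) (2 * a)) * h ^ (2 * a) / h ^ 2
      - κ * h ^ (2 * (p + q)) * ∑ s : Fin (p + q + 1),
      c s * ε ^ (2 * (s : ℕ)) * iteratedDeriv (2 * (p + q) + 2 - 2 * (s : ℕ)) u x₀|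
      ≤ D * C₂ * (h ^ (2 * (p + q) + 2) * E) := by
    rw [hlead, hsum0, ← Finset.sum_sub_distrib, hD, Finset.sum_mul, Finset.sum_mul]
    refine (Finset.abs_sum_le_sum_abs _ _).trans (Finset.sum_le_sum fun a ha => ?_)
    have ha' := Finset.mem_Icc.mp ha
    rw [← sub_div, ← sub_mul, ← mul_sub, abs_div, abs_mul, abs_mul,
      abs_of_pos (show 0 < h ^ (2 * a) by positivity), abs_of_pos (show 0 < h ^ 2 by positivity),
      div_le_iff₀ (by positivity)]
    have h1 := hb₂ t ht0 ht.2.2.2 a ha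
    have h2 : ε ^ (2 * (p + q + 2 - a)) ≤ E :=
      Finset.single_le_sum (f := fun s => ε ^ (2 * s)) (fun _ _ => by positivity)
        (show p + q + 2 - a ∈ Finset.range (p + q + 2) by simp; omega)
    -- The moment errors carry one more factor `t²`, hence `h ^ (2 n + 2)` times a single monomial
    -- of the sum `E`.
    have h3 : t ^ (2 * (p + q + 2 - a)) * h ^ (2 * a)
        = ε ^ (2 * (p + q + 2 - a)) * h ^ (2 * (p + q) + 2) * h ^ 2 := by
      rw [htdef, mul_pow, mul_assoc, mul_assoc, ← pow_add, ← pow_add]; congr 2; omega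
    calc _ ≤ |iteratedDeriv (2 * a) u x₀ / (2 * a).factorial| * (C₂ * t ^ (2 * (p + q + 2 - a)))
          * h ^ (2 * a) := by gcongr
      _ = |iteratedDeriv (2 * a) u x₀ / (2 * a).factorial| * C₂
          * (ε ^ (2 * (p + q + 2 - a)) * h ^ (2 * (p + q) + 2) * h ^ 2) := by rw [← h3]; ring
      _ ≤ |iteratedDeriv (2 * a) u x₀ / (2 * a).factorial| * C₂ * (E * h ^ (2 * (p + q) + 2) * h ^ 2) := by
          gcongr
      _ = _ := by ring
  -- The Taylor remainder of `u` carries no power of `ε`; it is absorbed by the constant term of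
  -- `E`.
  have hfirst : C₃ * h ^ (2 * (p + q) + 2) ≤ |C₃| * (h ^ (2 * (p + q) + 2) * E) := by
    have : h ^ (2 * (p + q) + 2) ≤ h ^ (2 * (p + q) + 2) * E :=
      le_mul_of_one_le_right (by positivity) hE1
    calc _ ≤ |C₃| * h ^ (2 * (p + q) + 2) :=
          mul_le_mul_of_nonneg_right (le_abs_self _) (by positivity)
      _ ≤ _ := mul_le_mul_of_nonneg_left this (abs_nonneg _)
  rw [add_mul]
  refine (abs_sub_le _ _ _).trans (add_le_add (hτ.trans hfirst) hdiff)

/-- The expansions of weights and truncation error, given the dual combinations of functionals and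
an approximate solution of the scaled system. -/
theorem IsDual.hasExpansion (hW : IsDual p q W) (hR : 2 ≤ R) (hn : p + q ≤ 5) (hn1 : 1 ≤ p + q)
    (hS : Scales T) (hT : Expands T (4 * (p + q) + 2 * R) θ) (hμ : IsCandidate p q W μ R θ)
    {a : Fin (p + 1) → Fin R → ℝ} {b : Fin q → Fin R → ℝ} {κ : ℝ} {c : Fin (p + q + 1) → ℝ}
    {A : Fin (p + 1) → ℝ} {B : Fin q → ℝ}
    (ha : ∀ j r, a j r = (weightCoeff p q W μ (Sum.inl (j : ℕ)) r : ℝ))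
    (hb : ∀ k r, b k r = (weightCoeff p q W μ (Sum.inr ((k : ℕ) + 1)) r : ℝ))
    (hA : ∀ j, A j = ((2 * W (Sum.inl (j : ℕ)) 2 : ℚ) : ℝ))
    (hB : ∀ k, B k = ((2 * W (Sum.inr ((k : ℕ) + 1)) 2 : ℚ) : ℝ))
    (hc : ∀ s, κ * c s * (2 * (p + q + 1 - (s : ℕ))).factorial
      = (leadingMoment p q W μ (p + q + 1 - s) : ℝ)) :
    HasExpansion T p q R a b κ c A B := by
  obtain ⟨w, g, δ₀, hδ₀, hsym, hoff, hsol⟩ := hW.exists_solution hT (by omega) hn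
  have hw : ∀ᶠ t in 𝓝[>] 0, IsScaled T p q t 1 (w t) (g t) := by
    filter_upwards [Ioo_mem_nhdsGT hδ₀] with t ht using (hsol t ht.1 ht.2).1
  obtain ⟨C, δ₁, hC, hδ₁, hbound⟩ := exists_uniform_bound (stencil p q)
    (fun ρ t => w t ρ - ∑ r ∈ Finset.range R, (weightCoeff p q W μ ρ r : ℝ) * t ^ (2 * r))
    (fun _ => 2 * R) (fun ρ hρ => hW.isBigO_solution hR hn hn1 hT hμ hsym hw hρ)
  have hinl : ∀ j : Fin (p + 1), Sum.inl ((j : ℕ) : ℤ) ∈ stencil p q := fun j => by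
    have := j.2
    rw [mem_stencil_inl, support, Finset.mem_Icc]; omega
  have hinr : ∀ k : Fin q, Sum.inr (((k : ℕ) : ℤ) + 1) ∈ stencil p q := fun k => by
    have := k.2
    rw [mem_stencil_inr, deletedSupport, support, Finset.mem_erase, Finset.mem_Icc]; omega
  have hlim : ∀ ρ ∈ stencil p q, ∀ h : ℝ, 0 < h →
      Tendsto (fun ε => w (ε * h) ρ) (𝓝[>] 0) (𝓝 (2 * W ρ 2)) := by
    intro ρ hρ h h0
    have h1 : Tendsto (fun t => w t ρ - 2 * W ρ 2) (𝓝[>] 0) (𝓝 0) := by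
      refine (hW.isBigO_solution_sub hR hn hn1 hT hμ hsym hw hρ).trans_tendsto ?_
      have : Tendsto (fun t : ℝ => t ^ 2) (𝓝 0) (𝓝 (0 ^ 2)) := tendsto_id.pow 2
      rw [zero_pow two_ne_zero] at this
      exact this.mono_left nhdsWithin_le_nhds
    have h2 : Tendsto (fun ε : ℝ => ε * h) (𝓝[>] 0) (𝓝[>] 0) := by
      refine tendsto_nhdsWithin_iff.mpr ⟨?_, ?_⟩
      · have : Tendsto (fun ε : ℝ => ε * h) (𝓝 0) (𝓝 (0 * h)) := tendsto_id.mul_const h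
        rw [zero_mul] at this
        exact this.mono_left nhdsWithin_le_nhds
      · filter_upwards [self_mem_nhdsWithin] with ε (hε : 0 < ε) using mul_pos hε h0
    have h3 := (h1.comp h2).add_const (2 * (W ρ 2 : ℝ))
    simpa [Function.comp_def] using h3
  refine ⟨fun ε h i => w (ε * h) (Sum.inl i) / h ^ 2, fun ε h k => w (ε * h) (Sum.inr k),
    fun ε h => g (ε * h) / h ^ 2, min δ₀ δ₁, lt_min hδ₀ hδ₁, ?_, ?_, ⟨C, ?_⟩, ?_, ?_⟩
  · intro x₀ ε h hε h0 ht α' β' γ'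
    obtain ⟨hs, huniq⟩ := hsol (ε * h) (mul_pos hε h0) (ht.trans_le (min_le_left _ _))
    have hh : h ^ 2 ≠ 0 := by positivity
    rw [isWeights_iff hS x₀ ε h p q h0]
    constructor
    · rintro ⟨h1, h2, h3⟩
      obtain ⟨h4, h5⟩ := huniq _ _ h3
      refine ⟨funext fun i => ?_, funext fun k => ?_, ?_⟩
      · by_cases hi : i ∈ support p
        · rw [eq_div_iff hh, ← h4 _ (mem_stencil_inl.mpr hi), Sum.elim_inl, mul_comm]
        · beta_reduce
          rw [h1 i hi, hoff _ _ (fun h => hi (mem_stencil_inl.mp h)), zero_div]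
      · by_cases hk : k ∈ deletedSupport q
        · exact h4 _ (mem_stencil_inr.mpr hk)
        · beta_reduce
          rw [h2 k hk, hoff _ _ (fun h => hk (mem_stencil_inr.mp h))]
      · rw [eq_div_iff hh, ← h5, mul_comm]
    · rintro ⟨rfl, rfl, rfl⟩
      refine ⟨fun i hi => ?_, fun k hk => ?_, ?_⟩
      · beta_reduce
        rw [hoff _ _ (fun h => hi (mem_stencil_inl.mp h)), zero_div]
      · beta_reduce
        rw [hoff _ _ (fun h => hk (mem_stencil_inr.mp h))]
      · have e1 : (Sum.elim (fun i => h ^ 2 * (w (ε * h) (Sum.inl i) / h ^ 2))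
            fun k => w (ε * h) (Sum.inr k) : ℤ ⊕ ℤ → ℝ) = w (ε * h) := by
          funext ρ
          rcases ρ with i | i
          · rw [Sum.elim_inl]; field_simp
          · rfl
        rw [e1, mul_div_cancel₀ _ hh]
        exact hs
  · intro ε h hε h0 ht i
    exact ⟨by simpa [reflect] using congrArg (· / h ^ 2) (hsym (ε * h) (Sum.inl i)),
      hsym (ε * h) (Sum.inr i)⟩
  · intro ε h hε h0 ht
    have hb' := hbound (ε * h) (mul_pos hε h0) (ht.trans_le (min_le_right _ _))
    constructor
    · intro j
      have h1 := hb' _ (hinl j)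
      have e1 : ∑ r : Fin R, a j r * ε ^ (2 * (r : ℕ)) * h ^ (2 * (r : ℕ)) / h ^ 2
          = (∑ r ∈ Finset.range R, (weightCoeff p q W μ (Sum.inl (j : ℕ)) r : ℝ)
            * (ε * h) ^ (2 * r)) / h ^ 2 := by
        rw [← Fin.sum_univ_eq_sum_range (fun r => (weightCoeff p q W μ (Sum.inl (j : ℕ)) r : ℝ)
            * (ε * h) ^ (2 * r)) R, Finset.sum_div]
        exact Finset.sum_congr rfl fun r _ => by rw [ha]; ring
      rw [e1, ← sub_div, abs_div, abs_of_pos (show 0 < h ^ 2 by positivity), ← mul_div_assoc,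
        ← mul_pow]
      gcongr
    · intro k
      have h1 := hb' _ (hinr k)
      have e1 : ∑ r : Fin R, b k r * ε ^ (2 * (r : ℕ)) * h ^ (2 * (r : ℕ))
          = ∑ r ∈ Finset.range R, (weightCoeff p q W μ (Sum.inr ((k : ℕ) + 1)) r : ℝ)
            * (ε * h) ^ (2 * r) := by
        rw [← Fin.sum_univ_eq_sum_range (fun r => (weightCoeff p q W μ (Sum.inr ((k : ℕ) + 1)) r : ℝ)
            * (ε * h) ^ (2 * r)) R]
        exact Finset.sum_congr rfl fun r _ => by rw [hb]; ring
      rw [e1, ← mul_pow]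
      exact h1
  · intro u x₀ hu
    exact hW.abs_truncationError_sub_le hR hn hn1 hT hμ hsym hδ₀
      (fun t h1 h2 => (hsol t h1 h2).1) hc hu
  · intro h h0
    refine ⟨fun j => ?_, fun k => ?_⟩
    · rw [hA j]
      push_cast
      exact (hlim _ (hinl j) h h0).div_const _
    · rw [hB k]
      push_cast
      exact hlim _ (hinr k) h h0

end assembly

/-! ### The four stencils -/

/-- The sign of the reflection symmetry of a column of given degree. -/
def reflectSign (j : ℤ) (a : ℕ) : ℚ := if a % 2 = 0 then 1 else j.sign

lemma reflectSign_neg (j : ℤ) (a : ℕ) : reflectSign (-j) a = (-1) ^ a * reflectSign j a := by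
  unfold reflectSign
  split_ifs with h
  · rw [Even.neg_one_pow (Nat.even_iff.mpr h), one_mul]
  · rw [Odd.neg_one_pow (Nat.odd_iff.mpr (by omega)), Int.sign_neg]
    push_cast
    ring

/-- The combinations of functionals whose coefficients at the nodes with nonnegative index are
listed in `L`: first the values at `0, …, p`, then the second derivatives at `1, …, q`. -/
def dualTable (L : List (List ℚ)) (p : ℕ) : ℤ ⊕ ℤ → ℕ → ℚ :=
  Sum.elim (fun j a => reflectSign j a * (L.getD j.natAbs []).getD a 0)
    fun k a => reflectSign k a * (L.getD (p + k.natAbs) []).getD a 0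

lemma dualTable_reflect (L : List (List ℚ)) (p : ℕ) (ρ : ℤ ⊕ ℤ) (a : ℕ) :
    dualTable L p (reflect ρ) a = (-1) ^ a * dualTable L p ρ a := by
  rcases ρ with j | j
  · simp [dualTable, reflect, reflectSign_neg, mul_assoc]
  · simp [dualTable, reflect, reflectSign_neg, mul_assoc]

/-- The coefficients of the moments of positive even degree listed in `L`. -/
def momentTable (L : List (List ℚ)) (a k : ℕ) : ℚ := (L.getD (a - 1) []).getD k 0

lemma cast_mul_natCast_eq {x : ℝ} {κ : ℚ} (hκ : x = κ) {N : ℕ} {z : ℚ} (h : κ * N = z) :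
    x * N = z := by
  rw [hκ, ← h]
  push_cast
  rfl

/-! ### Order 4. -/

/-- The dual combinations for the stencil `(1, 1)`. -/
def dual₄ : ℤ ⊕ ℤ → ℕ → ℚ :=
  dualTable [[1, 0, -6/5, 0, 1/5], [0, 1/2, 3/5, 0, -1/10], [0, -1/12, -1/20, 1/12, 1/20]] 1

/-- The table inverts the confluent Vandermonde matrix; both products with it are evaluated, and
parity is built into `dualTable`. -/
lemma isDual₄ : IsDual 1 1 dual₄ :=
  ⟨by decide +kernel, by decide +kernel, dualTable_reflect _ _⟩

lemma functionFlat₄ (j : Fin 2) :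
    (![-12/5, 6/5] : Fin 2 → ℝ) j = ((2 * dual₄ (Sum.inl (j : ℕ)) 2 : ℚ) : ℝ) := by
  have h : ∀ j : Fin 2, 2 * dual₄ (Sum.inl (j : ℕ)) 2 = ![-12/5, 6/5] j := by
    decide +kernel
  rw [h]
  fin_cases j <;> simp

lemma operatorFlat₄ (k : Fin 1) :
    (![-1/10] : Fin 1 → ℝ) k = ((2 * dual₄ (Sum.inr ((k : ℕ) + 1)) 2 : ℚ) : ℝ) := by
  have h : ∀ k : Fin 1, 2 * dual₄ (Sum.inr ((k : ℕ) + 1)) 2 = ![-1/10] k := by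
    decide +kernel
  rw [h]
  fin_cases k
  simp

lemma isCompactFD₄ :
    IsCompactFD 1 1 ![-12/5, 6/5] ![-1/10] (-1/200) :=
  isDual₄.isCompactFD (by norm_num) functionFlat₄ operatorFlat₄
    (cast_mul_natCast_eq (κ := -1/200) (by norm_num) (by decide +kernel))

/-- The coefficients of the leading term of the truncation error for `dual₄`. -/
def errorCoeff₄ (K : Type*) [Field K] : Fin 3 → K := ![1, 28, 140]

lemma errorCoeff₄_cast (s : Fin 3) : errorCoeff₄ ℝ s = errorCoeff₄ ℚ s := by
  fin_cases s <;> simp [errorCoeff₄]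

/-- The coefficients of the moments for the system of the stencil `(1, 1)`. -/
def moment₄ : ℕ → ℕ → ℚ :=
  momentTable [[-7/5, -31/75, 53347/112500], [-84/25, -2229/625, -23281/46875]]

-- Each moment needs `R - 1` coefficients: moment `2 a` begins at `t ^ (2 (n + 1 - a))` and is
-- wanted up to `O(t ^ (2 (n + R - a)))`.
set_option maxRecDepth 100000 in
lemma isCandidate₄ : IsCandidate 1 1 dual₄ moment₄ 4 0 :=
  ⟨by decide +kernel⟩

/-- The coefficients of the weights of the function values for `moment₄`. -/
def functionCoeff₄ (K : Type*) [Field K] : Fin 2 → Fin 4 → K :=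
  ![![-12/5, -84/125, 3021/3125, 92969/234375],
    ![6/5, 42/125, -3021/6250, -92969/468750]]

/-- The coefficients of the weights of the second derivatives for `moment₄`. -/
def operatorCoeff₄ (K : Type*) [Field K] : Fin 1 → Fin 4 → K :=
  ![![-1/10, -26250/156250, -16925/156250, -651/156250]]

lemma functionCoeff₄_cast (j : Fin 2) (r : Fin 4) :
    functionCoeff₄ ℝ j r = functionCoeff₄ ℚ j r := by
  fin_cases j <;> fin_cases r <;> simp [functionCoeff₄]

lemma operatorCoeff₄_cast (k : Fin 1) (r : Fin 4) :
    operatorCoeff₄ ℝ k r = operatorCoeff₄ ℚ k r := by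
  fin_cases k
  fin_cases r <;> simp [operatorCoeff₄]

lemma hasExpansion₄ :
    HasExpansion id 1 1 4 (functionCoeff₄ ℝ) (operatorCoeff₄ ℝ)
      (-1/200) (errorCoeff₄ ℝ)
      ![-12/5, 6/5] ![-1/10] :=
  isDual₄.hasExpansion (by norm_num) (by norm_num) (by norm_num)
    scales_id (expands_id _) isCandidate₄
    (fun j r => (functionCoeff₄_cast j r).trans
      (congrArg Rat.cast (by revert j r; decide +kernel)))
    (fun k r => (operatorCoeff₄_cast k r).trans
      (congrArg Rat.cast (by revert k r; decide +kernel)))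
    functionFlat₄ operatorFlat₄
    (fun s => cast_mul_natCast_eq (κ := -1/200 * errorCoeff₄ ℚ s)
      (by rw [errorCoeff₄_cast]; norm_num) (by revert s; decide +kernel))

/-! ### Order 6. -/

/-- The dual combinations for the stencil `(2, 1)`. -/
def dual₆ : ℤ ⊕ ℤ → ℕ → ℚ :=
  dualTable [[1, 0, -51/44, 0, 3/22, 0, 1/44],
      [0, 4/15, 6/11, 1/3, -1/66, -1/10, -1/33],
      [0, 7/60, 3/88, -1/6, -7/132, 1/20, 5/264],
      [0, -1/5, -1/11, 1/4, 5/44, -1/20, -1/44]] 2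

lemma isDual₆ : IsDual 2 1 dual₆ :=
  ⟨by decide +kernel, by decide +kernel, dualTable_reflect _ _⟩

lemma functionFlat₆ (j : Fin 3) :
    (![-51/22, 12/11, 3/44] : Fin 3 → ℝ) j = ((2 * dual₆ (Sum.inl (j : ℕ)) 2 : ℚ) : ℝ) := by
  have h : ∀ j : Fin 3, 2 * dual₆ (Sum.inl (j : ℕ)) 2 = ![-51/22, 12/11, 3/44] j := by
    decide +kernel
  rw [h]
  fin_cases j <;> simp

lemma operatorFlat₆ (k : Fin 1) :
    (![-2/11] : Fin 1 → ℝ) k = ((2 * dual₆ (Sum.inr ((k : ℕ) + 1)) 2 : ℚ) : ℝ) := by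
  have h : ∀ k : Fin 1, 2 * dual₆ (Sum.inr ((k : ℕ) + 1)) 2 = ![-2/11] k := by
    decide +kernel
  rw [h]
  fin_cases k
  simp

lemma isCompactFD₆ :
    IsCompactFD 2 1 ![-51/22, 12/11, 3/44] ![-2/11] (23/55440) :=
  isDual₆.isCompactFD (by norm_num) functionFlat₆ operatorFlat₆
    (cast_mul_natCast_eq (κ := 23/55440) (by norm_num) (by decide +kernel))

/-- The coefficients of the leading term of the truncation error for `dual₆`. -/
def errorCoeff₆ (K : Type*) [Field K] : Fin 4 → K := ![1, 54, 756, 2520]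

lemma errorCoeff₆_cast (s : Fin 4) : errorCoeff₆ ℝ s = errorCoeff₆ ℚ s := by
  fin_cases s <;> simp [errorCoeff₆]

/-- The coefficients of the moments for the system of the stencil `(2, 1)`. -/
def moment₆ : ℕ → ℕ → ℚ :=
  momentTable [[23/11, 271/242, -6292793/3913140], [414/55, 50159/4235, 2943062/1630475],
    [1242/77, 300555/5929, 17155354/326095]]

set_option maxRecDepth 100000 in
lemma isCandidate₆ : IsCandidate 2 1 dual₆ moment₆ 4 0 :=
  ⟨by decide +kernel⟩

/-- The coefficients of the weights of the function values for `moment₆`. -/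
def functionCoeff₆ (K : Type*) [Field K] : Fin 3 → Fin 4 → K :=
  ![![-51/22, 621/1694, 2841651/1304380, 5555227/14348180],
    ![12/11, -414/847, -538116/326095, -4542297/7174090],
    ![3/44, 1035/3388, 1463277/2608760, 12613961/28696360]]

/-- The coefficients of the weights of the second derivatives for `moment₆`. -/
def operatorCoeff₆ (K : Type*) [Field K] : Fin 1 → Fin 4 → K :=
  ![![-2/11, -79381958040/216542732560, -64254114540/216542732560, -8624761068/216542732560]]

lemma functionCoeff₆_cast (j : Fin 3) (r : Fin 4) :
    functionCoeff₆ ℝ j r = functionCoeff₆ ℚ j r := by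
  fin_cases j <;> fin_cases r <;> simp [functionCoeff₆]

lemma operatorCoeff₆_cast (k : Fin 1) (r : Fin 4) :
    operatorCoeff₆ ℝ k r = operatorCoeff₆ ℚ k r := by
  fin_cases k
  fin_cases r <;> simp [operatorCoeff₆]

lemma hasExpansion₆ :
    HasExpansion id 2 1 4 (functionCoeff₆ ℝ) (operatorCoeff₆ ℝ)
      (23/55440) (errorCoeff₆ ℝ)
      ![-51/22, 12/11, 3/44] ![-2/11] :=
  isDual₆.hasExpansion (by norm_num) (by norm_num) (by norm_num)
    scales_id (expands_id _) isCandidate₆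
    (fun j r => (functionCoeff₆_cast j r).trans
      (congrArg Rat.cast (by revert j r; decide +kernel)))
    (fun k r => (operatorCoeff₆_cast k r).trans
      (congrArg Rat.cast (by revert k r; decide +kernel)))
    functionFlat₆ operatorFlat₆
    (fun s => cast_mul_natCast_eq (κ := 23/55440 * errorCoeff₆ ℚ s)
      (by rw [errorCoeff₆_cast]; norm_num) (by revert s; decide +kernel))

/-! ### Order 8, with and without truncation. -/

/-- The dual combinations for the stencil `(2, 2)`. -/
def dual₈ : ℤ ⊕ ℤ → ℕ → ℚ :=
  dualTable [[1, 0, -265/262, 0, -249/2096, 0, 155/1048, 0, -37/2096],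
      [0, -8/21, 160/393, 4/3, 88/393, -1/2, -58/393, 1/21, 13/786],
      [0, 37/84, 155/1572, -2/3, -2069/12576, 1/4, 463/6288, -1/42, -97/12576],
      [0, -148/315, -172/1179, 2/3, 82/393, -13/60, -109/1572, 5/252, 31/4716],
      [0, -17/630, -23/4716, 1/24, 53/6288, -1/60, -13/3144, 1/504, 11/18864]] 2

lemma isDual₈ : IsDual 2 2 dual₈ :=
  ⟨by decide +kernel, by decide +kernel, dualTable_reflect _ _⟩

lemma functionFlat₈ (j : Fin 3) :
    (![-265/131, 320/393, 155/786] : Fin 3 → ℝ) j = ((2 * dual₈ (Sum.inl (j : ℕ)) 2 : ℚ) : ℝ) := by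
  have h : ∀ j : Fin 3, 2 * dual₈ (Sum.inl (j : ℕ)) 2 = ![-265/131, 320/393, 155/786] j := by
    decide +kernel
  rw [h]
  fin_cases j <;> simp

lemma operatorFlat₈ (k : Fin 2) :
    (![-344/1179, -23/2358] : Fin 2 → ℝ) k = ((2 * dual₈ (Sum.inr ((k : ℕ) + 1)) 2 : ℚ) : ℝ) := by
  have h : ∀ k : Fin 2, 2 * dual₈ (Sum.inr ((k : ℕ) + 1)) 2 = ![-344/1179, -23/2358] k := by
    decide +kernel
  rw [h]
  fin_cases k <;> simp

lemma isCompactFD₈ :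
    IsCompactFD 2 2 ![-265/131, 320/393, 155/786] ![-344/1179, -23/2358] (-79/2971080) :=
  isDual₈.isCompactFD (by norm_num) functionFlat₈ operatorFlat₈
    (cast_mul_natCast_eq (κ := -79/2971080) (by norm_num) (by decide +kernel))

/-- The coefficients of the leading term of the truncation error for `dual₈`. -/
def errorCoeff₈ (K : Type*) [Field K] : Fin 5 → K := ![1, 88, 2376, 22176, 55440]

lemma errorCoeff₈_cast (s : Fin 5) : errorCoeff₈ ℝ s = errorCoeff₈ ℚ s := by
  fin_cases s <;> simp [errorCoeff₈]

/-- Here `Q = 22`, so the even degrees up to 20 matter. Undifferentiated elements stop at degree 18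
and lose the coefficient `1 / 10!` of `t ^ 20`; two or more derivatives keep degree 20. -/
lemma expands_taylorTruncation_eighteen :
    Expands (taylorTruncation 18) (4 * (2 + 2) + 2 * 3) (1/3628800) :=
  expands_taylorTruncation (by norm_num) (by decide +kernel) (by norm_num) (by decide +kernel)

/-- The coefficients of the moments for the system of the stencil `(2, 2)` with all
elements expanded up to order eighteen. -/
def moment₈_eighteen : ℕ → ℕ → ℚ :=
  momentTable [[-3476/1179, -1444234819589/88962624], [-27808/1965, -4334094582031/74135520],
    [-41712/917, -1445820692485/11532192], [-111232/1179, -1450166936069/11120328]]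

-- The lost term enters only the last coefficient of the last equation. It leaves the leading
-- moments as in `moment₈` but, through the coupling, changes all the next ones. So the error term
-- agrees with the untruncated system, and the weights differ from their third coefficient on.
set_option maxRecDepth 100000 in
lemma isCandidate₈_eighteen : IsCandidate 2 2 dual₈ moment₈_eighteen 3 (1/3628800) :=
  ⟨by decide +kernel⟩

/-- The coefficients of the weights of the function values for `moment₈_eighteen`. -/
def functionCoeff₈_eighteen (K : Type*) [Field K] : Fin 3 → Fin 3 → K :=
  ![![-265/131, 257224/154449, 374495573482511/163157452416],
    ![320/393, -723008/463347, -131554452784583/61184044656],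
    ![155/786, 337172/463347, 981384524105795/978944714496]]

/-- The coefficients of the weights of the second derivatives for `moment₈_eighteen`. -/
def operatorCoeff₈_eighteen (K : Type*) [Field K] : Fin 2 → Fin 3 → K :=
  ![![-344/1179, -862048/1390041, -313528367747261/367104267936],
    ![-23/2358, -76472/1390041, -111386667913345/1468417071744]]

lemma functionCoeff₈_eighteen_cast (j : Fin 3) (r : Fin 3) :
    functionCoeff₈_eighteen ℝ j r = functionCoeff₈_eighteen ℚ j r := by
  fin_cases j <;> fin_cases r <;> simp [functionCoeff₈_eighteen]

lemma operatorCoeff₈_eighteen_cast (k : Fin 2) (r : Fin 3) :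
    operatorCoeff₈_eighteen ℝ k r = operatorCoeff₈_eighteen ℚ k r := by
  fin_cases k <;> fin_cases r <;> simp [operatorCoeff₈_eighteen]

lemma hasExpansion₈_eighteen :
    HasExpansion (taylorTruncation 18) 2 2 3 (functionCoeff₈_eighteen ℝ) (operatorCoeff₈_eighteen ℝ)
      (-79/2971080) (errorCoeff₈ ℝ)
      ![-265/131, 320/393, 155/786] ![-344/1179, -23/2358] :=
  isDual₈.hasExpansion (by norm_num) (by norm_num) (by norm_num)
    (scales_taylorTruncation 18) expands_taylorTruncation_eighteen isCandidate₈_eighteen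
    (fun j r => (functionCoeff₈_eighteen_cast j r).trans
      (congrArg Rat.cast (by revert j r; decide +kernel)))
    (fun k r => (operatorCoeff₈_eighteen_cast k r).trans
      (congrArg Rat.cast (by revert k r; decide +kernel)))
    functionFlat₈ operatorFlat₈
    (fun s => cast_mul_natCast_eq (κ := -79/2971080 * errorCoeff₈ ℚ s)
      (by rw [errorCoeff₈_cast]; norm_num) (by revert s; decide +kernel))

/-- The coefficients of the moments for the system of the stencil `(2, 2)`. -/
def moment₈ : ℕ → ℕ → ℚ :=
  momentTable [[-3476/1179, -1196912/463347], [-27808/1965, -64985768/2316735],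
    [-41712/917, -56740000/360381], [-111232/1179, -28527424/51483]]

set_option maxRecDepth 100000 in
lemma isCandidate₈ : IsCandidate 2 2 dual₈ moment₈ 3 0 :=
  ⟨by decide +kernel⟩

/-- The coefficients of the weights of the function values for `moment₈`. -/
def functionCoeff₈ (K : Type*) [Field K] : Fin 3 → Fin 3 → K :=
  ![![-265/131, 257224/154449, 144176866/47209911],
    ![320/393, -723008/463347, -347214464/141629733],
    ![155/786, 337172/463347, 130949165/141629733]]

/-- The coefficients of the weights of the second derivatives for `moment₈`. -/
def operatorCoeff₈ (K : Type*) [Field K] : Fin 2 → Fin 3 → K :=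
  ![![-344/1179, -862048/1390041, -207500044/424889199],
    ![-23/2358, -76472/1390041, -57373250/424889199]]

lemma functionCoeff₈_cast (j : Fin 3) (r : Fin 3) :
    functionCoeff₈ ℝ j r = functionCoeff₈ ℚ j r := by
  fin_cases j <;> fin_cases r <;> simp [functionCoeff₈]

lemma operatorCoeff₈_cast (k : Fin 2) (r : Fin 3) :
    operatorCoeff₈ ℝ k r = operatorCoeff₈ ℚ k r := by
  fin_cases k <;> fin_cases r <;> simp [operatorCoeff₈]

lemma hasExpansion₈ :
    HasExpansion id 2 2 3 (functionCoeff₈ ℝ) (operatorCoeff₈ ℝ)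
      (-79/2971080) (errorCoeff₈ ℝ)
      ![-265/131, 320/393, 155/786] ![-344/1179, -23/2358] :=
  isDual₈.hasExpansion (by norm_num) (by norm_num) (by norm_num)
    scales_id (expands_id _) isCandidate₈
    (fun j r => (functionCoeff₈_cast j r).trans
      (congrArg Rat.cast (by revert j r; decide +kernel)))
    (fun k r => (operatorCoeff₈_cast k r).trans
      (congrArg Rat.cast (by revert k r; decide +kernel)))
    functionFlat₈ operatorFlat₈
    (fun s => cast_mul_natCast_eq (κ := -79/2971080 * errorCoeff₈ ℚ s)
      (by rw [errorCoeff₈_cast]; norm_num) (by revert s; decide +kernel))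

/-! ### Order 10, where truncation at order 24 is harmless. -/

/-- The dual combinations for the stencil `(3, 2)`. -/
def dual₁₀ : ℤ ⊕ ℤ → ℕ → ℚ :=
  dualTable [[1, 0, -14335/16182, 0, -45529/129456, 0, 12281/43152, 0, -6427/129456, 0, 337/129456],
      [0, -831/644, 1065/3596, 67/24, 9271/21576, -1709/1472, -46321/172608, 2591/15456,
        1289/28768, -35/4416, -397/172608],
      [0, 2757/3220, 519/3596, -4/3, -21517/86304, 127/230, 53251/431520, -38/483, -557/28768,
        1/276, 409/431520],
      [0, 251/9660, 79/32364, -1/24, -293/64728, 139/7360, 2293/863040, -53/15456, -161/258912,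
        1/4416, 131/2589120],
      [0, -137/161, -167/899, 23/18, 4573/16182, -545/1104, -4865/43152, 271/3864, 361/21576,
        -11/3312, -107/129456],
      [0, -31/322, -43/3596, 11/72, 2791/129456, -37/552, -511/43152, 43/3864, 103/43152,
        -1/1656, -19/129456]] 3

lemma isDual₁₀ : IsDual 3 2 dual₁₀ :=
  ⟨by decide +kernel, by decide +kernel, dualTable_reflect _ _⟩

lemma functionFlat₁₀ (j : Fin 4) :
    (![-14335/8091, 1065/1798, 519/1798, 79/16182] : Fin 4 → ℝ) j
      = ((2 * dual₁₀ (Sum.inl (j : ℕ)) 2 : ℚ) : ℝ) := by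
  have h : ∀ j : Fin 4, 2 * dual₁₀ (Sum.inl (j : ℕ)) 2
      = ![-14335/8091, 1065/1798, 519/1798, 79/16182] j := by
    decide +kernel
  rw [h]
  fin_cases j <;> simp

lemma operatorFlat₁₀ (k : Fin 2) :
    (![-334/899, -43/1798] : Fin 2 → ℝ) k = ((2 * dual₁₀ (Sum.inr ((k : ℕ) + 1)) 2 : ℚ) : ℝ) := by
  have h : ∀ k : Fin 2, 2 * dual₁₀ (Sum.inr ((k : ℕ) + 1)) 2 = ![-334/899, -43/1798] k := by
    decide +kernel
  rw [h]
  fin_cases k <;> simp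

lemma isCompactFD₁₀ :
    IsCompactFD 3 2 ![-14335/8091, 1065/1798, 519/1798, 79/16182] ![-334/899, -43/1798]
      (619/299043360) :=
  isDual₁₀.isCompactFD (by norm_num) functionFlat₁₀ operatorFlat₁₀
    (cast_mul_natCast_eq (κ := 619/299043360) (by norm_num) (by decide +kernel))

/-- The coefficients of the leading term of the truncation error for `dual₁₀`. -/
def errorCoeff₁₀ (K : Type*) [Field K] : Fin 6 → K := ![1, 130, 5720, 102960, 720720, 1441440]

lemma errorCoeff₁₀_cast (s : Fin 6) : errorCoeff₁₀ ℝ s = errorCoeff₁₀ ℚ s := by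
  fin_cases s <;> simp [errorCoeff₁₀]

/-- Here `Q = 26`. The only degree below `Q` that can be dropped is 25, where the Gaussian
coefficient is zero, so the candidate of the untruncated system also serves the truncated one. -/
lemma expands_taylorTruncation_twentyFour : Expands (taylorTruncation 24) (4 * (3 + 2) + 2 * 3) 0 :=
  expands_taylorTruncation (by norm_num) (by decide +kernel) (by norm_num) (by decide +kernel)

/-- The coefficients of the moments for the system of the stencil `(3, 2)`. -/
def moment₁₀ : ℕ → ℕ → ℚ :=
  momentTable [[16094/2697, 47946865/7273809], [32188/899, 3879716354/44451055],
    [965640/6293, 39241870280/62231477], [1287520/2697, 246690444400/80011899],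
    [9656400/9889, 1002712735800/97792321]]

set_option maxRecDepth 100000 in
lemma isCandidate₁₀ : IsCandidate 3 2 dual₁₀ moment₁₀ 3 0 :=
  ⟨by decide +kernel⟩

/-- The coefficients of the weights of the function values for `moment₁₀`. -/
def functionCoeff₁₀ (K : Type*) [Field K] : Fin 4 → Fin 3 → K :=
  ![![-14335/8091, 67795975/26670633, 14201025431705/4747426015266],
    ![1065/1798, -79866475/35560844, -4626851267795/2109967117896],
    ![519/1798, 16456115/17780422, 501398734735/1054983558948],
    ![79/16182, 5270785/106682532, 4214433321515/18989704061064]]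

/-- The coefficients of the weights of the second derivatives for `moment₁₀`. -/
def operatorCoeff₁₀ (K : Type*) [Field K] : Fin 2 → Fin 3 → K :=
  ![![-334/899, -21525725/26670633, -771306629605/1582475338422],
    ![-43/1798, -3822325/26670633, -578232844745/1582475338422]]

lemma functionCoeff₁₀_cast (j : Fin 4) (r : Fin 3) :
    functionCoeff₁₀ ℝ j r = functionCoeff₁₀ ℚ j r := by
  fin_cases j <;> fin_cases r <;> simp [functionCoeff₁₀]

lemma operatorCoeff₁₀_cast (k : Fin 2) (r : Fin 3) :
    operatorCoeff₁₀ ℝ k r = operatorCoeff₁₀ ℚ k r := by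
  fin_cases k <;> fin_cases r <;> simp [operatorCoeff₁₀]

lemma hasExpansion₁₀ {T : (ℝ → ℝ) → ℝ → ℝ} (hS : Scales T)
    (hT : Expands T (4 * (3 + 2) + 2 * 3) 0) :
    HasExpansion T 3 2 3 (functionCoeff₁₀ ℝ) (operatorCoeff₁₀ ℝ)
      (619/299043360) (errorCoeff₁₀ ℝ)
      ![-14335/8091, 1065/1798, 519/1798, 79/16182] ![-334/899, -43/1798] :=
  isDual₁₀.hasExpansion (by norm_num) (by norm_num) (by norm_num)
    hS hT isCandidate₁₀
    (fun j r => (functionCoeff₁₀_cast j r).trans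
      (congrArg Rat.cast (by revert j r; decide +kernel)))
    (fun k r => (operatorCoeff₁₀_cast k r).trans
      (congrArg Rat.cast (by revert k r; decide +kernel)))
    functionFlat₁₀ operatorFlat₁₀
    (fun s => cast_mul_natCast_eq (κ := 619/299043360 * errorCoeff₁₀ ℚ s)
      (by rw [errorCoeff₁₀_cast]; norm_num) (by revert s; decide +kernel))

end RBFHFD

/-! ### The theorem for all four orders. -/

theorem mainTheorem2 :
    -- order 4
    (RBFHFD.HasExpansion id 1 1 4
      ![![-12/5, -84/125, 3021/3125, 92969/234375],
        ![6/5, 42/125, -3021/6250, -92969/468750]]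
      ![![-1/10, -26250/156250, -16925/156250, -651/156250]]
      (-1/200) ![1, 28, 140]
      ![-12/5, 6/5] ![-1/10] ∧
    RBFHFD.IsCompactFD 1 1 ![-12/5, 6/5] ![-1/10] (-1/200)) ∧
    -- order 6
    (RBFHFD.HasExpansion id 2 1 4
      ![![-51/22, 621/1694, 2841651/1304380, 5555227/14348180],
        ![12/11, -414/847, -538116/326095, -4542297/7174090],
        ![3/44, 1035/3388, 1463277/2608760, 12613961/28696360]]
      ![![-2/11, -79381958040/216542732560, -64254114540/216542732560,
          -8624761068/216542732560]]
      (23/55440) ![1, 54, 756, 2520]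
      ![-51/22, 12/11, 3/44] ![-2/11] ∧
    RBFHFD.IsCompactFD 2 1 ![-51/22, 12/11, 3/44] ![-2/11] (23/55440)) ∧
    -- order 8, all elements of the system expanded up to order eighteen
    (RBFHFD.HasExpansion (RBFHFD.taylorTruncation 18) 2 2 3
      ![![-265/131, 257224/154449, 374495573482511/163157452416],
        ![320/393, -723008/463347, -131554452784583/61184044656],
        ![155/786, 337172/463347, 981384524105795/978944714496]]
      ![![-344/1179, -862048/1390041, -313528367747261/367104267936],
        ![-23/2358, -76472/1390041, -111386667913345/1468417071744]]
      (-79/2971080) ![1, 88, 2376, 22176, 55440]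
      ![-265/131, 320/393, 155/786] ![-344/1179, -23/2358] ∧
    -- order 8, the system without truncation
    RBFHFD.HasExpansion id 2 2 3
      ![![-265/131, 257224/154449, 144176866/47209911],
        ![320/393, -723008/463347, -347214464/141629733],
        ![155/786, 337172/463347, 130949165/141629733]]
      ![![-344/1179, -862048/1390041, -207500044/424889199],
        ![-23/2358, -76472/1390041, -57373250/424889199]]
      (-79/2971080) ![1, 88, 2376, 22176, 55440]
      ![-265/131, 320/393, 155/786] ![-344/1179, -23/2358] ∧
    RBFHFD.IsCompactFD 2 2 ![-265/131, 320/393, 155/786] ![-344/1179, -23/2358]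
      (-79/2971080)) ∧
    -- order 10: the system without truncation, and all its elements expanded up to order
    -- twenty-four
    ((∀ T ∈ ({id, RBFHFD.taylorTruncation 24} : Set ((ℝ → ℝ) → ℝ → ℝ)),
      RBFHFD.HasExpansion T 3 2 3
        ![![-14335/8091, 67795975/26670633, 14201025431705/4747426015266],
          ![1065/1798, -79866475/35560844, -4626851267795/2109967117896],
          ![519/1798, 16456115/17780422, 501398734735/1054983558948],
          ![79/16182, 5270785/106682532, 4214433321515/18989704061064]]
        ![![-334/899, -21525725/26670633, -771306629605/1582475338422],
          ![-43/1798, -3822325/26670633, -578232844745/1582475338422]]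
        (619/299043360) ![1, 130, 5720, 102960, 720720, 1441440]
        ![-14335/8091, 1065/1798, 519/1798, 79/16182] ![-334/899, -43/1798]) ∧
    RBFHFD.IsCompactFD 3 2 ![-14335/8091, 1065/1798, 519/1798, 79/16182] ![-334/899, -43/1798]
      (619/299043360)) := by
  refine ⟨⟨RBFHFD.hasExpansion₄, RBFHFD.isCompactFD₄⟩, ⟨RBFHFD.hasExpansion₆, RBFHFD.isCompactFD₆⟩,
    ⟨RBFHFD.hasExpansion₈_eighteen, RBFHFD.hasExpansion₈, RBFHFD.isCompactFD₈⟩,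
    fun T hT => ?_, RBFHFD.isCompactFD₁₀⟩
  rcases hT with rfl | rfl
  · exact RBFHFD.hasExpansion₁₀ RBFHFD.scales_id (RBFHFD.expands_id _)
  · exact RBFHFD.hasExpansion₁₀ (RBFHFD.scales_taylorTruncation 24)
      RBFHFD.expands_taylorTruncation_twentyFour
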